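/- **Theorem (convergence of the moment-SOS hierarchies for algebraic Sobolev POPs).** Let $n,m\ge 1$ be integers, $T^n=\mathbb R^n/\mathbb Z^n$ with its normalized Lebesgue measure, and $e_a(x)=e^{-2\pi i\langle a,x\rangle}$ for $a\in\mathbb Z^n$. For $f\in L^2(T^n)$ put $c_a(f)=\int_{T^n} f\,e_a\,dx$, so that $f=\sum_a c_a(f)\,e_{-a}$. Let $H^m(T^n)$ be the space of $f\in L^2(T^n)$ whose weak derivatives $D^bf$ of order $|b|=b_1+\dots+b_n\le m$ are in $L^2(T^n)$, with either of the two equivalent norms $$\|f\|^2=\sum_{a}(1+\langle a,a\rangle)^m|c_a(f)|^2\quad\text{or}\quad \|f\|^2=\sum_{|b|\le m}\int_{T^n}|D^bf|^2dx ,$$ and let $w_a=(1+\langle a,a\rangle)^m$, respectively $w_a=\sum_{|b|\le m}\prod_i(2\pi a_i)^{2b_i}$, be the corresponding weights. Let $B$ be the set of real-valued $f\in H^m(T^n)$ with $\|f\|\le1$ and $E=\{(c_a(f))_{a}:f\in B\}\subset\ell_2(\mathbb Z^n)$. *The problem.* Let $a_1,\dots,a_l\in\mathbb N^n$ ($l\ge0$),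 $s=\max_j|a_j|$ ($s=0$ if $l=0$), and assume $m>s+n/2$. Let $p$ be a real polynomial in $l+1$ variables of degree $d_p$ whose coefficients are bounded measurable functions on $T^n$, and let $L:L^\infty(T^n)\to\mathbb R$ be a bounded linear functional. Put $$p^*=\inf_{f\in B}L\big(p(f,D^{a_1}f,\dots,D^{a_l}f)\big).$$ *Polynomials.* Let $\mathbb C[c]$ be the ring of complex polynomials in the variables $c_a$, $a\in\mathbb Z^n$, with the conjugate-linear involution determined by $c_a^*=c_{-a}$ (so that $|c_a|^2=c_ac_{-a}$). Its monomials $c^\beta=\prod_{a\in\beta}c_a$ are indexed by the finite multisets $\beta$ in $\mathbb Z^n$; let $d_\beta$ be the number of elements of $\beta$ and $\delta_\beta=\max_{a\in\beta}\max_i|a_i|$. Let $q_\beta$ be the coefficient of $c^\beta$ obtained by substituting $f=\sum_a c_ae_{-a}$, $D^{b}f=\sum_a\prod_i(2\pi i\,a_i)^{b_i}\,c_ae_{-a}$ in $p(f,D^{a_1}f,\dots,D^{a_l}f)$, expanding, and applying (the complex-linear extension of) $L$ to the coefficients. Let $A_{r,\rho}=\{\beta:d_\beta\le r,\ \delta_\beta\le\rho\}$,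 let $\mathbb C[c]_{r,\rho}$ be the span of $c^\beta$, $\beta\in A_{r,\rho}$, let $\Sigma_{r,\rho}$ be the set of finite sums $\sum_kq_k^*q_k$ with $q_k\in\mathbb C[c]_{r,\rho}$ ($\Sigma_{-1,\rho}=\{0\}$), and $$Q_{r,\rho}=\Big\{s_0+s_1\Big(1-\sum_{\max_i|a_i|\le\rho}w_a|c_a|^2\Big):s_0\in\Sigma_{r,\rho},\ s_1\in\Sigma_{r-1,\rho}\Big\},\qquad Q_{\infty,\infty}=\bigcup_{r,\rho\in\mathbb N}Q_{r,\rho}.$$ *Hierarchies.* Let $\gamma$ be a locally finite Borel measure on $\ell_2(\mathbb Z^n)$ which is strictly positive on every nonempty relatively open subset of $E$. Let $A_{\infty,\infty}$ be the set of all finite multisets. For $r,\rho\in\mathbb N$ and for $r=\rho=\infty$, let $p^{\rm out}_{r,\rho}$ be the infimum of $\sum_{\beta\in A_{r,\rho}}q_\beta y_\beta$ over all complex families $y=(y_\beta)_\beta$ with $y_\emptyset=1$ and $\ell_y(g)=\sum_\beta g_\beta y_\beta\ge0$ for all $g\in Q_{r,\rho}$, and let $p^{\rm inn}_{r,\rho}$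 be the infimum of the same sum over all $y$ of the form $y_\beta=\int_Ec^\beta g(c)\,d\gamma(c)$ with $g\in Q_{r,\rho}$ and $y_\emptyset=1$ (infima in $[-\infty,\infty]$). Then the objective is well defined: $p(f,D^{a_1}f,\dots,D^{a_l}f)\in L^\infty(T^n)$ for all $f\in B$. Moreover, for $f\in B$ it is a polynomial of finite algebraic degree in the Fourier coefficients: $q_\beta=0$ if $d_\beta>d_p$, and, with unconditional convergence, $$L\big(p(f,D^{a_1}f,\dots,D^{a_l}f)\big)=\sum_\beta q_\beta\prod_{a\in\beta}c_a(f).$$ The value $p^*$ is finite, and $$p^{\rm out}_{\infty,\infty}=p^*=p^{\rm inn}_{\infty,\infty},\qquad \lim_{r,\rho\to\infty}p^{\rm out}_{r,\rho}=p^*=\lim_{r,\rho\to\infty}p^{\rm inn}_{r,\rho},$$ where $r$ and $\rho$ tend to infinity jointly (and independently of each other). -/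

import Mathlib

open MeasureTheory Filter Topology
open scoped ENNReal

noncomputable section

namespace SobolevPOP

/-! ### The torus, Fourier coefficients, weak derivatives -/

/-- The torus `T^n = (ℝ/ℤ)^n`. -/
abbrev Torus (n : ℕ) : Type := UnitAddTorus (Fin n)

/-- Normalized Haar (Lebesgue) measure on `T^n`. -/
abbrev torusMeasure (n : ℕ) : Measure (Torus n) :=
  Measure.pi fun _ : Fin n => (AddCircle.haarAddCircle : Measure UnitAddCircle)

/-- The space `L²(T^n; ℂ)`. -/
abbrev L2 (n : ℕ) : Type := Lp ℂ 2 (torusMeasure n)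

/-- The space `L^∞(T^n; ℝ)`. -/
abbrev LInf (n : ℕ) : Type := Lp ℝ ∞ (torusMeasure n)

/-- The space `ℓ₂(ℤ^n)` of square summable complex sequences. -/
abbrev EllTwo (n : ℕ) : Type := lp (fun _ : Fin n → ℤ => ℂ) 2

instance (n : ℕ) : MeasurableSpace (EllTwo n) := borel _

instance (n : ℕ) : BorelSpace (EllTwo n) := ⟨rfl⟩

/-- `c_a = ∫ f(x) e^{-2πi⟨a,x⟩} dx`. -/
def fourierCoeff {n : ℕ} (f : L2 n) (a : Fin n → ℤ) : ℂ :=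
  ∫ x, f x * UnitAddTorus.mFourier (-a) x ∂(torusMeasure n)

/-- The order `|b| = b_1 + ... + b_n` of a multi-index. -/
def order {n : ℕ} (b : Fin n → ℕ) : ℕ := ∑ i, b i

/-- The quotient map `ℝ^n → T^n`. -/
def toTorus {n : ℕ} (x : Fin n → ℝ) : Torus n := fun i => (x i : UnitAddCircle)

/-- The classical partial derivative `∂u/∂x_i` of a function on `ℝ^n`. -/
def partialD {n : ℕ} (i : Fin n) (u : (Fin n → ℝ) → ℂ) : (Fin n → ℝ) → ℂ :=
  fun x => fderiv ℝ u x (Pi.single i 1)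

/-- The classical iterated derivative `∂^{|b|}u / ∂x_1^{b_1} ... ∂x_n^{b_n}`. -/
def classicalD {n : ℕ} (b : Fin n → ℕ) (u : (Fin n → ℝ) → ℂ) : (Fin n → ℝ) → ℂ :=
  (List.finRange n).foldr (fun i v => (partialD i)^[b i] v) u

/-- `g` is the weak derivative `D^b f` on the torus:
`∫ g φ = (-1)^{|b|} ∫ f D^b φ` for every smooth function `φ` on `T^n`
(`ψ` is `D^b φ`, seen as a function on `T^n`). -/
def HasWeakDeriv {n : ℕ} (b : Fin n → ℕ) (f g : L2 n) : Prop :=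
  ∀ φ ψ : Torus n → ℂ, ContDiff ℝ (⊤ : ℕ∞) (fun x : Fin n → ℝ => φ (toTorus x)) →
    (∀ x, ψ (toTorus x) = classicalD b (fun x => φ (toTorus x)) x) →
    ∫ x, g x * φ x ∂(torusMeasure n) = (-1) ^ order b * ∫ x, f x * ψ x ∂(torusMeasure n)

open Classical in
/-- The weak derivative `D^b f ∈ L²` (and `0` if it does not exist in `L²`). -/
def weakDeriv {n : ℕ} (b : Fin n → ℕ) (f : L2 n) : L2 n :=
  if h : ∃ g, HasWeakDeriv b f g then h.choose else 0

/-! ### The Sobolev space, its norms, and the unit ball -/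

/-- Membership in `H^m(T^n)`: all weak derivatives of order at most `m` are in `L²`. -/
def MemSobolev {n : ℕ} (m : ℕ) (f : L2 n) : Prop :=
  ∀ b : Fin n → ℕ, order b ≤ m → ∃ g, HasWeakDeriv b f g

/-- The multi-indices of order at most `m`. -/
def multiIndices (n m : ℕ) : Finset (Fin n → ℕ) :=
  (Fintype.piFinset fun _ => Finset.range (m + 1)).filter fun b => order b ≤ m

/-- The two customary (equivalent) norms of `H^m(T^n)`. -/
inductive SobolevNorm
  /-- `‖f‖² = ∑_{|b| ≤ m} ∫ |D^b f|²` -/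
  | derivative
  /-- `‖f‖² = ∑_a (1 + |a|²)^m |c_a|²` -/
  | fourier

/-- The weights `w_a` for which the squared norm is `∑_a w_a |c_a|²`. -/
def weight {n : ℕ} (m : ℕ) : SobolevNorm → (Fin n → ℤ) → ℝ
  | .derivative, a => ∑ b ∈ multiIndices n m, ∏ i, (2 * Real.pi * (a i : ℝ)) ^ (2 * b i)
  | .fourier, a => (1 + ∑ i, (a i : ℝ) ^ 2) ^ m

/-- The squared norm of an element of `H^m(T^n)`. -/
def normSq {n : ℕ} (m : ℕ) : SobolevNorm → L2 n → ℝ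
  | .derivative, f => ∑ b ∈ multiIndices n m, ∫ x, ‖weakDeriv b f x‖ ^ 2 ∂(torusMeasure n)
  | .fourier, f => ∑' a : Fin n → ℤ, (1 + ∑ i, (a i : ℝ) ^ 2) ^ m * ‖fourierCoeff f a‖ ^ 2

/-- The closed unit ball `B` of real-valued functions of `H^m(T^n)`. -/
def ball (n m : ℕ) (N : SobolevNorm) : Set (L2 n) :=
  {f | (∀ᵐ x ∂(torusMeasure n), (f x).im = 0) ∧ MemSobolev m f ∧ normSq m N f ≤ 1}

/-- The set `E = F B ⊆ ℓ₂(ℤ^n)` of Fourier coefficients of elements of `B`. -/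
def ellipsoid (n m : ℕ) (N : SobolevNorm) : Set (EllTwo n) :=
  {c | ∃ f ∈ ball n m N, ∀ a, c a = fourierCoeff f a}

/-! ### The objective `L(p(f, D^{a_1} f, ..., D^{a_l} f))` -/

/-- The multi-indices of the arguments of `p`: `none` stands for `f`, `some j` for `D^{a_j} f`. -/
def argIndex {n l : ℕ} (a : Fin l → Fin n → ℕ) (j : Option (Fin l)) : Fin n → ℕ := j.elim 0 a

/-- The arguments `f, D^{a_1} f, ..., D^{a_l} f` of `p`. -/
def arg {n l : ℕ} (a : Fin l → Fin n → ℕ) (f : L2 n) (j : Option (Fin l)) : L2 n :=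
  j.elim f fun i => weakDeriv (a i) f

/-- Polynomials in `l + 1` variables whose coefficients are real functions on `T^n`. -/
abbrev CoeffPoly (n l : ℕ) : Type := MvPolynomial (Option (Fin l)) (Torus n → ℝ)

/-- The coefficients of `p` are bounded (measurable) functions on `T^n`. -/
def BoundedCoeffs {n l : ℕ} (p : CoeffPoly n l) : Prop :=
  ∀ α, Measurable (p.coeff α) ∧ ∃ M : ℝ, ∀ x, |p.coeff α x| ≤ M

/-- The function `x ↦ p(x, f(x), D^{a_1} f(x), ..., D^{a_l} f(x))`. -/
def integrand {n l : ℕ} (a : Fin l → Fin n → ℕ) (p : CoeffPoly n l) (f : L2 n) (x : Torus n) : ℝ :=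
  p.eval₂ (Pi.evalRingHom (fun _ : Torus n => ℝ) x) fun j => (arg a f j x).re

open Classical in
/-- `L g` for an essentially bounded function `g` (and `0` if `g` is not in `L^∞`). -/
def applyL {n : ℕ} (L : LInf n →L[ℝ] ℝ) (g : Torus n → ℝ) : ℝ :=
  if h : MemLp g ∞ (torusMeasure n) then L (h.toLp g) else 0

/-- The complex-linear extension of `L`. -/
def applyLC {n : ℕ} (L : LInf n →L[ℝ] ℝ) (g : Torus n → ℂ) : ℂ :=
  (applyL L fun x => (g x).re : ℂ) + (applyL L fun x => (g x).im : ℂ) * Complex.I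

/-- The objective function `f ↦ L(p(f, D^{a_1} f, ..., D^{a_l} f))`. -/
def objective {n l : ℕ} (L : LInf n →L[ℝ] ℝ) (a : Fin l → Fin n → ℕ) (p : CoeffPoly n l)
    (f : L2 n) : ℝ := applyL L (integrand a p f)

/-- The optimal value `p* = inf_{f ∈ B} L(p(f, D^{a_1} f, ..., D^{a_l} f))`. -/
def optValue {n l : ℕ} (m : ℕ) (N : SobolevNorm) (L : LInf n →L[ℝ] ℝ) (a : Fin l → Fin n → ℕ)
    (p : CoeffPoly n l) : EReal := ⨅ f ∈ ball n m N, (objective L a p f : EReal)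

/-! ### Polynomials in the Fourier coefficients -/

/-- Indices of monomials: finite multisets of elements of `ℤ^n`, given by multiplicities. -/
abbrev MIndex (n : ℕ) : Type := (Fin n → ℤ) →₀ ℕ

/-- Complex polynomials `ℂ[c]` in the variables `c_a`, `a ∈ ℤ^n`. -/
abbrev FPoly (n : ℕ) : Type := MvPolynomial (Fin n → ℤ) ℂ

/-- The monomial `c^β`. -/
def monomialAt {n : ℕ} (c : (Fin n → ℤ) → ℂ) (β : MIndex n) : ℂ := β.prod fun a k => c a ^ k

/-- The algebraic degree of a monomial index: its number of elements, with multiplicity. -/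
def algDeg {n : ℕ} (β : MIndex n) : ℕ := β.sum fun _ k => k

/-- The harmonic degree of a monomial index: the largest `|a_i|` over its elements `a`. -/
def harmDeg {n : ℕ} (β : MIndex n) : ℕ :=
  β.support.sup fun a => Finset.univ.sup fun i => (a i).natAbs

/-- The frequencies `a ∈ ℤ^n` with `max_i |a_i| ≤ ρ`. -/
def freqBox (n ρ : ℕ) : Finset (Fin n → ℤ) :=
  Fintype.piFinset fun _ => Finset.Icc (-(ρ : ℤ)) (ρ : ℤ)

/-- The factor `(2πi a)^b` by which `D^b` multiplies `e^{2πi⟨a,x⟩}`. -/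
def symbol {n : ℕ} (b : Fin n → ℕ) (a : Fin n → ℤ) : ℂ :=
  ∏ i, (2 * Real.pi * Complex.I * (a i : ℂ)) ^ b i

/-- For fixed `x`, the polynomial in `c` obtained by substituting the trigonometric polynomial
`f = ∑_{max_i |a_i| ≤ ρ} c_a e^{2πi⟨a,·⟩}` and its derivatives into `p(x, ·)`. -/
def substPoly {n l : ℕ} (a : Fin l → Fin n → ℕ) (p : CoeffPoly n l) (ρ : ℕ) (x : Torus n) :
    FPoly n :=
  p.eval₂
    ((MvPolynomial.C.comp Complex.ofRealHom).comp (Pi.evalRingHom (fun _ : Torus n => ℝ) x))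
    fun j => ∑ k ∈ freqBox n ρ,
      MvPolynomial.C (symbol (argIndex a j) k * UnitAddTorus.mFourier k x) * MvPolynomial.X k

/-- The coefficient `q_β` of `c^β` in the objective function, written as a polynomial in the
(infinitely many) Fourier coefficients `c` of `f`. Only frequencies occurring in `β` matter for
it, so that it is enough to substitute harmonics up to the harmonic degree of `β`. -/
def objCoeff {n l : ℕ} (L : LInf n →L[ℝ] ℝ) (a : Fin l → Fin n → ℕ) (p : CoeffPoly n l)
    (β : MIndex n) : ℂ :=
  applyLC L fun x => (substPoly a p (harmDeg β) x).coeff β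

/-! ### Truncated quadratic modules and moment cones -/

/-- The involution `q ↦ q^*` of `ℂ[c]`: it conjugates the coefficients and exchanges `c_a` with
`c_{-a}`, the complex conjugate of `c_a` for a real-valued `f`. -/
def starPoly {n : ℕ} (q : FPoly n) : FPoly n :=
  MvPolynomial.rename (fun a : Fin n → ℤ => -a) (MvPolynomial.map (starRingEnd ℂ) q)

/-- `ℂ[c]_{r,ρ}`: algebraic degree at most `r` and harmonic degree at most `ρ`. -/
def truncPoly (n r ρ : ℕ) : Set (FPoly n) :=
  {q | ∀ β ∈ q.support, algDeg β ≤ r ∧ harmDeg β ≤ ρ}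

/-- Sums `∑_k q_k^* q_k` of Hermitian squares of elements of `K`. -/
def sosCone {n : ℕ} (K : Set (FPoly n)) : Set (FPoly n) :=
  {s | ∃ (M : ℕ) (q : Fin M → FPoly n), (∀ k, q k ∈ K) ∧ s = ∑ k, starPoly (q k) * q k}

/-- The polynomial `1 - ∑_{max_i |a_i| ≤ ρ} w_a |c_a|²`, where `|c_a|² = c_a c_{-a}`. -/
def ellipsoidPoly (n m : ℕ) (N : SobolevNorm) (ρ : ℕ) : FPoly n :=
  1 - ∑ a ∈ freqBox n ρ,
    MvPolynomial.C (weight m N a : ℂ) * (MvPolynomial.X a * MvPolynomial.X (-a))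

/-- The truncated quadratic module `Q_{r,ρ}`: the `s_0 + s_1 (1 - ∑ w_a |c_a|²)` with
`s_0 ∈ Σ_{r,ρ}` and `s_1 ∈ Σ_{r-1,ρ}` (where `Σ_{-1,ρ} = {0}`). -/
def quadModule (n m : ℕ) (N : SobolevNorm) (r ρ : ℕ) : Set (FPoly n) :=
  {t | ∃ s₀ ∈ sosCone (truncPoly n r ρ),
    ∃ s₁ ∈ sosCone {q | q ∈ truncPoly n (r - 1) ρ ∧ (r = 0 → q = 0)},
      t = s₀ + s₁ * ellipsoidPoly n m N ρ}

/-- The quadratic module `Q_{∞,∞} = ⋃_{r,ρ} Q_{r,ρ}`. -/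
def quadModuleTop (n m : ℕ) (N : SobolevNorm) : Set (FPoly n) :=
  ⋃ (r : ℕ) (ρ : ℕ), quadModule n m N r ρ

/-- The index set `A_{r,ρ}`. -/
def indexSet (n r ρ : ℕ) : Set (MIndex n) := {β | algDeg β ≤ r ∧ harmDeg β ≤ ρ}

/-- The linear functional `ℓ_y(p) = ∑_β p_β y_β`. -/
def riesz {n : ℕ} (y : MIndex n → ℂ) (p : FPoly n) : ℂ := ∑ β ∈ p.support, p.coeff β * y β

/-- The outer cone `Π_A {y : ℓ_y(p) ≥ 0 for all p ∈ Q}`. -/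
def outerCone {n : ℕ} (Q : Set (FPoly n)) (A : Set (MIndex n)) : Set (A → ℂ) :=
  (fun (y : MIndex n → ℂ) (β : A) => y β) ''
    {y | ∀ p ∈ Q, 0 ≤ (riesz y p).re ∧ (riesz y p).im = 0}

/-- The inner cone `{(∫_E c^β p(c) dγ(c))_{β ∈ A} : p ∈ Q}`. -/
def innerCone {n : ℕ} (γ : Measure (EllTwo n)) (E : Set (EllTwo n)) (Q : Set (FPoly n))
    (A : Set (MIndex n)) : Set (A → ℂ) :=
  {y | ∃ p ∈ Q, ∀ β : A, y β = ∫ c in E, monomialAt c β * MvPolynomial.eval (c ·) p ∂γ}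

/-- The value `inf ∑_{β ∈ A} q_β y_β` over the `y` in the cone `C` with `y_∅ = 1`. -/
def coneValue {n : ℕ} (q : MIndex n → ℂ) (A : Set (MIndex n)) (C : Set (A → ℂ)) : EReal :=
  ⨅ y ∈ {y ∈ C | ∃ h : (0 : MIndex n) ∈ A, y ⟨0, h⟩ = 1},
    (((∑' β : A, q β * y β).re : ℝ) : EReal)

/-- `p^out_{r,ρ}`. -/
def pOut (n m : ℕ) (N : SobolevNorm) (q : MIndex n → ℂ) (r ρ : ℕ) : EReal :=
  coneValue q (indexSet n r ρ) (outerCone (quadModule n m N r ρ) (indexSet n r ρ))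

/-- `p^inn_{r,ρ}`, for the reference measure `γ`. -/
def pInn (n m : ℕ) (N : SobolevNorm) (γ : Measure (EllTwo n)) (q : MIndex n → ℂ) (r ρ : ℕ) :
    EReal :=
  coneValue q (indexSet n r ρ)
    (innerCone γ (ellipsoid n m N) (quadModule n m N r ρ) (indexSet n r ρ))

/-- `p^out_{∞,∞}`. -/
def pOutTop (n m : ℕ) (N : SobolevNorm) (q : MIndex n → ℂ) : EReal :=
  coneValue q Set.univ (outerCone (quadModuleTop n m N) Set.univ)

/-- `p^inn_{∞,∞}`, for the reference measure `γ`. -/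
def pInnTop (n m : ℕ) (N : SobolevNorm) (γ : Measure (EllTwo n)) (q : MIndex n → ℂ) : EReal :=
  coneValue q Set.univ (innerCone γ (ellipsoid n m N) (quadModuleTop n m N) Set.univ)

end SobolevPOP

end

/-! ### Positivity certificates in Archimedean quadratic modules -/

/-! Taking Fourier coefficients turns the ball into the ellipsoid `E` of Hermitian sequences with `∑
w_a |c_a|² ≤ 1`. The condition `m > s + n/2` says that `∑_k ‖symbol b k‖² / w_k` converges for every
derivative `D^b` that occurs. By Cauchy-Schwarz the Fourier series of these derivatives then
converge absolutely, uniformly over the ball, so the objective is an absolutely convergent series of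
monomials in `c` (`objective_expansion`), and `E` is compact in `ℓ₂` (`isCompact_ellipsoid`).

The algebraic input is Putinar's theorem. It is proved for an arbitrary Archimedean quadratic module
(`mem_of_pos`): a maximal quadratic module defines a cut at each element, and the cuts form a real
point. The module `Q_{∞,∞}` is Archimedean, and the real points of the Hermitian polynomials that
are nonnegative on it are evaluations at points of the ellipsoid. So a Hermitian polynomial that is
positive on the ellipsoid lies in some `Q_{r,ρ}`, although there are infinitely many variables
(`exists_mem_quadModule_of_pos`).

For the lower bound, Cauchy-Schwarz itself has a sum-of-squares certificate of degree one
(`quadModule_linearForm`), and such bounds pass to sums and products with controlled degree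
(`Dominated`). Hence, for every pseudo-moment functional of level `(r, ρ)` with `r ≥ d_p`, replacing
the truncation of the objective at `ρ` by one at a fixed `ρ₁ ≤ ρ` costs at most `ε`
(`exists_tail_le`). The truncation at `ρ₁` exceeds `p^* - ε` strictly on the ellipsoid, since
truncated sequences stay in it; Putinar's theorem gives a certificate of a fixed level, which bounds
all later outer values from below.

For the upper bound, let `X` be a truncated objective minus `p^*`. The Hermitian square `(1 -
X/K)^(2k)`, normalized, is an admissible density which concentrates where `X` is small, and `γ`
charges that set (`exists_density`). Moments of admissible densities are pseudo-moments, so outer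
values never exceed inner ones, and both are squeezed to `p^*`. At `r = ρ = ∞` one also needs the
series of the objective to be summable for every pseudo-moment family, which again follows from
Putinar's theorem (`IsState.summable`). -/

/-- A quadratic module of a commutative `ℝ`-algebra. -/
structure IsQuadModule {A : Type*} [CommRing A] (M : Set A) : Prop where
  one_mem : 1 ∈ M
  add_mem : ∀ {x y}, x ∈ M → y ∈ M → x + y ∈ M
  sq_mul_mem : ∀ (a : A) {x}, x ∈ M → a ^ 2 * x ∈ M

/-- Every element is bounded above modulo `M`. -/
def IsArchimedeanModule {A : Type*} [CommRing A] [Algebra ℝ A] (M : Set A) : Prop :=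
  ∀ a : A, ∃ r : ℝ, algebraMap ℝ A r - a ∈ M

namespace IsQuadModule

variable {A : Type*} [CommRing A] {M : Set A}

lemma sq_mem (hM : IsQuadModule M) (a : A) : a ^ 2 ∈ M := by
  simpa using hM.sq_mul_mem a hM.one_mem

lemma zero_mem (hM : IsQuadModule M) : (0 : A) ∈ M := by
  simpa using hM.sq_mem 0

/-- Sums of squares. -/
def Sos (A : Type*) [CommRing A] : Set A := {s | ∀ N : Set A, IsQuadModule N → s ∈ N}

lemma isQuadModule_sos : IsQuadModule (Sos A) where
  one_mem := fun _ hN => hN.one_mem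
  add_mem := fun hx hy N hN => hN.add_mem (hx N hN) (hy N hN)
  sq_mul_mem := fun a _ hx N hN => hN.sq_mul_mem a (hx N hN)

/-- `Sos` is the smallest quadratic module, so it suffices that the multipliers mapping `M` into
itself form a quadratic module. -/
lemma sos_mul_mem (hM : IsQuadModule M) {s x : A} (hs : s ∈ Sos A) (hx : x ∈ M) : s * x ∈ M := by
  have h : IsQuadModule {s : A | ∀ x ∈ M, s * x ∈ M} :=
    ⟨fun x hx => by simpa using hx,
      fun h1 h2 x hx => by rw [add_mul]; exact hM.add_mem (h1 x hx) (h2 x hx),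
      fun a s h x hx => by rw [mul_assoc]; exact hM.sq_mul_mem a (h x hx)⟩
  exact hs _ h x hx

/-- The quadratic module generated by `M` and `f`. -/
def adjoin (M : Set A) (f : A) : Set A := {x | ∃ m ∈ M, ∃ s ∈ Sos A, x = m + s * f}

lemma isQuadModule_adjoin (hM : IsQuadModule M) (f : A) : IsQuadModule (adjoin M f) where
  one_mem := ⟨1, hM.one_mem, 0, isQuadModule_sos.zero_mem, by simp⟩
  add_mem := by
    rintro _ _ ⟨m, hm, s, hs, rfl⟩ ⟨m', hm', s', hs', rfl⟩
    exact ⟨m + m', hM.add_mem hm hm', s + s', isQuadModule_sos.add_mem hs hs', by ring⟩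
  sq_mul_mem := by
    rintro a _ ⟨m, hm, s, hs, rfl⟩
    exact ⟨a ^ 2 * m, hM.sq_mul_mem a hm, a ^ 2 * s, isQuadModule_sos.sq_mul_mem a hs, by ring⟩

lemma subset_adjoin (M : Set A) (f : A) : M ⊆ adjoin M f :=
  fun m hm => ⟨m, hm, 0, isQuadModule_sos.zero_mem, by simp⟩

lemma mem_adjoin (hM : IsQuadModule M) (f : A) : f ∈ adjoin M f :=
  ⟨0, hM.zero_mem, 1, isQuadModule_sos.one_mem, by simp⟩

lemma exists_maximal (hM : IsQuadModule M) (h : (-1 : A) ∉ M) :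
    ∃ S : Set A, IsQuadModule S ∧ M ⊆ S ∧ (-1 : A) ∉ S ∧
      ∀ T, IsQuadModule T → S ⊆ T → (-1 : A) ∉ T → T = S := by
  obtain ⟨S, hMS, hS⟩ := zorn_subset_nonempty {T : Set A | IsQuadModule T ∧ (-1 : A) ∉ T}
    (fun c hc hchain hne => by
      refine ⟨⋃₀ c, ⟨⟨?_, ?_, ?_⟩, ?_⟩, fun s hs => Set.subset_sUnion_of_mem hs⟩
      · obtain ⟨T, hT⟩ := hne
        exact ⟨T, hT, (hc hT).1.one_mem⟩
      · rintro x y ⟨T, hT, hx⟩ ⟨T', hT', hy⟩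
        rcases hchain.total hT hT' with h | h
        · exact ⟨T', hT', (hc hT').1.add_mem (h hx) hy⟩
        · exact ⟨T, hT, (hc hT).1.add_mem hx (h hy)⟩
      · rintro a x ⟨T, hT, hx⟩
        exact ⟨T, hT, (hc hT).1.sq_mul_mem a hx⟩
      · rintro ⟨T, hT, hx⟩
        exact (hc hT).2 hx) M ⟨hM, h⟩
  exact ⟨S, hS.1.1, hMS, hS.1.2, fun T hT hST h1 => (hS.eq_of_subset ⟨hT, h1⟩ hST).symm⟩

variable [Algebra ℝ A]

lemma smul_mem (hM : IsQuadModule M) {r : ℝ} (hr : 0 ≤ r) {x : A} (hx : x ∈ M) :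
    algebraMap ℝ A r * x ∈ M := by
  have := hM.sq_mul_mem (algebraMap ℝ A (√r)) hx
  rwa [← map_pow, Real.sq_sqrt hr] at this

lemma algebraMap_mem (hM : IsQuadModule M) {r : ℝ} (hr : 0 ≤ r) : algebraMap ℝ A r ∈ M := by
  simpa using hM.smul_mem hr hM.one_mem

lemma of_smul_mem (hM : IsQuadModule M) {r : ℝ} (hr : 0 < r) {x : A}
    (hx : algebraMap ℝ A r * x ∈ M) : x ∈ M := by
  have := hM.smul_mem (inv_nonneg.2 hr.le) hx
  rwa [← mul_assoc, ← map_mul, inv_mul_cancel₀ hr.ne', map_one, one_mul] at this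

/-- The support of a quadratic module is an ideal. -/
lemma mul_mem_support (hM : IsQuadModule M) (a : A) {x : A} (hx : x ∈ M) (hx' : -x ∈ M) :
    a * x ∈ M := by
  -- Polarization: `4ax = (a+1)² x + (a-1)² (-x)`.
  have h1 := hM.sq_mul_mem (a + 1) hx
  have h2 := hM.sq_mul_mem (a - 1) hx'
  have h := hM.add_mem h1 h2
  refine hM.of_smul_mem (r := 4) (by norm_num) ?_
  convert h using 1
  rw [show (4 : ℝ) = ((4 : ℕ) : ℝ) by norm_num, map_natCast]
  push_cast
  ring

/-- If both memberships fail, maximality gives `-1 = m₁ + s₁ a = m₂ - s₂ a`. Eliminating `a` yields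
`-(s₁ + s₂) ∈ M`, so `s₁` lies in the support, which is an ideal; then `s₁ a ∈ M` and the first
equation puts `-1` into `M`. -/
lemma total_of_maximal (hM : IsQuadModule M) (h : (-1 : A) ∉ M)
    (hmax : ∀ T, IsQuadModule T → M ⊆ T → (-1 : A) ∉ T → T = M) (a : A) : a ∈ M ∨ -a ∈ M := by
  by_contra! hcon
  have key : ∀ b, b ∉ M → (-1 : A) ∈ adjoin M b := fun b hb => by
    by_contra hb'
    have := hmax _ (hM.isQuadModule_adjoin b) (subset_adjoin M b) hb'
    exact hb (this ▸ hM.mem_adjoin b)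
  obtain ⟨m₁, hm₁, s₁, hs₁, h₁⟩ := key a hcon.1
  obtain ⟨m₂, hm₂, s₂, hs₂, h₂⟩ := key (-a) hcon.2
  have h3 : -(s₁ + s₂) ∈ M := by
    have : -(s₁ + s₂) = s₂ * m₁ + s₁ * m₂ := by linear_combination s₂ * h₁ + s₁ * h₂
    rw [this]
    exact hM.add_mem (hM.sos_mul_mem hs₂ hm₁) (hM.sos_mul_mem hs₁ hm₂)
  have h4 : -s₁ ∈ M := by
    have := hM.add_mem h3 (hs₂ M hM)
    rwa [neg_add, neg_add_cancel_right] at this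
  have h5 : a * s₁ ∈ M := hM.mul_mem_support a (hs₁ M hM) h4
  apply h
  rw [h₁, mul_comm]
  exact hM.add_mem hm₁ h5

/-- Follows from `2r (r² - a²) = (r-a)² (r+a) + (r+a)² (r-a)`. -/
lemma sq_bound (hM : IsQuadModule M) {r : ℝ} (hr : 0 < r) {a : A}
    (h₁ : algebraMap ℝ A r - a ∈ M) (h₂ : algebraMap ℝ A r + a ∈ M) :
    algebraMap ℝ A (r ^ 2) - a ^ 2 ∈ M := by
  have h := hM.add_mem (hM.sq_mul_mem (algebraMap ℝ A r - a) h₂)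
    (hM.sq_mul_mem (algebraMap ℝ A r + a) h₁)
  refine hM.of_smul_mem (r := 2 * r) (by positivity) ?_
  convert h using 1
  rw [map_mul, map_pow, show (2 : ℝ) = ((2 : ℕ) : ℝ) by norm_num, map_natCast]
  push_cast
  ring

/-- An Archimedean quadratic module without `-1` has a real point. -/
lemma exists_algHom (hM : IsQuadModule M) (hA : IsArchimedeanModule M) (h : (-1 : A) ∉ M) :
    ∃ φ : A →ₐ[ℝ] ℝ, ∀ x ∈ M, 0 ≤ φ x := by
  obtain ⟨S, hS, hMS, h1, hmax⟩ := hM.exists_maximal h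
  have htot := hS.total_of_maximal h1 hmax
  have harch : IsArchimedeanModule S := fun a => (hA a).imp fun r hr => hMS hr
  have hneg : ∀ {r : ℝ}, algebraMap ℝ A r ∈ S → 0 ≤ r := by
    intro r hr
    by_contra! hlt
    refine h1 (hS.of_smul_mem (r := -r) (by linarith) ?_)
    simpa using hr
  -- The point is the cut `α a = inf {r | r - a ∈ S}`; the Archimedean property makes the set
  -- nonempty, and `-1 ∉ S` bounds it below.
  set U : A → Set ℝ := fun a => {r | algebraMap ℝ A r - a ∈ S} with hU
  have hne : ∀ a, (U a).Nonempty := fun a => harch a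
  have hbdd : ∀ a, BddBelow (U a) := fun a => by
    obtain ⟨t, ht⟩ := harch (-a)
    refine ⟨-t, fun r hr => ?_⟩
    have := hS.add_mem ht hr
    have h2 : algebraMap ℝ A (t + r) ∈ S := by
      convert this using 1
      rw [map_add]; ring
    linarith [hneg h2]
  set α : A → ℝ := fun a => sInf (U a) with hα
  have hle : ∀ {a : A} {r : ℝ}, algebraMap ℝ A r - a ∈ S → α a ≤ r :=
    fun {a r} hr => csInf_le (hbdd a) hr
  have hgt : ∀ {a : A} {r : ℝ}, α a < r → algebraMap ℝ A r - a ∈ S := by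
    intro a r hr
    obtain ⟨t, ht, htr⟩ := exists_lt_of_csInf_lt (hne a) hr
    have := hS.add_mem ht (hS.algebraMap_mem (sub_nonneg.2 htr.le))
    convert this using 1
    rw [map_sub]; ring
  -- Totality of `S` makes the cut two-sided: `α a` is also a supremum of lower bounds, which yields
  -- both inequalities in additivity.
  have hlt : ∀ {a : A} {r : ℝ}, r < α a → a - algebraMap ℝ A r ∈ S := by
    intro a r hr
    rcases htot (a - algebraMap ℝ A r) with h | h
    · exact h
    · rw [neg_sub] at h
      exact absurd (hle h) (not_le.2 hr)
  have hge : ∀ {a : A} {r : ℝ}, a - algebraMap ℝ A r ∈ S → r ≤ α a := by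
    intro a r hr
    refine le_csInf (hne a) fun t ht => ?_
    have := hS.add_mem hr ht
    have h2 : algebraMap ℝ A (t - r) ∈ S := by
      convert this using 1
      rw [map_sub]; ring
    linarith [hneg h2]
  have hconst : ∀ r : ℝ, α (algebraMap ℝ A r) = r := fun r =>
    le_antisymm (hle (by simpa using hS.zero_mem)) (hge (by simpa using hS.zero_mem))
  have hadd : ∀ a b, α (a + b) = α a + α b := by
    intro a b
    apply le_antisymm
    · refine le_of_forall_pos_le_add fun ε hε => ?_
      have h1 := hgt (show α a < α a + ε / 2 by linarith)
      have h2 := hgt (show α b < α b + ε / 2 by linarith)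
      have := hS.add_mem h1 h2
      have h3 : algebraMap ℝ A (α a + α b + ε) - (a + b) ∈ S := by
        convert this using 1
        rw [show α a + α b + ε = (α a + ε / 2) + (α b + ε / 2) by ring, map_add]; ring
      exact hle h3
    · refine le_of_forall_sub_le fun ε hε => ?_
      have h1 := hlt (show α a - ε / 2 < α a by linarith)
      have h2 := hlt (show α b - ε / 2 < α b by linarith)
      have := hS.add_mem h1 h2
      have h3 : (a + b) - algebraMap ℝ A (α a + α b - ε) ∈ S := by
        convert this using 1
        rw [show α a + α b - ε = (α a - ε / 2) + (α b - ε / 2) by ring, map_add]; ring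
      exact hge h3
  -- Infinitesimals have infinitesimal squares: `±a ≤ √ε` modulo `S` gives `a² ≤ ε`.
  have hsq0 : ∀ a, α a = 0 → α (a ^ 2) = 0 := by
    intro a ha
    apply le_antisymm
    · refine le_of_forall_pos_le_add fun ε hε => ?_
      have hr : 0 < √ε := Real.sqrt_pos.2 hε
      have h1 : algebraMap ℝ A (√ε) - a ∈ S := hgt (by rw [ha]; exact hr)
      have h2 : algebraMap ℝ A (√ε) + a ∈ S := by
        have := hlt (show -√ε < α a by rw [ha]; linarith)
        rwa [map_neg, sub_neg_eq_add, add_comm] at this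
      have h3 := hS.sq_bound hr h1 h2
      rw [Real.sq_sqrt hε.le] at h3
      simpa using hle h3
    · exact hge (by simpa using hS.sq_mem a)
  have hαneg : ∀ a, α (-a) = -α a := fun a => by
    have := hadd a (-a)
    rw [add_neg_cancel, show (0 : A) = algebraMap ℝ A 0 by simp, hconst] at this
    linarith
  have hsmul : ∀ (r : ℝ) a, α (algebraMap ℝ A r * a) = r * α a := by
    have hpos : ∀ (r : ℝ) a, 0 ≤ r → α (algebraMap ℝ A r * a) = r * α a := by
      intro r a hr
      apply le_antisymm
      · rcases hr.eq_or_lt with rfl | hr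
        · simpa using (hconst 0).le
        refine le_of_forall_pos_le_add fun ε hε => ?_
        have h1 := hS.smul_mem hr.le (hgt (show α a < α a + ε / r by
          have := div_pos hε hr; linarith))
        refine hle ?_
        convert h1 using 1
        rw [mul_sub, ← map_mul]
        congr 2
        field_simp
      · rcases hr.eq_or_lt with rfl | hr
        · simpa using (hconst 0).ge
        refine le_of_forall_sub_le fun ε hε => ?_
        have h1 := hS.smul_mem hr.le (hlt (show α a - ε / r < α a by
          have := div_pos hε hr; linarith))
        refine hge ?_
        convert h1 using 1
        rw [mul_sub, ← map_mul]
        congr 2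
        field_simp
    intro r a
    rcases le_total 0 r with hr | hr
    · exact hpos r a hr
    · have := hpos (-r) a (by linarith)
      rw [map_neg, neg_mul, hαneg] at this
      linarith
  -- Apply the infinitesimal case to `a - α a`; multiplicativity then follows by polarization.
  have hsq : ∀ a, α (a ^ 2) = α a ^ 2 := by
    intro a
    have h0 : α (a + algebraMap ℝ A (-α a)) = 0 := by rw [hadd, hconst]; ring
    have h2 := hsq0 _ h0
    have h3 : (a + algebraMap ℝ A (-α a)) ^ 2
        = a ^ 2 + (algebraMap ℝ A (-(2 * α a)) * a + algebraMap ℝ A (α a ^ 2)) := by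
      simp only [map_neg, map_mul, map_pow]
      rw [show (2 : ℝ) = ((2 : ℕ) : ℝ) by norm_num, map_natCast]
      push_cast
      ring
    rw [h3, hadd, hadd, hsmul, hconst] at h2
    linarith
  have hmul : ∀ a b, α (a * b) = α a * α b := by
    intro a b
    have h1 := hsq (a + b)
    rw [show (a + b) ^ 2 = a ^ 2 + (algebraMap ℝ A 2 * (a * b) + b ^ 2) by
      rw [show (2 : ℝ) = ((2 : ℕ) : ℝ) by norm_num, map_natCast]; push_cast; ring,
      hadd, hadd, hsmul, hsq, hsq, hadd] at h1
    linarith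
  refine ⟨{ toFun := α, map_one' := ?_, map_mul' := hmul, map_zero' := ?_, map_add' := hadd,
            commutes' := hconst }, fun x hx => ?_⟩
  · simpa using hconst 1
  · simpa using hconst 0
  · exact hge (by simpa using hMS hx)

/-- Putinar's theorem in abstract form. -/
theorem mem_of_pos (hM : IsQuadModule M) (hA : IsArchimedeanModule M) {f : A}
    (hf : ∀ φ : A →ₐ[ℝ] ℝ, (∀ x ∈ M, 0 ≤ φ x) → 0 < φ f) : f ∈ M := by
  have hQ := hM.isQuadModule_adjoin (-f)
  have hQA : IsArchimedeanModule (adjoin M (-f)) := fun a =>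
    (hA a).imp fun r hr => subset_adjoin M (-f) hr
  -- Otherwise there would be a real point of `M` at which `f ≤ 0`.
  have h1 : (-1 : A) ∈ adjoin M (-f) := by
    by_contra h
    obtain ⟨φ, hφ⟩ := hQ.exists_algHom hQA h
    have h2 := hφ (-f) (hM.mem_adjoin _)
    have h3 := hf φ fun x hx => hφ x (subset_adjoin M (-f) hx)
    rw [map_neg] at h2
    linarith
  obtain ⟨m, hm, s, hs, hms⟩ := h1
  have hsf : s * f - 1 ∈ M := by
    have : s * f - 1 = m := by linear_combination hms
    rwa [this]
  have hup : ∀ {a : A} {r t : ℝ}, algebraMap ℝ A r - a ∈ M → r ≤ t → algebraMap ℝ A t - a ∈ M := by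
    intro a r t h hrt
    have := hM.add_mem h (hM.algebraMap_mem (sub_nonneg.2 hrt))
    convert this using 1
    rw [map_sub]; ring
  obtain ⟨k₁, hk₁⟩ := hA s
  obtain ⟨k₂, hk₂⟩ := hA (s ^ 2 * f + 1)
  -- One constant bounding both `s` and `s² f + 1` is enough for the descent below.
  obtain ⟨k, hk, hks, hksf⟩ : ∃ k : ℝ, 0 < k ∧ algebraMap ℝ A (2 * k) - s ∈ M ∧
      algebraMap ℝ A (2 * k) - (s ^ 2 * f + 1) ∈ M := by
    refine ⟨max 1 (max k₁ k₂), by positivity, hup hk₁ ?_, hup hk₂ ?_⟩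
    · have := le_max_left k₁ k₂
      have := le_max_right 1 (max k₁ k₂)
      have := le_max_left 1 (max k₁ k₂)
      linarith
    · have := le_max_right k₁ k₂
      have := le_max_right 1 (max k₁ k₂)
      have := le_max_left 1 (max k₁ k₂)
      linarith
  obtain ⟨r₀, hr₀⟩ := hA (-f)
  -- The descent rests on `k² (f + r - 1/k²) = (k-s)² (f+r) + 2k (sf - 1) + r s (2k - s) + (2k - s²
  -- f - 1)`, all four terms being in `M`. The decrement `1/k²` does not depend on `r`, so finitely
  -- many steps remove the constant.
  have hstep : ∀ r : ℝ, 0 ≤ r → f + algebraMap ℝ A r ∈ M →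
      f + algebraMap ℝ A (r - 1 / k ^ 2) ∈ M := by
    intro r hr h
    have e1 := hM.sq_mul_mem (algebraMap ℝ A k - s) h
    have e2 := hM.smul_mem (show 0 ≤ 2 * k by positivity) hsf
    have e3 := hM.smul_mem hr (hM.sos_mul_mem hs hks)
    have e := hM.add_mem (hM.add_mem e1 e2) (hM.add_mem e3 hksf)
    refine hM.of_smul_mem (r := k ^ 2) (by positivity) ?_
    convert e using 1
    rw [mul_add, ← map_mul, show k ^ 2 * (r - 1 / k ^ 2) = k ^ 2 * r - 1 by field_simp]
    simp only [map_sub, map_mul, map_pow, map_one]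
    rw [show (2 : ℝ) = ((2 : ℕ) : ℝ) by norm_num, map_natCast]
    push_cast
    ring
  have hiter : ∀ j : ℕ, f + algebraMap ℝ A (max r₀ 0 - j * (1 / k ^ 2)) ∈ M ∨ f ∈ M := by
    intro j
    induction j with
    | zero =>
      left
      have := hup hr₀ (le_max_left r₀ 0)
      convert this using 1
      simp [add_comm]
    | succ j ih =>
      rcases ih with h | h
      · by_cases hj : 0 ≤ max r₀ 0 - j * (1 / k ^ 2)
        · left
          have := hstep _ hj h
          convert this using 3
          push_cast
          ring
        · right
          have := hM.add_mem h (hM.algebraMap_mem (show 0 ≤ -(max r₀ 0 - j * (1 / k ^ 2)) by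
            linarith))
          rwa [map_neg, add_neg_cancel_right] at this
      · exact Or.inr h
  obtain ⟨j, hj⟩ := exists_nat_gt (max r₀ 0 / (1 / k ^ 2))
  rcases hiter j with h | h
  · rw [div_lt_iff₀ (by positivity)] at hj
    have := hM.add_mem h (hM.algebraMap_mem (show 0 ≤ -(max r₀ 0 - j * (1 / k ^ 2)) by linarith))
    rwa [map_neg, add_neg_cancel_right] at this
  · exact h

end IsQuadModule

/-! ### Hermitian polynomials, the modules `Q_{r,ρ}`, and Putinar's theorem on the ellipsoid. -/

noncomputable section

namespace SobolevPOP

open MvPolynomial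

variable {n : ℕ}

/-! ### The involution -/

/-- The involution of `ℂ[c]` as a ring homomorphism. -/
def starHom (n : ℕ) : FPoly n →+* FPoly n :=
  (rename (fun a : Fin n → ℤ => -a) : FPoly n →ₐ[ℂ] FPoly n).toRingHom.comp
    (map (starRingEnd ℂ))

lemma starPoly_eq (q : FPoly n) : starPoly q = starHom n q := rfl

@[simp] lemma starHom_C (z : ℂ) : starHom n (C z) = C (starRingEnd ℂ z) := by
  simp [starHom]

@[simp] lemma starHom_X (a : Fin n → ℤ) : starHom n (X a) = X (-a) := by
  simp [starHom]

@[simp] lemma starHom_starHom (q : FPoly n) : starHom n (starHom n q) = q := by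
  have : (starHom n).comp (starHom n) = RingHom.id _ := by
    apply MvPolynomial.ringHom_ext <;> intro a <;> simp
  exact congrArg (fun f : FPoly n →+* FPoly n => f q) this

lemma coeff_starHom (q : FPoly n) (β : MIndex n) :
    (starHom n q).coeff (β.mapDomain fun a => -a) = starRingEnd ℂ (q.coeff β) := by
  change (rename (fun a : Fin n → ℤ => -a) (map (starRingEnd ℂ) q)).coeff _ = _
  rw [coeff_rename_mapDomain _ neg_injective, coeff_map]

lemma eval_starHom {c : (Fin n → ℤ) → ℂ} (hc : ∀ a, c (-a) = starRingEnd ℂ (c a)) (q : FPoly n) :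
    eval c (starHom n q) = starRingEnd ℂ (eval c q) := by
  have : (eval c).comp (starHom n) = (starRingEnd ℂ).comp (eval c) := by
    apply MvPolynomial.ringHom_ext <;> intro a <;> simp [hc]
  exact congrArg (fun f : FPoly n →+* ℂ => f q) this

/-! ### Truncations -/

lemma mem_freqBox {ρ : ℕ} {a : Fin n → ℤ} : a ∈ freqBox n ρ ↔ ∀ i, (a i).natAbs ≤ ρ := by
  simp only [freqBox, Fintype.mem_piFinset, Finset.mem_Icc]
  exact forall_congr' fun i => by omega

lemma neg_mem_freqBox {ρ : ℕ} {a : Fin n → ℤ} (h : a ∈ freqBox n ρ) : -a ∈ freqBox n ρ := by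
  simpa [mem_freqBox] using mem_freqBox.1 h

lemma freqBox_mono {ρ ρ' : ℕ} (h : ρ ≤ ρ') : freqBox n ρ ⊆ freqBox n ρ' := fun _ ha =>
  mem_freqBox.2 fun i => (mem_freqBox.1 ha i).trans h

lemma exists_mem_freqBox (a : Fin n → ℤ) : ∃ ρ, a ∈ freqBox n ρ :=
  ⟨Finset.univ.sup fun i => (a i).natAbs,
    mem_freqBox.2 fun i => Finset.le_sup (f := fun i => (a i).natAbs) (Finset.mem_univ i)⟩

lemma exists_subset_freqBox (s : Finset (Fin n → ℤ)) : ∃ ρ, s ⊆ freqBox n ρ := by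
  refine ⟨s.sup fun a => Finset.univ.sup fun i => (a i).natAbs, fun a ha => mem_freqBox.2 fun i => ?_⟩
  exact (Finset.le_sup (f := fun i => (a i).natAbs) (Finset.mem_univ i)).trans
    (Finset.le_sup (f := fun a : Fin n → ℤ => Finset.univ.sup fun i => (a i).natAbs) ha)

lemma tendsto_freqBox : Tendsto (fun ρ => freqBox n ρ) atTop atTop :=
  tendsto_atTop_finset_of_monotone (fun _ _ h => freqBox_mono h) exists_mem_freqBox

lemma harmDeg_le_iff {β : MIndex n} {ρ : ℕ} : harmDeg β ≤ ρ ↔ β.support ⊆ freqBox n ρ := by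
  simp only [harmDeg, Finset.sup_le_iff, Finset.mem_univ, true_imp_iff, Finset.subset_iff,
    mem_freqBox]

/-- In terms of total degree and variables, the closure properties of the truncations are those of
ordinary polynomials. -/
lemma mem_truncPoly_iff {r ρ : ℕ} {q : FPoly n} :
    q ∈ truncPoly n r ρ ↔ q.totalDegree ≤ r ∧ q.vars ⊆ freqBox n ρ := by
  constructor
  · intro h
    refine ⟨Finset.sup_le fun β hβ => (h β hβ).1, fun a ha => ?_⟩
    obtain ⟨β, hβ, haβ⟩ := (mem_vars_iff_mem_support a).1 ha
    exact harmDeg_le_iff.1 (h β hβ).2 haβ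
  · rintro ⟨h1, h2⟩ β hβ
    exact ⟨(le_totalDegree hβ).trans h1,
      harmDeg_le_iff.2 fun a ha => h2 ((mem_vars_iff_mem_support a).2 ⟨β, hβ, ha⟩)⟩

lemma truncPoly_mono {r r' ρ ρ' : ℕ} (hr : r ≤ r') (hρ : ρ ≤ ρ') :
    truncPoly n r ρ ⊆ truncPoly n r' ρ' := fun _ hq β hβ =>
  ⟨(hq β hβ).1.trans hr, (hq β hβ).2.trans hρ⟩

lemma exists_mem_truncPoly (q : FPoly n) : ∃ r ρ, q ∈ truncPoly n r ρ := by
  obtain ⟨ρ, hρ⟩ := exists_subset_freqBox q.vars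
  exact ⟨q.totalDegree, ρ, mem_truncPoly_iff.2 ⟨le_rfl, hρ⟩⟩

lemma truncPoly_C (r ρ : ℕ) (z : ℂ) : C z ∈ truncPoly n r ρ := by
  rw [mem_truncPoly_iff, totalDegree_C, vars_C]; simp

lemma truncPoly_X {r ρ : ℕ} (hr : 1 ≤ r) {a : Fin n → ℤ} (ha : a ∈ freqBox n ρ) :
    X a ∈ truncPoly n r ρ := by
  rw [mem_truncPoly_iff, totalDegree_X, vars_X]; simpa [hr] using ha

lemma truncPoly_add {r ρ : ℕ} {p q : FPoly n} (hp : p ∈ truncPoly n r ρ)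
    (hq : q ∈ truncPoly n r ρ) : p + q ∈ truncPoly n r ρ := by
  classical
  rw [mem_truncPoly_iff] at *
  exact ⟨(totalDegree_add p q).trans (max_le hp.1 hq.1),
    (vars_add_subset p q).trans (Finset.union_subset hp.2 hq.2)⟩

lemma truncPoly_mul {r s ρ : ℕ} {p q : FPoly n} (hp : p ∈ truncPoly n r ρ)
    (hq : q ∈ truncPoly n s ρ) : p * q ∈ truncPoly n (r + s) ρ := by
  classical
  rw [mem_truncPoly_iff] at *
  exact ⟨(totalDegree_mul p q).trans (add_le_add hp.1 hq.1),
    (vars_mul p q).trans (Finset.union_subset hp.2 hq.2)⟩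

lemma truncPoly_C_mul {r ρ : ℕ} (z : ℂ) {q : FPoly n} (hq : q ∈ truncPoly n r ρ) :
    C z * q ∈ truncPoly n r ρ := by
  have := truncPoly_mul (truncPoly_C 0 ρ z) hq
  rwa [zero_add] at this

lemma truncPoly_neg {r ρ : ℕ} {q : FPoly n} (hq : q ∈ truncPoly n r ρ) :
    -q ∈ truncPoly n r ρ := by
  have := truncPoly_C_mul (-1) hq
  simpa using this

lemma truncPoly_sub {r ρ : ℕ} {p q : FPoly n} (hp : p ∈ truncPoly n r ρ)
    (hq : q ∈ truncPoly n r ρ) : p - q ∈ truncPoly n r ρ := by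
  rw [sub_eq_add_neg]; exact truncPoly_add hp (truncPoly_neg hq)

lemma truncPoly_sum {ι : Type*} {r ρ : ℕ} (s : Finset ι) {q : ι → FPoly n}
    (hq : ∀ i ∈ s, q i ∈ truncPoly n r ρ) : ∑ i ∈ s, q i ∈ truncPoly n r ρ := by
  classical
  induction s using Finset.induction_on with
  | empty => simpa using truncPoly_C r ρ (0 : ℂ)
  | insert i s hi ih =>
    rw [Finset.sum_insert hi]
    exact truncPoly_add (hq i (Finset.mem_insert_self _ _))
      (ih fun j hj => hq j (Finset.mem_insert_of_mem hj))

/-! ### Cones of Hermitian squares -/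

lemma sosCone_zero (K : Set (FPoly n)) : (0 : FPoly n) ∈ sosCone K :=
  ⟨0, Fin.elim0, fun k => k.elim0, by simp⟩

lemma sosCone_sq {K : Set (FPoly n)} {q : FPoly n} (hq : q ∈ K) : starHom n q * q ∈ sosCone K :=
  ⟨1, fun _ => q, fun _ => hq, by simp [starPoly_eq]⟩

lemma sosCone_add {K : Set (FPoly n)} {s t : FPoly n} (hs : s ∈ sosCone K) (ht : t ∈ sosCone K) :
    s + t ∈ sosCone K := by
  obtain ⟨M, q, hq, rfl⟩ := hs
  obtain ⟨M', q', hq', rfl⟩ := ht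
  refine ⟨M + M', Fin.append q q', fun k => ?_, ?_⟩
  · refine Fin.addCases (fun i => ?_) (fun i => ?_) k
    · rw [Fin.append_left]; exact hq i
    · rw [Fin.append_right]; exact hq' i
  · simp [Fin.sum_univ_add]

/-- Multiplication by a Hermitian square. -/
lemma sosCone_mul {K K' : Set (FPoly n)} {u s : FPoly n} (h : ∀ q ∈ K, u * q ∈ K')
    (hs : s ∈ sosCone K) : starHom n u * u * s ∈ sosCone K' := by
  obtain ⟨M, q, hq, rfl⟩ := hs
  refine ⟨M, fun k => u * q k, fun k => h _ (hq k), ?_⟩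
  rw [Finset.mul_sum]
  refine Finset.sum_congr rfl fun k _ => ?_
  rw [starPoly_eq, starPoly_eq, map_mul]
  ring

lemma sosCone_mono {K K' : Set (FPoly n)} (h : K ⊆ K') : sosCone K ⊆ sosCone K' := by
  rintro _ ⟨M, q, hq, rfl⟩
  exact ⟨M, q, fun k => h (hq k), rfl⟩

/-! ### The truncated quadratic modules -/

variable {m : ℕ} {N : SobolevNorm}

lemma weight_pos (m : ℕ) (N : SobolevNorm) (a : Fin n → ℤ) : 0 < weight m N a := by
  cases N with
  | fourier => exact pow_pos (by positivity) _
  | derivative =>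
    refine Finset.sum_pos' (fun b _ => Finset.prod_nonneg fun i _ => by
      rw [pow_mul]; positivity) ⟨0, ?_, by simp⟩
    exact Finset.mem_filter.2 ⟨Fintype.mem_piFinset.2 fun i => by simp, by simp [order]⟩

/-- The polynomials whose squares may multiply the constraint in `Q_{r,ρ}`. -/
def multiplierPoly (n r ρ : ℕ) : Set (FPoly n) :=
  {q | q ∈ truncPoly n (r - 1) ρ ∧ (r = 0 → q = 0)}

lemma quadModule_sos {r ρ : ℕ} {s : FPoly n} (hs : s ∈ sosCone (truncPoly n r ρ)) :
    s ∈ quadModule n m N r ρ :=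
  ⟨s, hs, 0, sosCone_zero _, by simp⟩

lemma quadModule_sq {r ρ : ℕ} {q : FPoly n} (hq : q ∈ truncPoly n r ρ) :
    starHom n q * q ∈ quadModule n m N r ρ := quadModule_sos (sosCone_sq hq)

lemma quadModule_ellipsoid {r ρ : ℕ} {q : FPoly n} (hr : 1 ≤ r) (hq : q ∈ truncPoly n (r - 1) ρ) :
    starHom n q * q * ellipsoidPoly n m N ρ ∈ quadModule n m N r ρ :=
  ⟨0, sosCone_zero _, _, sosCone_sq (K := multiplierPoly n r ρ) ⟨hq, by omega⟩, by simp⟩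

lemma quadModule_add {r ρ : ℕ} {s t : FPoly n} (hs : s ∈ quadModule n m N r ρ)
    (ht : t ∈ quadModule n m N r ρ) : s + t ∈ quadModule n m N r ρ := by
  obtain ⟨s₀, h₀, s₁, h₁, rfl⟩ := hs
  obtain ⟨t₀, k₀, t₁, k₁, rfl⟩ := ht
  exact ⟨s₀ + t₀, sosCone_add h₀ k₀, s₁ + t₁, sosCone_add h₁ k₁, by ring⟩

lemma quadModule_sum {ι : Type*} {r ρ : ℕ} (s : Finset ι) {q : ι → FPoly n}
    (hq : ∀ i ∈ s, q i ∈ quadModule n m N r ρ) : ∑ i ∈ s, q i ∈ quadModule n m N r ρ := by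
  classical
  induction s using Finset.induction_on with
  | empty => simpa using quadModule_sos (sosCone_zero _)
  | insert i s hi ih =>
    rw [Finset.sum_insert hi]
    exact quadModule_add (hq i (Finset.mem_insert_self _ _))
      (ih fun j hj => hq j (Finset.mem_insert_of_mem hj))

/-- The index `r` bounds the degree of the `q_k`, not of `q_k^* q_k`; hence a Hermitian square of a
polynomial of degree `d` raises it by `d` only. -/
lemma quadModule_mul {r d ρ : ℕ} {u t : FPoly n} (hu : u ∈ truncPoly n d ρ)
    (ht : t ∈ quadModule n m N r ρ) : starHom n u * u * t ∈ quadModule n m N (r + d) ρ := by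
  obtain ⟨s₀, h₀, s₁, h₁, rfl⟩ := ht
  refine ⟨_, sosCone_mul (u := u) (K' := truncPoly n (r + d) ρ) (fun q hq => ?_) h₀,
    _, sosCone_mul (u := u) (fun q hq => ?_) h₁, by ring⟩
  · rw [add_comm]; exact truncPoly_mul hu hq
  · obtain ⟨h1, h2⟩ := hq
    -- At `r = 0` the truncated difference `r - 1` is `0`, and the degree count is saved by the
    -- multiplier being zero.
    rcases Nat.eq_zero_or_pos r with rfl | hr
    · rw [h2 rfl, mul_zero]
      exact ⟨by simpa using truncPoly_C _ ρ (0 : ℂ), fun _ => rfl⟩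
    · refine ⟨?_, by omega⟩
      rw [show r + d - 1 = d + (r - 1) by omega]
      exact truncPoly_mul hu h1

lemma quadModule_C_mul {r ρ : ℕ} {x : ℝ} (hx : 0 ≤ x) {t : FPoly n}
    (ht : t ∈ quadModule n m N r ρ) : C (x : ℂ) * t ∈ quadModule n m N r ρ := by
  have := quadModule_mul (truncPoly_C 0 ρ ((√x : ℝ) : ℂ)) ht
  rwa [starHom_C, ← map_mul, Complex.conj_ofReal, ← Complex.ofReal_mul, Real.mul_self_sqrt hx]
    at this

lemma quadModule_C {r ρ : ℕ} {x : ℝ} (hx : 0 ≤ x) :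
    (C (x : ℂ) : FPoly n) ∈ quadModule n m N r ρ := by
  have := quadModule_C_mul (n := n) (m := m) (N := N) (r := r) (ρ := ρ) hx
    (quadModule_sq (truncPoly_C _ _ 1))
  simpa using this

lemma ellipsoidPoly_eq {ρ ρ' : ℕ} (h : ρ ≤ ρ') :
    ellipsoidPoly n m N ρ = ellipsoidPoly n m N ρ' + ∑ a ∈ freqBox n ρ' \ freqBox n ρ,
      C (weight m N a : ℂ) * (starHom n (X a) * X a) := by
  unfold ellipsoidPoly
  rw [← Finset.sum_sdiff (freqBox_mono h)]
  simp only [starHom_X, mul_comm (X (-_) : FPoly n)]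
  ring

/-- The constraint itself depends on `ρ`: passing to `ρ'` subtracts the terms `w_a |c_a|²` of the
new frequencies. Multiplied by `|q|²` these are Hermitian squares of `q c_a`, of degree at most `(r
- 1) + 1`, and are absorbed in `s_0`. -/
lemma quadModule_mono {r r' ρ ρ' : ℕ} (hr : r ≤ r') (hρ : ρ ≤ ρ') :
    quadModule n m N r ρ ⊆ quadModule n m N r' ρ' := by
  rintro _ ⟨s₀, h₀, s₁, h₁, rfl⟩
  refine quadModule_add (quadModule_sos (sosCone_mono (truncPoly_mono hr hρ) h₀)) ?_
  obtain ⟨M, q, hq, rfl⟩ := h₁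
  rw [Finset.sum_mul]
  refine quadModule_sum _ fun k _ => ?_
  obtain ⟨hk, hk0⟩ := hq k
  rcases Nat.eq_zero_or_pos r with rfl | hrpos
  · rw [hk0 rfl, mul_zero, zero_mul]
    exact quadModule_sos (sosCone_zero _)
  rw [ellipsoidPoly_eq hρ, mul_add, Finset.mul_sum]
  refine quadModule_add (quadModule_ellipsoid (hrpos.trans_le hr)
    (truncPoly_mono (by omega) hρ hk)) (quadModule_sum _ fun a ha => ?_)
  have ha' := (Finset.mem_sdiff.1 ha).1
  rw [mul_left_comm]
  refine quadModule_C_mul (weight_pos m N a).le ?_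
  have : starPoly (q k) * q k * (starHom n (X a) * X a)
      = starHom n (q k * X a) * (q k * X a) := by
    rw [starPoly_eq, map_mul]; ring
  rw [this]
  refine quadModule_sq (truncPoly_mono ?_ le_rfl
    (truncPoly_mul (truncPoly_mono le_rfl hρ hk) (truncPoly_X le_rfl ha')))
  omega

/-- A linear form with coefficients `t` is bounded by `η` modulo `Q_{1,ρ}` (Cauchy-Schwarz). -/
lemma quadModule_linearForm {ρ : ℕ} (t : (Fin n → ℤ) → ℂ) {η : ℝ} (hη : 0 < η)
    (ht : ∑ k ∈ freqBox n ρ, ‖t k‖ ^ 2 / weight m N k ≤ η ^ 2) :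
    C ((η ^ 2 : ℝ) : ℂ) - starHom n (∑ k ∈ freqBox n ρ, C (t k) * X k)
      * (∑ k ∈ freqBox n ρ, C (t k) * X k) ∈ quadModule n m N 1 ρ := by
  set F : FPoly n := ∑ k ∈ freqBox n ρ, C (t k) * X k with hF
  set τ := ∑ k ∈ freqBox n ρ, ‖t k‖ ^ 2 / weight m N k with hτ
  -- Chosen so that `η² w_k λ_k` is the conjugate of `t_k`: the cross terms of `∑ η² w_k |X_k - λ_k
  -- F|²` then add up to `-2 F^* F`.
  set lam : (Fin n → ℤ) → ℂ := fun k => starRingEnd ℂ (t k) / ((weight m N k * η ^ 2 : ℝ) : ℂ)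
  have hFt : F ∈ truncPoly n 1 ρ :=
    truncPoly_sum _ fun k hk => truncPoly_C_mul _ (truncPoly_X le_rfl hk)
  have hw : ∀ k : Fin n → ℤ, (weight m N k : ℂ) ≠ 0 := fun k =>
    Complex.ofReal_ne_zero.2 (weight_pos m N k).ne'
  have hη' : (η : ℂ) ≠ 0 := Complex.ofReal_ne_zero.2 hη.ne'
  have h1 : ∀ k, C ((η ^ 2 * weight m N k : ℝ) : ℂ) *
      (starHom n (X k - C (lam k) * F) * (X k - C (lam k) * F))
      = C ((η ^ 2 : ℝ) : ℂ) * (C (weight m N k : ℂ) * (X k * X (-k)))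
        - starHom n (C (t k) * X k) * F - starHom n F * (C (t k) * X k)
        + C ((‖t k‖ ^ 2 / weight m N k / η ^ 2 : ℝ) : ℂ) * (starHom n F * F) := by
    intro k
    have e1 : ((η ^ 2 * weight m N k : ℝ) : ℂ) * lam k = starRingEnd ℂ (t k) := by
      simp only [lam]; push_cast; field_simp [hw k]
    have e2 : ((η ^ 2 * weight m N k : ℝ) : ℂ) * starRingEnd ℂ (lam k) = t k := by
      simp only [lam, map_div₀, Complex.conj_conj, Complex.conj_ofReal]
      push_cast; field_simp [hw k]
    have e3 : ((η ^ 2 * weight m N k : ℝ) : ℂ) * (lam k * starRingEnd ℂ (lam k))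
        = ((‖t k‖ ^ 2 / weight m N k / η ^ 2 : ℝ) : ℂ) := by
      rw [← mul_assoc, e1]
      simp only [lam, map_div₀, Complex.conj_conj, Complex.conj_ofReal]
      rw [← mul_div_assoc, mul_comm, Complex.mul_conj, Complex.normSq_eq_norm_sq]
      push_cast; field_simp [hw k]
    have e1' := congrArg (C : ℂ → FPoly n) e1
    have e2' := congrArg (C : ℂ → FPoly n) e2
    have e3' := congrArg (C : ℂ → FPoly n) e3
    simp only [map_mul] at e1' e2' e3'
    have e4 : (C ((η ^ 2 * weight m N k : ℝ) : ℂ) : FPoly n)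
        = C ((η ^ 2 : ℝ) : ℂ) * C (weight m N k : ℂ) := by
      rw [Complex.ofReal_mul, map_mul]
    simp only [map_sub, map_mul, starHom_C, starHom_X]
    rw [← e3', ← e1', ← e2', e4]
    ring
  have h2 := Finset.sum_congr (rfl : freqBox n ρ = freqBox n ρ) fun k _ => h1 k
  rw [Finset.sum_add_distrib, Finset.sum_sub_distrib, Finset.sum_sub_distrib, ← Finset.sum_mul,
    ← map_sum, ← hF, ← Finset.mul_sum, ← Finset.mul_sum, ← hF, ← Finset.sum_mul, ← map_sum,
    ← Complex.ofReal_sum, ← Finset.sum_div, ← hτ] at h2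
  -- Three admissible terms: `η²` times the constraint, the weighted squares `|X_k - λ_k F|²`, and
  -- `(1 - τ/η²) F^* F`, whose coefficient is nonnegative by `ht`.
  have h3 : C ((η ^ 2 : ℝ) : ℂ) - starHom n F * F
      = C ((η ^ 2 : ℝ) : ℂ) * (starHom n 1 * 1 * ellipsoidPoly n m N ρ)
        + (∑ k ∈ freqBox n ρ, C ((η ^ 2 * weight m N k : ℝ) : ℂ) *
            (starHom n (X k - C (lam k) * F) * (X k - C (lam k) * F))
          + C ((1 - τ / η ^ 2 : ℝ) : ℂ) * (starHom n F * F)) := by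
    rw [h2, ellipsoidPoly, Complex.ofReal_sub, map_sub, Complex.ofReal_one, map_one, map_one]
    ring
  rw [h3]
  refine quadModule_add (quadModule_C_mul (sq_nonneg η)
    (quadModule_ellipsoid le_rfl (by simpa using truncPoly_C 0 ρ 1)))
    (quadModule_add (quadModule_sum _ fun k hk => quadModule_C_mul
      (mul_nonneg (sq_nonneg _) (weight_pos m N k).le) (quadModule_sq
        (truncPoly_sub (truncPoly_X le_rfl hk) (truncPoly_C_mul _ hFt))))
      (quadModule_C_mul ?_ (quadModule_sq hFt)))
  rw [sub_nonneg, div_le_one (by positivity)]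
  exact ht

/-! ### Positivity on the ellipsoid -/

/-- The points of the (infinite-dimensional) ellipsoid, described by inequalities. -/
structure InEllipsoid (m : ℕ) (N : SobolevNorm) (c : (Fin n → ℤ) → ℂ) : Prop where
  herm : ∀ a, c (-a) = starRingEnd ℂ (c a)
  sum_le : ∀ ρ, ∑ a ∈ freqBox n ρ, weight m N a * ‖c a‖ ^ 2 ≤ 1

lemma eval_ellipsoidPoly {c : (Fin n → ℤ) → ℂ} (hc : ∀ a, c (-a) = starRingEnd ℂ (c a)) (ρ : ℕ) :
    eval c (ellipsoidPoly n m N ρ)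
      = ((1 - ∑ a ∈ freqBox n ρ, weight m N a * ‖c a‖ ^ 2 : ℝ) : ℂ) := by
  simp [ellipsoidPoly, hc, Complex.mul_conj, Complex.normSq_eq_norm_sq]

lemma eval_sosCone_nonneg {c : (Fin n → ℤ) → ℂ} (hc : ∀ a, c (-a) = starRingEnd ℂ (c a))
    {K : Set (FPoly n)} {s : FPoly n} (hs : s ∈ sosCone K) :
    ∃ x : ℝ, 0 ≤ x ∧ eval c s = x := by
  obtain ⟨M, q, -, rfl⟩ := hs
  refine ⟨∑ k, ‖eval c (q k)‖ ^ 2, by positivity, ?_⟩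
  simp only [map_sum, map_mul, starPoly_eq, eval_starHom hc]
  push_cast
  refine Finset.sum_congr rfl fun k _ => ?_
  rw [mul_comm, Complex.mul_conj, Complex.normSq_eq_norm_sq]
  push_cast; rfl

lemma InEllipsoid.eval_quadModule {c : (Fin n → ℤ) → ℂ} (hc : InEllipsoid m N c) {r ρ : ℕ}
    {t : FPoly n} (ht : t ∈ quadModule n m N r ρ) : ∃ x : ℝ, 0 ≤ x ∧ eval c t = x := by
  obtain ⟨s₀, h₀, s₁, h₁, rfl⟩ := ht
  obtain ⟨x, hx, hx'⟩ := eval_sosCone_nonneg hc.herm h₀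
  obtain ⟨y, hy, hy'⟩ := eval_sosCone_nonneg hc.herm h₁
  refine ⟨x + y * (1 - ∑ a ∈ freqBox n ρ, weight m N a * ‖c a‖ ^ 2),
    add_nonneg hx (mul_nonneg hy (sub_nonneg.2 (hc.sum_le ρ))), ?_⟩
  rw [map_add, map_mul, hx', hy', eval_ellipsoidPoly hc.herm]
  push_cast; ring

lemma mem_quadModuleTop {t : FPoly n} :
    t ∈ quadModuleTop n m N ↔ ∃ r ρ, t ∈ quadModule n m N r ρ := by
  simp [quadModuleTop]

lemma quadModuleTop_add {s t : FPoly n} (hs : s ∈ quadModuleTop n m N)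
    (ht : t ∈ quadModuleTop n m N) : s + t ∈ quadModuleTop n m N := by
  rw [mem_quadModuleTop] at *
  obtain ⟨r, ρ, hs⟩ := hs
  obtain ⟨r', ρ', ht⟩ := ht
  exact ⟨max r r', max ρ ρ', quadModule_add
    (quadModule_mono (le_max_left _ _) (le_max_left _ _) hs)
    (quadModule_mono (le_max_right _ _) (le_max_right _ _) ht)⟩

lemma quadModuleTop_mul (u : FPoly n) {t : FPoly n} (ht : t ∈ quadModuleTop n m N) :
    starHom n u * u * t ∈ quadModuleTop n m N := by
  rw [mem_quadModuleTop] at *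
  obtain ⟨r, ρ, ht⟩ := ht
  obtain ⟨d, ρ', hu⟩ := exists_mem_truncPoly u
  exact ⟨r + d, max ρ ρ', quadModule_mul (truncPoly_mono le_rfl (le_max_right _ _) hu)
    (quadModule_mono le_rfl (le_max_left _ _) ht)⟩

lemma quadModuleTop_sq (u : FPoly n) : starHom n u * u ∈ quadModuleTop n m N := by
  obtain ⟨d, ρ, hu⟩ := exists_mem_truncPoly u
  exact mem_quadModuleTop.2 ⟨d, ρ, quadModule_sq hu⟩

lemma quadModuleTop_C_mul {x : ℝ} (hx : 0 ≤ x) {t : FPoly n} (ht : t ∈ quadModuleTop n m N) :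
    C (x : ℂ) * t ∈ quadModuleTop n m N := by
  rw [mem_quadModuleTop] at *
  obtain ⟨r, ρ, ht⟩ := ht
  exact ⟨r, ρ, quadModule_C_mul hx ht⟩

/-- Every Hermitian square is bounded modulo `Q_{∞,∞}`. -/
lemma exists_bound_quadModuleTop (q : FPoly n) :
    ∃ x : ℝ, 0 ≤ x ∧ C (x : ℂ) - starHom n q * q ∈ quadModuleTop n m N := by
  induction q using MvPolynomial.induction_on with
  | C z =>
    refine ⟨‖z‖ ^ 2, by positivity, ?_⟩
    rw [starHom_C, ← map_mul, ← map_sub, mul_comm, Complex.mul_conj, Complex.normSq_eq_norm_sq,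
      sub_self, map_zero]
    simpa using quadModuleTop_sq (0 : FPoly n)
  | add p q hp hq =>
    obtain ⟨x, hx, hp⟩ := hp
    obtain ⟨y, hy, hq⟩ := hq
    refine ⟨2 * x + 2 * y, by positivity, ?_⟩
    -- Parallelogram identity: `2x + 2y - |p+q|² = 2(x - |p|²) + 2(y - |q|²) + |p-q|²`.
    have := quadModuleTop_add (quadModuleTop_add (quadModuleTop_C_mul zero_le_two hp)
      (quadModuleTop_C_mul zero_le_two hq)) (quadModuleTop_sq (p - q))
    convert this using 1
    rw [show ((2 : ℝ) : ℂ) = ((2 : ℕ) : ℂ) by norm_num]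
    simp only [map_add, map_sub, Complex.ofReal_add, Complex.ofReal_mul, map_mul, map_natCast,
      Complex.ofReal_ofNat]
    rw [show (2 : ℂ) = ((2 : ℕ) : ℂ) by norm_num, map_natCast]
    push_cast
    ring
  | mul_X q a hq =>
    obtain ⟨x, hx, hq⟩ := hq
    obtain ⟨ρ, hρ⟩ := exists_mem_freqBox a
    set w := weight m N a with hw
    have hwpos : 0 < w := weight_pos m N a
    refine ⟨x * w⁻¹, by positivity, ?_⟩
    -- A linear form with the single coefficient `1` at `a` gives `|X_a|² ≤ 1/w_a` modulo the
    -- module.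
    have h1 := quadModule_linearForm (m := m) (N := N) (ρ := ρ) (fun k => if k = a then 1 else 0)
      (η := √(w⁻¹)) (by positivity) (by
        rw [Real.sq_sqrt (by positivity), Finset.sum_eq_single a]
        · simp [hw]
        · intro b _ hb; simp [hb]
        · intro h; exact absurd hρ h)
    rw [Finset.sum_eq_single a (by intro b _ hb; simp [hb]) (fun h => absurd hρ h),
      Real.sq_sqrt (by positivity), if_pos rfl, map_one, one_mul] at h1
    -- `x/w - |q X_a|² = |q|² (1/w - |X_a|²) + (x - |q|²)/w`.
    have := quadModuleTop_add (quadModuleTop_mul q (mem_quadModuleTop.2 ⟨_, _, h1⟩))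
      (quadModuleTop_C_mul (inv_nonneg.2 hwpos.le) hq)
    convert this using 1
    simp only [map_mul, Complex.ofReal_mul]
    ring

/-! ### Putinar's theorem for the ellipsoid -/

/-- The real algebra of Hermitian polynomials. -/
def hermAlg (n : ℕ) : Subalgebra ℝ (FPoly n) where
  carrier := {q | starHom n q = q}
  mul_mem' := fun {a b} ha hb => by simp only [Set.mem_ofPred_eq] at *; rw [map_mul, ha, hb]
  add_mem' := fun {a b} ha hb => by simp only [Set.mem_ofPred_eq] at *; rw [map_add, ha, hb]
  algebraMap_mem' := fun r => by
    simp [MvPolynomial.algebraMap_apply]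

lemma mem_hermAlg {q : FPoly n} : q ∈ hermAlg n ↔ starHom n q = q := Iff.rfl

/-- The Hermitian real part. -/
def hermRe (q : FPoly n) : hermAlg n :=
  ⟨C (1 / 2 : ℂ) * (q + starHom n q), by
    rw [mem_hermAlg, map_mul, map_add, starHom_starHom, starHom_C, add_comm]
    simp only [map_div₀, map_one, map_ofNat]⟩

/-- The Hermitian imaginary part. -/
def hermIm (q : FPoly n) : hermAlg n :=
  ⟨C (-Complex.I / 2 : ℂ) * (q - starHom n q), by
    rw [mem_hermAlg, map_mul, map_sub, starHom_starHom, starHom_C]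
    simp only [map_div₀, map_neg, Complex.conj_I, map_ofNat, neg_neg]
    rw [neg_div, map_neg]; ring⟩

lemma C_half_sq : (C (1 / 2 : ℂ) : FPoly n) + C (1 / 2) = 1 := by
  rw [← map_add, ← map_one C]; norm_num

lemma C_I_half : (C (-Complex.I / 2 : ℂ) : FPoly n) * C (-Complex.I / 2)
    = - (C (1 / 2) * C (1 / 2)) := by
  rw [← map_mul, ← map_mul, ← map_neg]
  congr 1
  linear_combination (1 / 4 : ℂ) * Complex.I_mul_I

/-- Since `q = hermRe q + i hermIm q`, the ring `ℂ[c]` is the complexification of its Hermitian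
elements; the rules for products, sums and constants let a real point extend to a complex one. -/
lemma hermRe_mul (p q : FPoly n) :
    hermRe (p * q) = hermRe p * hermRe q - hermIm p * hermIm q := by
  apply Subtype.ext
  simp only [hermRe, hermIm, Subalgebra.coe_sub, Subalgebra.coe_mul, map_mul]
  linear_combination (C (1 / 2 : ℂ) : FPoly n) * (p * q + starHom n p * starHom n q) *
    (-(C_half_sq (n := n))) + (p - starHom n p) * (q - starHom n q) * C_I_half (n := n)

lemma hermIm_mul (p q : FPoly n) :
    hermIm (p * q) = hermRe p * hermIm q + hermIm p * hermRe q := by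
  apply Subtype.ext
  simp only [hermRe, hermIm, Subalgebra.coe_add, Subalgebra.coe_mul, map_mul]
  linear_combination (C (-Complex.I / 2 : ℂ) : FPoly n) * (p * q - starHom n p * starHom n q) *
    (-(C_half_sq (n := n)))

lemma hermRe_add (p q : FPoly n) : hermRe (p + q) = hermRe p + hermRe q := by
  apply Subtype.ext
  simp only [hermRe, Subalgebra.coe_add, map_add]; ring

lemma hermIm_add (p q : FPoly n) : hermIm (p + q) = hermIm p + hermIm q := by
  apply Subtype.ext
  simp only [hermIm, Subalgebra.coe_add, map_add]; ring

lemma hermRe_C (z : ℂ) : hermRe (C z : FPoly n) = algebraMap ℝ _ z.re := by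
  apply Subtype.ext
  change C (1 / 2 : ℂ) * (C z + starHom n (C z)) = C ((z.re : ℝ) : ℂ)
  rw [starHom_C, ← map_add, ← map_mul, Complex.add_conj]
  congr 1; push_cast; ring

lemma hermIm_C (z : ℂ) : hermIm (C z : FPoly n) = algebraMap ℝ _ z.im := by
  apply Subtype.ext
  change C (-Complex.I / 2 : ℂ) * (C z - starHom n (C z)) = C ((z.im : ℝ) : ℂ)
  rw [starHom_C, ← map_sub, ← map_mul, Complex.sub_conj]
  congr 1; push_cast
  linear_combination (-(z.im : ℂ)) * Complex.I_mul_I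

lemma hermRe_coe (q : hermAlg n) : hermRe (q : FPoly n) = q := by
  apply Subtype.ext
  have h := q.2
  rw [mem_hermAlg] at h
  simp only [hermRe]
  rw [h]
  linear_combination (q : FPoly n) * C_half_sq (n := n)

lemma hermIm_coe (q : hermAlg n) : hermIm (q : FPoly n) = 0 := by
  apply Subtype.ext
  have h := q.2
  rw [mem_hermAlg] at h
  simp only [hermIm]
  rw [h]
  simp

/-- The complexification of a real point of the algebra of Hermitian polynomials. -/
def complexify (φ : hermAlg n →ₐ[ℝ] ℝ) : FPoly n →+* ℂ where
  toFun q := ⟨φ (hermRe q), φ (hermIm q)⟩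
  map_one' := by
    rw [← map_one C, hermRe_C, hermIm_C, φ.commutes, φ.commutes]; rfl
  map_zero' := by
    rw [← map_zero C, hermRe_C, hermIm_C, φ.commutes, φ.commutes]; rfl
  map_mul' p q := by
    rw [hermRe_mul, hermIm_mul]
    apply Complex.ext <;> simp
  map_add' p q := by
    rw [hermRe_add, hermIm_add]
    apply Complex.ext <;> simp

lemma complexify_C (φ : hermAlg n →ₐ[ℝ] ℝ) (z : ℂ) : complexify φ (C z) = z := by
  change (⟨φ (hermRe (C z)), φ (hermIm (C z))⟩ : ℂ) = z
  rw [hermRe_C, hermIm_C, φ.commutes, φ.commutes]; rfl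

lemma complexify_eq_eval (φ : hermAlg n →ₐ[ℝ] ℝ) (q : FPoly n) :
    complexify φ q = eval (fun a => complexify φ (X a)) q := by
  have : complexify φ = eval (fun a => complexify φ (X a)) := by
    apply MvPolynomial.ringHom_ext <;> intro a <;> simp [complexify_C]
  exact congrArg (fun f : FPoly n →+* ℂ => f q) this

lemma complexify_coe (φ : hermAlg n →ₐ[ℝ] ℝ) (q : hermAlg n) :
    complexify φ (q : FPoly n) = (φ q : ℂ) := by
  change (⟨φ (hermRe (q : FPoly n)), φ (hermIm (q : FPoly n))⟩ : ℂ) = _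
  rw [hermRe_coe, hermIm_coe, map_zero]; rfl

lemma complexify_starHom (φ : hermAlg n →ₐ[ℝ] ℝ) (q : FPoly n) :
    complexify φ (starHom n q) = starRingEnd ℂ (complexify φ q) := by
  have h1 : hermRe (starHom n q) = hermRe q := by
    apply Subtype.ext; simp only [hermRe, starHom_starHom, add_comm]
  have h2 : hermIm (starHom n q) = -hermIm q := by
    apply Subtype.ext
    simp only [hermIm, starHom_starHom, Subalgebra.coe_neg]; ring
  change (⟨φ (hermRe (starHom n q)), φ (hermIm (starHom n q))⟩ : ℂ) = _
  rw [h1, h2, map_neg]; rfl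

/-- Putinar's theorem for the ellipsoid, in infinitely many variables. -/
theorem exists_mem_quadModule_of_pos {q : FPoly n} (hq : starHom n q = q)
    (hpos : ∀ c, InEllipsoid m N c → 0 < (eval c q).re) : ∃ r ρ, q ∈ quadModule n m N r ρ := by
  -- On Hermitian elements `a^* a = a²`, so the trace of `Q_{∞,∞}` there is a quadratic module in
  -- the real, involution-free sense.
  rw [← mem_quadModuleTop]
  set M : Set (hermAlg n) := {x | (x : FPoly n) ∈ quadModuleTop n m N} with hMdef
  have hM : IsQuadModule M := by
    refine ⟨?_, fun hx hy => quadModuleTop_add hx hy, fun a x hx => ?_⟩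
    · simpa [hMdef] using quadModuleTop_sq (1 : FPoly n)
    · have := quadModuleTop_mul (a : FPoly n) hx
      rw [mem_hermAlg.1 a.2] at this
      simpa [hMdef, sq] using this
  have hA : IsArchimedeanModule M := by
    intro a
    obtain ⟨x, -, hx⟩ := exists_bound_quadModuleTop (m := m) (N := N) (a : FPoly n)
    -- From `a ≤ (1 + a²)/2`: `(1+x)/2 - a = ((x - a²) + (1 - a)²)/2`.
    refine ⟨(1 + x) / 2, ?_⟩
    have := quadModuleTop_C_mul (show (0 : ℝ) ≤ 1 / 2 by norm_num)
      (quadModuleTop_add hx (quadModuleTop_sq (1 - a : FPoly n)))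
    change (C (((1 + x) / 2 : ℝ) : ℂ) : FPoly n) - a ∈ quadModuleTop n m N
    convert this using 1
    rw [map_sub, map_one, mem_hermAlg.1 a.2]
    have e : (C (((1 + x) / 2 : ℝ) : ℂ) : FPoly n) = C (1 / 2 : ℂ) * (1 + C (x : ℂ)) := by
      rw [← map_one C, ← map_add, ← map_mul]; congr 1; push_cast; ring
    rw [e]
    push_cast
    linear_combination (a : FPoly n) * C_half_sq (n := n)
  refine hM.mem_of_pos (f := ⟨q, hq⟩) hA fun φ hφ => ?_
  -- The complexified point is evaluation at the values of the variables. It commutes with the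
  -- involution, and the constraints, which lie in the module, place `c` in the ellipsoid.
  set c : (Fin n → ℤ) → ℂ := fun a => complexify φ (X a) with hc
  have hherm : ∀ a, c (-a) = starRingEnd ℂ (c a) := fun a => by
    simp only [hc]
    rw [← complexify_starHom, starHom_X]
  have hE : InEllipsoid m N c := by
    refine ⟨hherm, fun ρ => ?_⟩
    have hmem : ellipsoidPoly n m N ρ ∈ quadModuleTop n m N := by
      have := quadModule_ellipsoid (n := n) (m := m) (N := N) (r := 1) (ρ := ρ) le_rfl
        (truncPoly_C 0 ρ 1)
      simp only [map_one, one_mul] at this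
      exact mem_quadModuleTop.2 ⟨1, ρ, this⟩
    have hst : starHom n (ellipsoidPoly n m N ρ) = ellipsoidPoly n m N ρ := by
      simp only [ellipsoidPoly, map_sub, map_one, map_sum, map_mul, starHom_C, starHom_X, neg_neg,
        Complex.conj_ofReal, mul_comm (X (-_) : FPoly n)]
    have h1 := hφ ⟨_, hst⟩ hmem
    have h2 := complexify_coe φ ⟨_, hst⟩
    rw [complexify_eq_eval, ← hc, eval_ellipsoidPoly hherm] at h2
    rw [← Complex.ofReal_inj.1 h2] at h1
    linarith
  have h1 := hpos c hE
  have h2 := complexify_coe φ ⟨q, hq⟩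
  rw [complexify_eq_eval, ← hc] at h2
  rw [show eval c q = _ from h2] at h1
  simpa using h1

end SobolevPOP

end

/-! ### Pseudo-moment functionals and domination certificates of controlled degree. -/

noncomputable section

namespace SobolevPOP

open MvPolynomial

variable {n m : ℕ} {N : SobolevNorm}

/-! ### Pseudo-moment functionals -/

lemma riesz_eq_sum (y : MIndex n → ℂ) (p : FPoly n) {S : Finset (MIndex n)} (h : p.support ⊆ S) :
    riesz y p = ∑ β ∈ S, p.coeff β * y β :=
  Finset.sum_subset h fun β _ hβ => by rw [notMem_support_iff.1 hβ, zero_mul]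

/-- The functional `ℓ_y` as a linear map. -/
def rieszLin (y : MIndex n → ℂ) : FPoly n →ₗ[ℂ] ℂ where
  toFun := riesz y
  map_add' p q := by
    classical
    rw [riesz_eq_sum y (p + q) (S := p.support ∪ q.support) support_add,
      riesz_eq_sum y p Finset.subset_union_left, riesz_eq_sum y q Finset.subset_union_right,
      ← Finset.sum_add_distrib]
    exact Finset.sum_congr rfl fun β _ => by rw [coeff_add, add_mul]
  map_smul' z p := by
    rw [riesz_eq_sum y (z • p) (S := p.support) support_smul, riesz, RingHom.id_apply, smul_eq_mul,
      Finset.mul_sum]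
    exact Finset.sum_congr rfl fun β _ => by rw [coeff_smul, smul_eq_mul, mul_assoc]

lemma riesz_eq_rieszLin (y : MIndex n → ℂ) (p : FPoly n) : riesz y p = rieszLin y p := rfl

lemma rieszLin_C_mul (y : MIndex n → ℂ) (z : ℂ) (p : FPoly n) :
    rieszLin y (C z * p) = z * rieszLin y p := by
  rw [← smul_eq_C_mul, map_smul, smul_eq_mul]

lemma rieszLin_monomial (y : MIndex n → ℂ) (β : MIndex n) (z : ℂ) :
    rieszLin y (monomial β z) = z * y β := by
  change riesz y _ = _
  rw [riesz_eq_sum y _ (S := {β}) support_monomial_subset, Finset.sum_singleton, coeff_monomial,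
    if_pos rfl]

lemma rieszLin_C (y : MIndex n → ℂ) (z : ℂ) : rieszLin y (C z) = z * y 0 :=
  rieszLin_monomial y 0 z

/-- Normalized functionals which are nonnegative on `Q`. -/
structure IsState (Q : Set (FPoly n)) (y : MIndex n → ℂ) : Prop where
  one : y 0 = 1
  nonneg : ∀ p ∈ Q, 0 ≤ (rieszLin y p).re
  im_eq : ∀ p ∈ Q, (rieszLin y p).im = 0

lemma IsState.mono {Q Q' : Set (FPoly n)} {y : MIndex n → ℂ} (h : IsState Q' y) (hQ : Q ⊆ Q') :
    IsState Q y := ⟨h.one, fun p hp => h.nonneg p (hQ hp), fun p hp => h.im_eq p (hQ hp)⟩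

lemma rieszLin_sq (y : MIndex n → ℂ) (hy : y 0 = 1) (x : ℝ) (t : ℂ) (q : FPoly n) :
    rieszLin y (starHom n (C (x : ℂ) - C t * q) * (C (x : ℂ) - C t * q))
      = x ^ 2 - x * (t * rieszLin y q + starRingEnd ℂ t * rieszLin y (starHom n q))
        + (‖t‖ ^ 2 : ℝ) * rieszLin y (starHom n q * q) := by
  have : starHom n (C (x : ℂ) - C t * q) * (C (x : ℂ) - C t * q)
      = C ((x : ℂ) ^ 2) - C ((x : ℂ) * t) * q - C ((x : ℂ) * starRingEnd ℂ t) * starHom n q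
        + C (t * starRingEnd ℂ t) * (starHom n q * q) := by
    simp only [map_sub, map_mul, starHom_C, Complex.conj_ofReal, map_pow]; ring
  rw [this, map_add, map_sub, map_sub, rieszLin_C_mul, rieszLin_C_mul, rieszLin_C_mul, rieszLin_C,
    hy, Complex.mul_conj, Complex.normSq_eq_norm_sq]
  push_cast; ring

/-- Positivity only on Hermitian squares forces Hermitian symmetry: `ℓ(|1 - tq|²)` and `ℓ(|q|²)` are
real, and the choices `t = 1` and `t = i` determine `ℓ(q^*)`. -/
lemma IsState.rieszLin_star {r ρ : ℕ} {y : MIndex n → ℂ}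
    (hy : IsState (quadModule n m N r ρ) y) {q : FPoly n} (hq : q ∈ truncPoly n r ρ) :
    rieszLin y (starHom n q) = starRingEnd ℂ (rieszLin y q) := by
  have key : ∀ t : ℂ, ‖t‖ = 1 → (t * rieszLin y q + starRingEnd ℂ t * rieszLin y (starHom n q)).im
      = 0 := by
    intro t ht
    have h1 := hy.im_eq _ (quadModule_sq (truncPoly_sub (truncPoly_C r ρ ((1 : ℝ) : ℂ))
      (truncPoly_C_mul t hq)))
    have h2 := hy.im_eq _ (quadModule_sq hq)
    rw [rieszLin_sq y hy.one, ht] at h1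
    simp [h2] at h1
    simp
    linarith
  have h1 := key 1 (by simp)
  have h2 := key Complex.I (by simp)
  simp at h1 h2
  apply Complex.ext <;> simp <;> linarith

/-- With the phase `t` for which `t ℓ(q) = |ℓ(q)|`, the inequality `ℓ(|x - tq|²) ≥ 0` reads `2x
|ℓ(q)| ≤ x² + ℓ(|q|²)`, and the right side is at most `2x²`. -/
lemma IsState.norm_rieszLin_le {r ρ : ℕ} {y : MIndex n → ℂ}
    (hy : IsState (quadModule n m N r ρ) y) {q : FPoly n} (hq : q ∈ truncPoly n r ρ) {x : ℝ}
    (hx : 0 < x) (hqx : C ((x ^ 2 : ℝ) : ℂ) - starHom n q * q ∈ quadModule n m N r ρ) :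
    ‖rieszLin y q‖ ≤ x := by
  by_cases h0 : rieszLin y q = 0
  · rw [h0, norm_zero]; exact hx.le
  have hpos : 0 < ‖rieszLin y q‖ := norm_pos_iff.2 h0
  set t : ℂ := starRingEnd ℂ (rieszLin y q) / ‖rieszLin y q‖ with ht
  have htn : ‖t‖ = 1 := by
    rw [ht, norm_div, RCLike.norm_conj, Complex.norm_real, norm_norm, div_self hpos.ne']
  have htq : t * rieszLin y q = (‖rieszLin y q‖ : ℝ) := by
    rw [ht, div_mul_eq_mul_div, mul_comm, Complex.mul_conj, Complex.normSq_eq_norm_sq,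
      Complex.ofReal_pow, sq, mul_div_assoc, div_self (Complex.ofReal_ne_zero.2 hpos.ne'), mul_one]
  have h1 := hy.nonneg _ (quadModule_sq (truncPoly_sub (truncPoly_C r ρ ((x : ℝ) : ℂ))
      (truncPoly_C_mul t hq)))
  have h2 := hy.nonneg _ hqx
  rw [map_sub, rieszLin_C, hy.one, mul_one, Complex.sub_re, Complex.ofReal_re] at h2
  rw [rieszLin_sq y hy.one, hy.rieszLin_star hq, ← map_mul, htq, htn, Complex.conj_ofReal] at h1
  have h3 : (((x : ℂ) ^ 2 - x * ((‖rieszLin y q‖ : ℝ) + (‖rieszLin y q‖ : ℝ))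
      + ((1 ^ 2 : ℝ) : ℂ) * rieszLin y (starHom n q * q)) : ℂ).re
      = x ^ 2 - x * (2 * ‖rieszLin y q‖) + (rieszLin y (starHom n q * q)).re := by
    rw [one_pow, Complex.ofReal_one, one_mul, Complex.add_re, ← Complex.ofReal_add,
      ← Complex.ofReal_pow, ← Complex.ofReal_mul, ← Complex.ofReal_sub, Complex.ofReal_re]
    ring
  rw [h3] at h1
  have h4 : x * ‖rieszLin y q‖ ≤ x * x := by nlinarith
  exact le_of_mul_le_mul_left h4 hx

/-! ### Polynomials bounded by a constant modulo the quadratic module -/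

/-- `q` has degree at most `d` and absolute value at most `x`, with a certificate in `Q_{d,ρ}`. -/
structure Dominated (m : ℕ) (N : SobolevNorm) (q : FPoly n) (x : ℝ) (d ρ : ℕ) : Prop where
  mem : q ∈ truncPoly n d ρ
  sq_le : C ((x ^ 2 : ℝ) : ℂ) - starHom n q * q ∈ quadModule n m N d ρ

/-- `x² x'² - |q q'|² = |q'|² (x² - |q|²) + x² (x'² - |q'|²)`. -/
lemma Dominated.mul {q q' : FPoly n} {x x' : ℝ} {d d' ρ : ℕ} (h : Dominated m N q x d ρ)
    (h' : Dominated m N q' x' d' ρ) : Dominated m N (q * q') (x * x') (d + d') ρ := by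
  refine ⟨truncPoly_mul h.mem h'.mem, ?_⟩
  have := quadModule_add (quadModule_mul h'.mem h.sq_le) (quadModule_mono (by omega) le_rfl
    (quadModule_C_mul (sq_nonneg x) h'.sq_le) : _ ∈ quadModule n m N (d + d') ρ)
  convert this using 1
  rw [mul_pow, Complex.ofReal_mul, map_mul, map_mul]
  ring

/-- Triangle inequality as a certificate: `x x' ((x+x')² - |q+q'|²)` equals `(x+x') x' (x² - |q|²) +
(x+x') x (x'² - |q'|²) + |x' q - x q'|²`. Division by `x x'` is why both bounds must be positive. -/
lemma Dominated.add {q q' : FPoly n} {x x' : ℝ} {d ρ : ℕ} (hx : 0 < x) (hx' : 0 < x')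
    (h : Dominated m N q x d ρ) (h' : Dominated m N q' x' d ρ) :
    Dominated m N (q + q') (x + x') d ρ := by
  refine ⟨truncPoly_add h.mem h'.mem, ?_⟩
  have h1 := truncPoly_sub (truncPoly_C_mul ((x' : ℝ) : ℂ) h.mem)
    (truncPoly_C_mul ((x : ℝ) : ℂ) h'.mem)
  have h2 := quadModule_C_mul (show 0 ≤ (x * x')⁻¹ by positivity) (quadModule_add
    (quadModule_add (quadModule_C_mul (show 0 ≤ (x + x') * x' by positivity) h.sq_le)
    (quadModule_C_mul (show 0 ≤ (x + x') * x by positivity) h'.sq_le)) (quadModule_sq h1))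
  convert h2 using 1
  have e : (C (((x * x')⁻¹ : ℝ) : ℂ) : FPoly n) * (C (x : ℂ) * C (x' : ℂ)) = 1 := by
    rw [← map_mul, ← map_mul, ← Complex.ofReal_mul, ← Complex.ofReal_mul,
      inv_mul_cancel₀ (by positivity)]
    simp
  simp only [map_sub, map_add, map_mul, Complex.ofReal_mul, Complex.ofReal_add, Complex.ofReal_pow,
    map_pow, starHom_C, Complex.conj_ofReal] at e ⊢
  linear_combination (starHom n q * q + starHom n q' * q' + starHom n q * q' + starHom n q' * q
    - (C (x : ℂ) + C (x' : ℂ)) ^ 2) * e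

lemma Dominated.one (m : ℕ) (N : SobolevNorm) (d ρ : ℕ) : Dominated m N (1 : FPoly n) 1 d ρ := by
  refine ⟨by simpa using truncPoly_C d ρ (1 : ℂ), ?_⟩
  simpa using quadModule_C (n := n) (m := m) (N := N) (r := d) (ρ := ρ) le_rfl

lemma Dominated.zero (m : ℕ) (N : SobolevNorm) (x : ℝ) (d ρ : ℕ) :
    Dominated m N (0 : FPoly n) x d ρ := by
  refine ⟨by simpa using truncPoly_C d ρ (0 : ℂ), ?_⟩
  simpa using quadModule_C (n := n) (m := m) (N := N) (r := d) (ρ := ρ) (sq_nonneg x)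

lemma Dominated.norm_rieszLin_le {q : FPoly n} {x : ℝ} {d r ρ : ℕ} (h : Dominated m N q x d ρ)
    (hx : 0 < x) (hd : d ≤ r) {y : MIndex n → ℂ} (hy : IsState (quadModule n m N r ρ) y) :
    ‖rieszLin y q‖ ≤ x :=
  hy.norm_rieszLin_le (truncPoly_mono hd le_rfl h.mem) hx (quadModule_mono hd le_rfl h.sq_le)

lemma dominated_linearForm {ρ : ℕ} (t : (Fin n → ℤ) → ℂ) {η : ℝ} (hη : 0 < η)
    (ht : ∑ k ∈ freqBox n ρ, ‖t k‖ ^ 2 / weight m N k ≤ η ^ 2) :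
    Dominated m N (∑ k ∈ freqBox n ρ, C (t k) * X k) η 1 ρ :=
  ⟨truncPoly_sum _ fun _ hk => truncPoly_C_mul _ (truncPoly_X le_rfl hk),
    quadModule_linearForm t hη ht⟩

/-- The monomial with exponent `α` in dominated polynomials depends continuously on them. -/
def StablyDominated {σ : Type*} (n m : ℕ) (N : SobolevNorm) (x : σ → ℝ) (α : σ →₀ ℕ) : Prop :=
  ∃ P D : ℝ, 0 < P ∧ 0 < D ∧ ∀ (ρ : ℕ) (F F' : σ → FPoly n) (η : ℝ), 0 < η →
    (∀ j, Dominated m N (F j) (x j) 1 ρ) → (∀ j, Dominated m N (F' j) (x j) 1 ρ) →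
    (∀ j, Dominated m N (F j - F' j) η 1 ρ) →
    Dominated m N (α.prod fun j k => F j ^ k) P α.degree ρ ∧
    Dominated m N (α.prod fun j k => F' j ^ k) P α.degree ρ ∧
    Dominated m N ((α.prod fun j k => F j ^ k) - α.prod fun j k => F' j ^ k) (D * η) α.degree ρ

/-- Product rule `uv - u'v' = (u - u') v + u' (v - v')`; this produces the constant `D P' + P D'`.
-/
lemma StablyDominated.add {σ : Type*} {x : σ → ℝ} {α α' : σ →₀ ℕ}
    (h : StablyDominated n m N x α) (h' : StablyDominated n m N x α') :
    StablyDominated n m N x (α + α') := by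
  obtain ⟨P, D, hP, hD, h⟩ := h
  obtain ⟨P', D', hP', hD', h'⟩ := h'
  refine ⟨P * P', D * P' + P * D', by positivity, by positivity, fun ρ F F' η hη h1 h2 h3 => ?_⟩
  obtain ⟨a1, a2, a3⟩ := h ρ F F' η hη h1 h2 h3
  obtain ⟨b1, b2, b3⟩ := h' ρ F F' η hη h1 h2 h3
  rw [map_add, Finsupp.prod_add_index' (by simp) (by simp [pow_add]),
    Finsupp.prod_add_index' (by simp) (by simp [pow_add])]
  refine ⟨a1.mul b1, a2.mul b2, ?_⟩
  have := Dominated.add (by positivity) (by positivity) (a3.mul b1) (a2.mul b3)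
  convert this using 1 <;> ring

/-- The constants depend on `α` and the bounds `x` only. This independence of `ρ` and of the forms
makes the tail estimate uniform over all levels. -/
lemma stablyDominated {σ : Type*} (n m : ℕ) (N : SobolevNorm) (x : σ → ℝ)
    (hx : ∀ j, 0 < x j) (α : σ →₀ ℕ) : StablyDominated n m N x α := by
  have hzero : StablyDominated n m N x 0 := by
    refine ⟨1, 1, one_pos, one_pos, fun ρ F F' η hη h1 h2 h3 => ?_⟩
    simp only [Finsupp.prod_zero_index, sub_self]
    exact ⟨.one _ _ _ _, .one _ _ _ _, .zero _ _ _ _ _⟩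
  induction α using Finsupp.induction_linear with
  | zero => exact hzero
  | add f g hf hg => exact hf.add hg
  | single j k =>
    induction k with
    | zero => rwa [Finsupp.single_zero]
    | succ k ih =>
      rw [Finsupp.single_add]
      refine ih.add ⟨x j, 1, hx j, one_pos, fun ρ F F' η hη h1 h2 h3 => ?_⟩
      simp only [Finsupp.prod_single_index, pow_zero, pow_one, Finsupp.degree_single, one_mul]
      exact ⟨h1 j, h2 j, h3 j⟩

end SobolevPOP

end

/-! ### Fourier analysis and weak derivatives on the torus. -/

noncomputable section

namespace SobolevPOP

variable {n : ℕ}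

/-! ### The torus -/

lemma isOpenQuotientMap_toTorus : IsOpenQuotientMap (toTorus (n := n)) :=
  IsOpenQuotientMap.piMap fun _ => QuotientAddGroup.isOpenQuotientMap_mk

lemma continuous_of_comp_toTorus {φ : Torus n → ℂ} (h : Continuous fun x => φ (toTorus x)) :
    Continuous φ :=
  isOpenQuotientMap_toTorus.isQuotientMap.continuous_iff.2 h

lemma toTorus_add (x y : Fin n → ℝ) : toTorus (x + y) = toTorus x + toTorus y := by
  ext i; simp [toTorus]

lemma mFourier_toTorus (a : Fin n → ℤ) (x : Fin n → ℝ) :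
    UnitAddTorus.mFourier a (toTorus x)
      = Complex.exp (∑ i, 2 * Real.pi * Complex.I * (a i : ℂ) * (x i : ℂ)) := by
  rw [Complex.exp_sum]
  simp only [UnitAddTorus.mFourier, ContinuousMap.coe_mk, toTorus]
  refine Finset.prod_congr rfl fun i _ => ?_
  rw [fourier_coe_apply]
  simp

lemma mFourier_norm_apply (a : Fin n → ℤ) (x : Torus n) : ‖UnitAddTorus.mFourier a x‖ = 1 := by
  simp only [UnitAddTorus.mFourier, fourier_apply, ContinuousMap.coe_mk, norm_prod,
    Circle.norm_coe, Finset.prod_const_one]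

lemma integrable_of_continuous {φ : Torus n → ℂ} (h : Continuous φ) :
    Integrable φ (torusMeasure n) :=
  h.integrable_of_hasCompactSupport (HasCompactSupport.of_compactSpace φ)

/-- Smooth functions on the torus. -/
def SmoothTorus (φ : Torus n → ℂ) : Prop :=
  ContDiff ℝ (⊤ : ℕ∞) fun x : Fin n → ℝ => φ (toTorus x)

lemma SmoothTorus.continuous {φ : Torus n → ℂ} (h : SmoothTorus φ) : Continuous φ :=
  continuous_of_comp_toTorus (ContDiff.continuous h)

lemma hasFDerivAt_mFourier (a : Fin n → ℤ) (x : Fin n → ℝ) :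
    HasFDerivAt (fun x : Fin n → ℝ => UnitAddTorus.mFourier a (toTorus x))
      (UnitAddTorus.mFourier a (toTorus x) • ∑ i, (2 * Real.pi * Complex.I * (a i : ℂ)) •
        (Complex.ofRealCLM.comp (ContinuousLinearMap.proj (R := ℝ) (φ := fun _ : Fin n => ℝ) i)))
      x := by
  simp only [mFourier_toTorus]
  refine HasFDerivAt.cexp ?_
  refine HasFDerivAt.fun_sum fun i _ => ?_
  exact ((Complex.ofRealCLM.comp (ContinuousLinearMap.proj (R := ℝ)
    (φ := fun _ : Fin n => ℝ) i)).hasFDerivAt (x := x)).const_mul (2 * Real.pi * Complex.I * (a i : ℂ))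

lemma smoothTorus_mFourier (a : Fin n → ℤ) : SmoothTorus (UnitAddTorus.mFourier a) := by
  unfold SmoothTorus
  simp only [mFourier_toTorus]
  refine ContDiff.cexp (ContDiff.sum fun i _ => contDiff_const.mul ?_)
  exact Complex.ofRealCLM.contDiff.comp (contDiff_apply ℝ ℝ i)

lemma partialD_mFourier (a : Fin n → ℤ) (z : ℂ) (i : Fin n) :
    partialD i (fun x => z * UnitAddTorus.mFourier a (toTorus x))
      = fun x => (2 * Real.pi * Complex.I * (a i : ℂ) * z) *
          UnitAddTorus.mFourier a (toTorus x) := by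
  ext x
  unfold partialD
  rw [((hasFDerivAt_mFourier a x).const_mul z).fderiv]
  simp only [FunLike.coe_smul, Pi.smul_apply, FunLike.coe_sum, Finset.sum_apply,
    ContinuousLinearMap.comp_apply, ContinuousLinearMap.proj_apply, Complex.ofRealCLM_apply]
  rw [Finset.sum_eq_single i]
  · simp; ring
  · intro j _ hj; simp [Pi.single_eq_of_ne hj]
  · simp

lemma iterate_partialD_mFourier (a : Fin n → ℤ) (i : Fin n) (k : ℕ) (z : ℂ) :
    (partialD i)^[k] (fun x => z * UnitAddTorus.mFourier a (toTorus x))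
      = fun x => ((2 * Real.pi * Complex.I * (a i : ℂ)) ^ k * z) *
          UnitAddTorus.mFourier a (toTorus x) := by
  induction k generalizing z with
  | zero => simp
  | succ k ih =>
    rw [Function.iterate_succ_apply, partialD_mFourier, ih]
    ext x; ring

lemma classicalD_mFourier (b : Fin n → ℕ) (a : Fin n → ℤ) :
    classicalD b (fun x => UnitAddTorus.mFourier a (toTorus x))
      = fun x => symbol b a * UnitAddTorus.mFourier a (toTorus x) := by
  have key : ∀ l : List (Fin n), l.foldr (fun i v => (partialD i)^[b i] v)
      (fun x => UnitAddTorus.mFourier a (toTorus x))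
      = fun x => (l.map fun i => (2 * Real.pi * Complex.I * (a i : ℂ)) ^ b i).prod *
          UnitAddTorus.mFourier a (toTorus x) := by
    intro l
    induction l with
    | nil => simp
    | cons i l ih => rw [List.foldr_cons, ih, iterate_partialD_mFourier]; simp
  rw [classicalD, key, symbol, Fin.prod_univ_def]

/-! ### Integration by parts -/

/-- The partial derivative of a function on the torus. -/
def torusD (i : Fin n) (φ : Torus n → ℂ) (y : Torus n) : ℂ :=
  fderiv ℝ (fun v : Fin n → ℝ => φ (y + toTorus v)) 0 (Pi.single i 1)

lemma torusD_toTorus (i : Fin n) (φ : Torus n → ℂ) (x : Fin n → ℝ) :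
    torusD i φ (toTorus x) = partialD i (fun x => φ (toTorus x)) x := by
  unfold torusD partialD
  simp_rw [← toTorus_add]
  rw [fderiv_comp_add_left (f := fun x => φ (toTorus x)) x, add_zero]

lemma SmoothTorus.torusD {φ : Torus n → ℂ} (h : SmoothTorus φ) (i : Fin n) :
    SmoothTorus (torusD i φ) := by
  unfold SmoothTorus
  simp_rw [torusD_toTorus]
  unfold partialD
  exact (ContDiff.fderiv_right (m := (⊤ : ℕ∞)) h (by simp)).clm_apply contDiff_const

lemma SmoothTorus.mul {φ ψ : Torus n → ℂ} (h : SmoothTorus φ) (h' : SmoothTorus ψ) :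
    SmoothTorus (fun x => φ x * ψ x) := ContDiff.mul h h'

lemma SmoothTorus.hasDerivAt {φ : Torus n → ℂ} (h : SmoothTorus φ) (i : Fin n) (y : Torus n)
    (t : ℝ) : HasDerivAt (fun t : ℝ => φ (y + toTorus (Pi.single i t)))
      (SobolevPOP.torusD i φ (y + toTorus (Pi.single i t))) t := by
  obtain ⟨x, rfl⟩ := isOpenQuotientMap_toTorus.surjective y
  simp_rw [← toTorus_add, torusD_toTorus]
  have h1 : HasFDerivAt (fun x => φ (toTorus x))
      (fderiv ℝ (fun x => φ (toTorus x)) (x + Pi.single i t)) (x + Pi.single i t) :=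
    (ContDiff.differentiable h (by simp) _).hasFDerivAt
  have h2 : HasDerivAt (fun t : ℝ => x + Pi.single i t) (Pi.single i (1 : ℝ)) t := by
    refine HasDerivAt.const_add _ ?_
    rw [hasDerivAt_pi]
    intro j
    by_cases hj : j = i
    · subst hj; simpa using! hasDerivAt_id' t
    · simpa [Pi.single_eq_of_ne hj] using hasDerivAt_const t (0 : ℝ)
  exact h1.comp_hasDerivAt t h2

/-- By translation invariance `t ↦ ∫ φ(y + t e_i) dy` is constant; differentiate under the integral
at `t = 0`. -/
lemma integral_torusD {φ : Torus n → ℂ} (h : SmoothTorus φ) (i : Fin n) :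
    ∫ x, torusD i φ x ∂(torusMeasure n) = 0 := by
  have hc := (h.torusD i).continuous
  obtain ⟨M, hM⟩ := (isCompact_range hc.norm).bddAbove
  have key := hasDerivAt_integral_of_dominated_loc_of_deriv_le (μ := torusMeasure n) (𝕜 := ℝ)
    (F := fun t y => φ (y + toTorus (Pi.single i t))) (x₀ := (0 : ℝ)) (s := Set.univ)
    (F' := fun t y => torusD i φ (y + toTorus (Pi.single i t))) (bound := fun _ => M)
    Filter.univ_mem
    (Filter.Eventually.of_forall fun t =>
      (h.continuous.comp (continuous_id.add continuous_const)).aestronglyMeasurable)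
    (integrable_of_continuous (h.continuous.comp (continuous_id.add continuous_const)))
    ((hc.comp (continuous_id.add continuous_const)).aestronglyMeasurable)
    (Filter.Eventually.of_forall fun y t _ => hM ⟨_, rfl⟩)
    (integrable_const M)
    (Filter.Eventually.of_forall fun y t _ => h.hasDerivAt i y t)
  have h2 := key.2
  simp_rw [integral_add_right_eq_self (μ := torusMeasure n) φ] at h2
  have h3 := h2.unique (hasDerivAt_const (0 : ℝ) _)
  rwa [integral_add_right_eq_self (μ := torusMeasure n) (torusD i φ)] at h3

lemma torusD_mul_mFourier {φ : Torus n → ℂ} (h : SmoothTorus φ) (i : Fin n) (a : Fin n → ℤ)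
    (y : Torus n) :
    torusD i (fun x => φ x * UnitAddTorus.mFourier (-a) x) y
      = torusD i φ y * UnitAddTorus.mFourier (-a) y
        - 2 * Real.pi * Complex.I * (a i : ℂ) * (φ y * UnitAddTorus.mFourier (-a) y) := by
  obtain ⟨x, rfl⟩ := isOpenQuotientMap_toTorus.surjective y
  simp_rw [torusD_toTorus]
  have h3 := congrFun (partialD_mFourier (-a) 1 i) x
  unfold partialD at h3 ⊢
  simp only [one_mul, mul_one] at h3
  rw [fderiv_fun_mul (ContDiff.differentiable h (by simp) _)
    (ContDiff.differentiable (smoothTorus_mFourier (-a)) (by simp) _)]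
  simp only [FunLike.coe_add, FunLike.coe_smul, Pi.add_apply, Pi.smul_apply, smul_eq_mul, h3]
  simp only [Pi.neg_apply, Int.cast_neg]
  ring

/-- Integration by parts: the derivative of the product `φ e_a` has integral zero. -/
lemma integral_torusD_mul_mFourier {φ : Torus n → ℂ} (h : SmoothTorus φ) (i : Fin n)
    (a : Fin n → ℤ) :
    ∫ x, torusD i φ x * UnitAddTorus.mFourier (-a) x ∂(torusMeasure n)
      = 2 * Real.pi * Complex.I * (a i : ℂ) *
        ∫ x, φ x * UnitAddTorus.mFourier (-a) x ∂(torusMeasure n) := by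
  have h1 := integral_torusD (h.mul (smoothTorus_mFourier (-a))) i
  have hc := (smoothTorus_mFourier (-a)).continuous
  simp_rw [torusD_mul_mFourier h] at h1
  have e1 : Integrable (fun x => torusD i φ x * UnitAddTorus.mFourier (-a) x) (torusMeasure n) :=
    integrable_of_continuous ((h.torusD i).continuous.mul hc)
  have e2 : Integrable (fun x => φ x * UnitAddTorus.mFourier (-a) x) (torusMeasure n) :=
    integrable_of_continuous (h.continuous.mul hc)
  rw [integral_sub e1 (e2.const_mul _), integral_const_mul] at h1
  exact sub_eq_zero.1 h1

/-- Fourier coefficients of classical derivatives. -/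
lemma SmoothTorus.integral_classicalD {φ ψ : Torus n → ℂ} (h : SmoothTorus φ) (b : Fin n → ℕ)
    (hψ : ∀ x, ψ (toTorus x) = classicalD b (fun x => φ (toTorus x)) x) :
    Continuous ψ ∧ ∀ a, ∫ x, ψ x * UnitAddTorus.mFourier (-a) x ∂(torusMeasure n)
      = symbol b a * ∫ x, φ x * UnitAddTorus.mFourier (-a) x ∂(torusMeasure n) := by
  -- The derivatives are taken on `ℝ^n`; at each stage the result is realized again as a smooth
  -- function on the torus, so that integration by parts can be repeated.
  have hiter : ∀ (i : Fin n) (k : ℕ) (φ : Torus n → ℂ), SmoothTorus φ →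
      ∃ ψ : Torus n → ℂ, SmoothTorus ψ ∧
        ((fun x => ψ (toTorus x)) = (partialD i)^[k] fun x => φ (toTorus x)) ∧
        ∀ a, ∫ x, ψ x * UnitAddTorus.mFourier (-a) x ∂(torusMeasure n)
          = (2 * Real.pi * Complex.I * (a i : ℂ)) ^ k *
            ∫ x, φ x * UnitAddTorus.mFourier (-a) x ∂(torusMeasure n) := by
    intro i k
    induction k with
    | zero => exact fun φ hφ => ⟨φ, hφ, rfl, fun a => by simp⟩
    | succ k ih =>
      intro φ hφ
      obtain ⟨ψ, h1, h2, h3⟩ := ih (SobolevPOP.torusD i φ) (hφ.torusD i)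
      refine ⟨ψ, h1, ?_, fun a => ?_⟩
      · rw [h2, Function.iterate_succ_apply]
        congr 1
        ext x; exact torusD_toTorus i φ x
      · rw [h3, integral_torusD_mul_mFourier hφ]; ring
  have hlist : ∀ l : List (Fin n), ∃ ψ : Torus n → ℂ, SmoothTorus ψ ∧
        ((fun x => ψ (toTorus x)) = l.foldr (fun i v => (partialD i)^[b i] v)
          fun x => φ (toTorus x)) ∧
        ∀ a, ∫ x, ψ x * UnitAddTorus.mFourier (-a) x ∂(torusMeasure n)
          = (l.map fun i => (2 * Real.pi * Complex.I * (a i : ℂ)) ^ b i).prod *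
            ∫ x, φ x * UnitAddTorus.mFourier (-a) x ∂(torusMeasure n) := by
    intro l
    induction l with
    | nil => exact ⟨φ, h, rfl, fun a => by simp⟩
    | cons i l ih =>
      obtain ⟨ψ, h1, h2, h3⟩ := ih
      obtain ⟨ψ', h1', h2', h3'⟩ := hiter i (b i) ψ h1
      refine ⟨ψ', h1', ?_, fun a => ?_⟩
      · rw [h2', h2, List.foldr_cons]
      · rw [h3', h3, List.map_cons, List.prod_cons]; ring
  obtain ⟨ψ', h1, h2, h3⟩ := hlist (List.finRange n)
  have : ψ = ψ' := by
    ext y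
    obtain ⟨x, rfl⟩ := isOpenQuotientMap_toTorus.surjective y
    rw [hψ, classicalD, ← h2]
  subst this
  exact ⟨h1.continuous, fun a => by rw [h3, symbol, Fin.prod_univ_def]⟩

/-! ### Fourier coefficients -/

lemma fourierCoeff_eq (f : L2 n) : fourierCoeff f = UnitAddTorus.mFourierCoeff f := by
  ext a
  unfold fourierCoeff UnitAddTorus.mFourierCoeff
  simp only [smul_eq_mul, mul_comm]
  rfl

lemma hasSum_sq_fourierCoeff (f : L2 n) :
    HasSum (fun a => ‖fourierCoeff f a‖ ^ 2) (∫ x, ‖f x‖ ^ 2 ∂(torusMeasure n)) := by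
  rw [fourierCoeff_eq]
  exact UnitAddTorus.hasSum_sq_mFourierCoeff f

/-- Parseval's identity, without conjugation. -/
lemma hasSum_integral_mul (f : L2 n) {φ : Torus n → ℂ} (hφ : Continuous φ) :
    HasSum (fun a => (∫ x, φ x * UnitAddTorus.mFourier a x ∂(torusMeasure n)) * fourierCoeff f a)
      (∫ x, f x * φ x ∂(torusMeasure n)) := by
  -- Pairing with the conjugate of `φ` cancels the conjugation in the inner product.
  set g : C(Torus n, ℂ) := ⟨fun x => starRingEnd ℂ (φ x), Complex.continuous_conj.comp hφ⟩
  have h := UnitAddTorus.hasSum_prod_mFourierCoeff (g.toLp 2 (torusMeasure n) ℂ) f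
  rw [← fourierCoeff_eq f] at h
  convert h using 1
  · ext a
    congr 1
    refine Eq.trans ?_ (congrArg _ (UnitAddTorus.mFourierCoeff_toLp g a).symm)
    unfold UnitAddTorus.mFourierCoeff
    rw [← integral_conj]
    refine integral_congr_ae (Filter.Eventually.of_forall fun x => ?_)
    simp [g, UnitAddTorus.mFourier_neg, mul_comm]
  · refine integral_congr_ae ?_
    filter_upwards [ContinuousMap.coeFn_toLp (p := 2) (𝕜 := ℂ) (torusMeasure n) g] with x hx
    change f x * φ x = starRingEnd ℂ ((g.toLp 2 (torusMeasure n) ℂ) x) * f x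
    rw [hx]
    simp [g, mul_comm]

lemma ext_fourierCoeff {f g : L2 n} (h : ∀ a, fourierCoeff f a = fourierCoeff g a) : f = g := by
  have hf := UnitAddTorus.hasSum_mFourier_series_L2 f
  have hg := UnitAddTorus.hasSum_mFourier_series_L2 g
  rw [← fourierCoeff_eq] at hf hg
  rw [funext h] at hf
  exact hf.unique hg

lemma exists_fourierCoeff {c : (Fin n → ℤ) → ℂ} (hc : Summable fun a => ‖c a‖ ^ 2) :
    ∃ f : L2 n, ∀ a, fourierCoeff f a = c a := by
  have hc' : Memℓp c 2 := by
    rw [memℓp_gen_iff (by norm_num)]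
    simpa using hc
  refine ⟨UnitAddTorus.mFourierBasis.repr.symm ⟨c, hc'⟩, fun a => ?_⟩
  rw [fourierCoeff_eq, ← UnitAddTorus.mFourierBasis_repr, LinearIsometryEquiv.apply_symm_apply]

lemma symbol_neg (b : Fin n → ℕ) (a : Fin n → ℤ) :
    symbol b (-a) = (-1) ^ order b * symbol b a := by
  simp only [symbol, order]
  rw [← Finset.prod_pow_eq_pow_sum, ← Finset.prod_mul_distrib]
  refine Finset.prod_congr rfl fun i _ => ?_
  rw [← mul_pow]
  simp

lemma symbol_neg_eq_conj (b : Fin n → ℕ) (a : Fin n → ℤ) :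
    symbol b (-a) = starRingEnd ℂ (symbol b a) := by
  simp only [symbol, map_prod, map_pow, map_mul, map_ofNat, Complex.conj_ofReal, Complex.conj_I,
    map_intCast, Pi.neg_apply, Int.cast_neg, mul_neg, neg_mul]

/-- Both pairings expand by Parseval. The coefficients of `D^b φ` enter at `-a`, and the sign of
`symbol b (-a)` cancels `(-1)^|b|`. -/
lemma hasWeakDeriv_of_fourierCoeff {b : Fin n → ℕ} {f g : L2 n}
    (h : ∀ a, fourierCoeff g a = symbol b a * fourierCoeff f a) : HasWeakDeriv b f g := by
  intro φ ψ hφ hψ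
  obtain ⟨hc, hint⟩ := SmoothTorus.integral_classicalD hφ b hψ
  have h1 := hasSum_integral_mul g (SmoothTorus.continuous hφ)
  have h2 := (hasSum_integral_mul f hc).mul_left ((-1 : ℂ) ^ order b)
  refine h1.unique (h2.congr_fun fun a => ?_)
  have h3 := hint (-a)
  rw [neg_neg] at h3
  rw [h3, h, symbol_neg]
  have : ((-1 : ℂ) ^ order b) * (-1) ^ order b = 1 := by
    rw [← mul_pow]; simp
  linear_combination (-(symbol b a * fourierCoeff f a *
    ∫ x, φ x * UnitAddTorus.mFourier a x ∂(torusMeasure n))) * this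

/-- Exponentials are eigenfunctions of `D^b`, so testing against them suffices. Hence weak
derivatives are unique and the choice made in `weakDeriv` does not matter. -/
lemma HasWeakDeriv.fourierCoeff_eq {b : Fin n → ℕ} {f g : L2 n} (h : HasWeakDeriv b f g)
    (a : Fin n → ℤ) : fourierCoeff g a = symbol b a * fourierCoeff f a := by
  have h1 := h (UnitAddTorus.mFourier (-a)) (fun x => symbol b (-a) * UnitAddTorus.mFourier (-a) x)
    (smoothTorus_mFourier (-a)) (fun x => by rw [classicalD_mFourier])
  unfold fourierCoeff
  rw [h1]
  simp_rw [mul_left_comm _ (symbol b (-a))]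
  rw [integral_const_mul, symbol_neg, ← mul_assoc, ← mul_assoc, ← mul_pow]
  simp

lemma fourierCoeff_weakDeriv {b : Fin n → ℕ} {f : L2 n} (h : ∃ g, HasWeakDeriv b f g)
    (a : Fin n → ℤ) : fourierCoeff (weakDeriv b f) a = symbol b a * fourierCoeff f a := by
  unfold weakDeriv
  rw [dif_pos h]
  exact h.choose_spec.fourierCoeff_eq a

lemma fourierCoeff_neg_of_real {f : L2 n} (h : ∀ᵐ x ∂(torusMeasure n), (f x).im = 0)
    (a : Fin n → ℤ) : fourierCoeff f (-a) = starRingEnd ℂ (fourierCoeff f a) := by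
  unfold fourierCoeff
  rw [← integral_conj]
  refine integral_congr_ae ?_
  filter_upwards [h] with x hx
  rw [map_mul, Complex.conj_eq_iff_im.2 hx, ← UnitAddTorus.mFourier_neg]

/-- The conjugate of `f` has the same Fourier coefficients as `f`, hence equals it in `L²`. -/
lemma real_of_fourierCoeff_neg {f : L2 n}
    (h : ∀ a, fourierCoeff f (-a) = starRingEnd ℂ (fourierCoeff f a)) :
    ∀ᵐ x ∂(torusMeasure n), (f x).im = 0 := by
  have hmem : MemLp (fun x => starRingEnd ℂ (f x)) 2 (torusMeasure n) := (Lp.memLp f).star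
  have hg : hmem.toLp = f := by
    apply ext_fourierCoeff
    intro a
    rw [← neg_neg a, h]
    unfold fourierCoeff
    rw [← integral_conj]
    refine integral_congr_ae ?_
    filter_upwards [hmem.coeFn_toLp] with x hx
    rw [hx, map_mul, ← UnitAddTorus.mFourier_neg]
  have h2 := hmem.coeFn_toLp
  rw [hg] at h2
  filter_upwards [h2] with x hx
  exact Complex.conj_eq_iff_im.1 hx.symm

/-- An `L²` function with absolutely summable Fourier coefficients is the sum of its Fourier
series almost everywhere. -/
lemma ae_hasSum_fourier {g : L2 n} (h : Summable fun a => ‖fourierCoeff g a‖) :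
    ∀ᵐ x ∂(torusMeasure n),
      HasSum (fun a => fourierCoeff g a * UnitAddTorus.mFourier a x) (g x) := by
  -- The series converges in the sup norm to a continuous `G`; its image in `L²` has to be `g`.
  have hs : Summable fun a => fourierCoeff g a • (UnitAddTorus.mFourier a : C(Torus n, ℂ)) := by
    refine Summable.of_norm ?_
    simpa [norm_smul, UnitAddTorus.mFourier_norm] using h
  obtain ⟨G, hG⟩ := hs
  have h1 : HasSum (fun a => fourierCoeff g a • UnitAddTorus.mFourierLp 2 a)
      (ContinuousMap.toLp 2 (torusMeasure n) ℂ G) := by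
    have := (ContinuousMap.toLp 2 (torusMeasure n) ℂ (E := ℂ)).hasSum hG
    simpa only [map_smul] using! this
  have h2 := UnitAddTorus.hasSum_mFourier_series_L2 g
  rw [← fourierCoeff_eq] at h2
  have h3 := h2.unique h1
  have h4 := ContinuousMap.coeFn_toLp (p := 2) (𝕜 := ℂ) (torusMeasure n) G
  rw [← h3] at h4
  filter_upwards [h4] with x hx
  rw [hx]
  simpa using (ContinuousMap.evalCLM ℂ x).hasSum hG

end SobolevPOP

end

/-! ### Sobolev weights, the ball as an ellipsoid, and compactness. -/

noncomputable section

namespace SobolevPOP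

variable {n m : ℕ} {N : SobolevNorm}

/-! ### Weights -/

lemma norm_symbol_sq (b : Fin n → ℕ) (a : Fin n → ℤ) :
    ‖symbol b a‖ ^ 2 = ∏ i, (2 * Real.pi * (a i : ℝ)) ^ (2 * b i) := by
  simp only [symbol, norm_prod, norm_pow, ← Finset.prod_pow]
  refine Finset.prod_congr rfl fun i _ => ?_
  rw [pow_mul, ← pow_mul, mul_comm (b i), pow_mul]
  congr 1
  simp [mul_pow, abs_of_pos Real.pi_pos]

lemma symbol_zero (a : Fin n → ℤ) : symbol 0 a = 1 := by simp [symbol]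

lemma mem_multiIndices {b : Fin n → ℕ} : b ∈ multiIndices n m ↔ order b ≤ m := by
  refine ⟨fun h => (Finset.mem_filter.1 h).2, fun h => Finset.mem_filter.2
    ⟨Fintype.mem_piFinset.2 fun i => Finset.mem_range.2 ?_, h⟩⟩
  have := Finset.single_le_sum (f := b) (fun _ _ => Nat.zero_le _) (Finset.mem_univ i)
  exact Nat.lt_succ_of_le (this.trans h)

lemma norm_symbol_sq_le_weight_derivative {b : Fin n → ℕ} (hb : order b ≤ m) (a : Fin n → ℤ) :
    ‖symbol b a‖ ^ 2 ≤ weight m .derivative a := by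
  have := Finset.single_le_sum (f := fun b => ‖symbol b a‖ ^ 2) (fun b _ => by positivity)
    (mem_multiIndices.2 hb)
  simpa only [weight, norm_symbol_sq] using this

lemma norm_symbol_sq_le (b : Fin n → ℕ) (a : Fin n → ℤ) :
    ‖symbol b a‖ ^ 2 ≤ (2 * Real.pi) ^ (2 * order b) * (1 + ∑ i, (a i : ℝ) ^ 2) ^ order b := by
  rw [norm_symbol_sq, order, pow_mul, ← mul_pow, ← Finset.prod_pow_eq_pow_sum]
  refine Finset.prod_le_prod (fun i _ => by rw [pow_mul]; positivity) fun i _ => ?_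
  rw [pow_mul]
  refine pow_le_pow_left₀ (by positivity) ?_ _
  rw [mul_pow]
  refine mul_le_mul_of_nonneg_left ?_ (by positivity)
  have := Finset.single_le_sum (f := fun i => (a i : ℝ) ^ 2) (fun _ _ => by positivity)
    (Finset.mem_univ i)
  linarith

/-- For the derivative norm a single multi-index is enough: `b = m e_i`, where `i` is a coordinate
with largest `|a_i|`, since `1 + |a|² ≤ (n+1) a_i²`. -/
lemma exists_le_weight (n m : ℕ) (N : SobolevNorm) : ∃ K : ℝ, 0 < K ∧ ∀ a : Fin n → ℤ,
    (1 + ∑ i, (a i : ℝ) ^ 2) ^ m ≤ K * weight m N a := by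
  cases N with
  | fourier => exact ⟨1, one_pos, fun a => by simp [weight]⟩
  | derivative =>
    refine ⟨(n + 1 : ℝ) ^ m, by positivity, fun a => ?_⟩
    -- At `a = 0` there is no coordinate with `a_i² ≥ 1`; here `b = 0` contributes `1` to the
    -- weight.
    by_cases ha : a = 0
    · subst ha
      have h1 : (1 : ℝ) ≤ weight m .derivative (0 : Fin n → ℤ) := by
        have := norm_symbol_sq_le_weight_derivative (m := m) (b := 0) (by simp [order])
          (0 : Fin n → ℤ)
        simpa [symbol_zero] using this
      have h2 : (1 : ℝ) ≤ (n + 1 : ℝ) ^ m := one_le_pow₀ (by linarith [n.cast_nonneg (α := ℝ)])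
      simpa using one_le_mul_of_one_le_of_one_le h2 h1
    · obtain ⟨j, hj⟩ := Function.ne_iff.1 ha
      obtain ⟨i, -, hi⟩ := Finset.exists_max_image Finset.univ (fun i => (a i : ℝ) ^ 2)
        ⟨j, Finset.mem_univ j⟩
      have hj1 : (1 : ℝ) ≤ (a j : ℝ) ^ 2 := by
        have : (1 : ℤ) ≤ a j ^ 2 := Int.add_one_le_iff.2 (sq_pos_iff.2 hj)
        exact_mod_cast this
      have hi1 := hj1.trans (hi j (Finset.mem_univ j))
      have hsum : 1 + ∑ k, (a k : ℝ) ^ 2 ≤ (n + 1) * (a i : ℝ) ^ 2 := by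
        have := Finset.sum_le_card_nsmul Finset.univ (fun k => (a k : ℝ) ^ 2) _
          (fun k hk => hi k hk)
        rw [Finset.card_univ, Fintype.card_fin, nsmul_eq_mul] at this
        linarith
      have hw := norm_symbol_sq_le_weight_derivative (m := m) (b := Pi.single i m)
        (by simp [order]) a
      rw [norm_symbol_sq, Finset.prod_eq_single i (fun k _ hk => by simp [hk]) (by simp),
        Pi.single_eq_same, pow_mul] at hw
      calc (1 + ∑ k, (a k : ℝ) ^ 2) ^ m ≤ ((n + 1) * (a i : ℝ) ^ 2) ^ m :=
            pow_le_pow_left₀ (by positivity) hsum _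
        _ = (n + 1 : ℝ) ^ m * ((a i : ℝ) ^ 2) ^ m := mul_pow _ _ _
        _ ≤ (n + 1 : ℝ) ^ m * ((2 * Real.pi * (a i : ℝ)) ^ 2) ^ m := by
            refine mul_le_mul_of_nonneg_left (pow_le_pow_left₀ (by positivity) ?_ _) (by positivity)
            rw [mul_pow]
            refine le_mul_of_one_le_left (by positivity) (one_le_pow₀ ?_)
            linarith [Real.pi_gt_three]
        _ ≤ _ := mul_le_mul_of_nonneg_left hw (by positivity)

lemma exists_norm_symbol_sq_le_weight (N : SobolevNorm) {b : Fin n → ℕ} (hb : order b ≤ m) :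
    ∃ K : ℝ, 0 < K ∧ ∀ a : Fin n → ℤ, ‖symbol b a‖ ^ 2 ≤ K * weight m N a := by
  obtain ⟨K, hK, h⟩ := exists_le_weight n m N
  refine ⟨(2 * Real.pi) ^ (2 * order b) * K, by positivity, fun a => ?_⟩
  refine (norm_symbol_sq_le b a).trans ?_
  rw [mul_assoc]
  refine mul_le_mul_of_nonneg_left (le_trans ?_ (h a)) (by positivity)
  exact pow_le_pow_right₀ (by simp; positivity) hb

/-- Comparison with the lattice sum of `‖a‖^(-2k)` in the sup norm, which converges for `2k > n`;
only `a = 0` escapes the comparison. -/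
lemma summable_inv_pow {k : ℕ} (hk : n < 2 * k) :
    Summable fun a : Fin n → ℤ => ((1 + ∑ i, (a i : ℝ) ^ 2) ^ k)⁻¹ := by
  set b := Pi.basisFun ℝ (Fin n)
  set L : Submodule ℤ (Fin n → ℝ) := Submodule.span ℤ (Set.range b)
  have hrank : Module.finrank ℤ L = n := by
    rw [Module.finrank_eq_card_basis (b.restrictScalars ℤ), Fintype.card_fin]
  have h := ZLattice.summable_norm_pow_inv L (2 * k) (by rw [hrank]; exact hk)
  have hmem : ∀ a : Fin n → ℤ, (fun i => (a i : ℝ)) ∈ L := fun a => by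
    have : (fun i => (a i : ℝ)) = ∑ i, a i • b i := by
      ext j
      simp [b, Pi.single_apply]
    rw [this]
    exact Submodule.sum_mem _ fun i _ => Submodule.smul_mem _ _ (Submodule.subset_span ⟨i, rfl⟩)
  have h2 := h.comp_injective (i := fun a : Fin n → ℤ => (⟨_, hmem a⟩ : L)) (fun a a' haa => by
    ext i
    have : (a i : ℝ) = a' i := congrFun (congrArg Subtype.val haa) i
    exact_mod_cast this)
  refine Summable.of_norm_bounded_eventually h2 ?_
  refine (Set.finite_singleton (0 : Fin n → ℤ)).subset fun a ha => ?_
  by_contra ha0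
  apply ha
  have hpos : 0 < ‖fun i => (a i : ℝ)‖ := norm_pos_iff.2 fun h0 => ha0 (by
    ext i
    have := congrFun h0 i
    simpa using this)
  change ‖((1 + ∑ i, (a i : ℝ) ^ 2) ^ k)⁻¹‖ ≤ (‖fun i => (a i : ℝ)‖)⁻¹ ^ (2 * k)
  rw [norm_inv, Real.norm_of_nonneg (by positivity), inv_pow, pow_mul]
  refine inv_anti₀ (by positivity) (pow_le_pow_left₀ (by positivity) ?_ _)
  have : ‖fun i => (a i : ℝ)‖ ≤ √(1 + ∑ i, (a i : ℝ) ^ 2) := by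
    refine (pi_norm_le_iff_of_nonneg (by positivity)).2 fun i => Real.abs_le_sqrt ?_
    have := Finset.single_le_sum (f := fun i => (a i : ℝ) ^ 2) (fun _ _ => by positivity)
      (Finset.mem_univ i)
    linarith
  calc ‖fun i => (a i : ℝ)‖ ^ 2 ≤ √(1 + ∑ i, (a i : ℝ) ^ 2) ^ 2 :=
        pow_le_pow_left₀ (norm_nonneg _) this _
    _ = _ := Real.sq_sqrt (by positivity)

/-- The quotient is of order `(1 + |a|²)^(-(m - |b|))`, so the Sobolev condition `m > |b| + n/2` is
the convergence condition for the lattice sum. -/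
lemma summable_symbol_div_weight (N : SobolevNorm) {b : Fin n → ℕ}
    (hb : 2 * order b + n < 2 * m) :
    Summable fun a : Fin n → ℤ => ‖symbol b a‖ ^ 2 / weight m N a := by
  obtain ⟨K, hK, h⟩ := exists_le_weight n m N
  have hs := (summable_inv_pow (n := n) (k := m - order b) (by omega)).mul_left
    ((2 * Real.pi) ^ (2 * order b) * K)
  refine Summable.of_nonneg_of_le (fun a => div_nonneg (by positivity) (weight_pos m N a).le)
    (fun a => ?_) hs
  rw [div_le_iff₀ (weight_pos m N a)]
  refine (norm_symbol_sq_le b a).trans ?_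
  have hpos : 0 < 1 + ∑ i, (a i : ℝ) ^ 2 := by positivity
  have e : (1 + ∑ i, (a i : ℝ) ^ 2) ^ order b
      = ((1 + ∑ i, (a i : ℝ) ^ 2) ^ (m - order b))⁻¹ * (1 + ∑ i, (a i : ℝ) ^ 2) ^ m := by
    rw [eq_inv_mul_iff_mul_eq₀ (by positivity), ← pow_add]
    congr 1; omega
  rw [e, mul_assoc, mul_assoc]
  refine mul_le_mul_of_nonneg_left ?_ (by positivity)
  calc _ ≤ ((1 + ∑ i, (a i : ℝ) ^ 2) ^ (m - order b))⁻¹ * (K * weight m N a) :=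
        mul_le_mul_of_nonneg_left (h a) (by positivity)
    _ = _ := by ring

lemma summable_inv_weight (N : SobolevNorm) (hm : n < 2 * m) :
    Summable fun a : Fin n → ℤ => 1 / weight m N a := by
  simpa [symbol_zero] using summable_symbol_div_weight N (b := (0 : Fin n → ℕ)) (m := m)
    (by simpa [order] using hm)

/-! ### The unit ball and the ellipsoid -/

lemma InEllipsoid.sum_finset_le {c : (Fin n → ℤ) → ℂ} (hc : InEllipsoid m N c)
    (s : Finset (Fin n → ℤ)) : ∑ a ∈ s, weight m N a * ‖c a‖ ^ 2 ≤ 1 := by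
  obtain ⟨ρ, hρ⟩ := exists_subset_freqBox s
  exact (Finset.sum_le_sum_of_subset_of_nonneg hρ fun a _ _ =>
    mul_nonneg (weight_pos m N a).le (by positivity)).trans (hc.sum_le ρ)

lemma InEllipsoid.summable {c : (Fin n → ℤ) → ℂ} (hc : InEllipsoid m N c) :
    Summable fun a => weight m N a * ‖c a‖ ^ 2 :=
  summable_of_sum_le (fun a => mul_nonneg (weight_pos m N a).le (by positivity)) hc.sum_finset_le

lemma InEllipsoid.norm_sq_le {c : (Fin n → ℤ) → ℂ} (hc : InEllipsoid m N c) (a : Fin n → ℤ) :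
    ‖c a‖ ^ 2 ≤ 1 / weight m N a := by
  have := hc.sum_finset_le {a}
  rw [Finset.sum_singleton] at this
  rw [le_div_iff₀ (weight_pos m N a)]
  linarith

lemma InEllipsoid.summable_symbol_sq {c : (Fin n → ℤ) → ℂ} (hc : InEllipsoid m N c)
    {b : Fin n → ℕ} (hb : order b ≤ m) : Summable fun a => ‖symbol b a * c a‖ ^ 2 := by
  obtain ⟨K, hK, h⟩ := exists_norm_symbol_sq_le_weight N hb
  refine Summable.of_nonneg_of_le (fun a => by positivity) (fun a => ?_) (hc.summable.mul_left K)
  rw [norm_mul, mul_pow, ← mul_assoc]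
  exact mul_le_mul_of_nonneg_right (h a) (by positivity)

/-- The Cauchy-Schwarz bound for the Fourier series of derivatives. -/
lemma InEllipsoid.sum_norm_symbol_le {c : (Fin n → ℤ) → ℂ} (hc : InEllipsoid m N c)
    {b : Fin n → ℕ} (hb : 2 * order b + n < 2 * m) (s : Finset (Fin n → ℤ)) :
    ∑ a ∈ s, ‖symbol b a‖ * ‖c a‖ ≤ √(∑' a : Fin n → ℤ, ‖symbol b a‖ ^ 2 / weight m N a) := by
  refine Real.le_sqrt_of_sq_le ?_
  have h1 := Finset.sum_mul_sq_le_sq_mul_sq s (fun a => ‖symbol b a‖ / √(weight m N a))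
    (fun a => √(weight m N a) * ‖c a‖)
  have e1 : ∀ a : Fin n → ℤ, ‖symbol b a‖ / √(weight m N a) * (√(weight m N a) * ‖c a‖)
      = ‖symbol b a‖ * ‖c a‖ := fun a => by
    have := Real.sqrt_pos.2 (weight_pos m N a)
    field_simp
  simp only [e1, div_pow, mul_pow, Real.sq_sqrt (weight_pos m N _).le] at h1
  refine h1.trans ?_
  calc _ ≤ (∑ a ∈ s, ‖symbol b a‖ ^ 2 / weight m N a) * 1 :=
        mul_le_mul_of_nonneg_left (hc.sum_finset_le s)
          (Finset.sum_nonneg fun a _ => div_nonneg (by positivity) (weight_pos m N a).le)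
    _ ≤ _ := by
        rw [mul_one]
        exact (summable_symbol_div_weight N hb).sum_le_tsum s
          fun a _ => div_nonneg (by positivity) (weight_pos m N a).le

lemma InEllipsoid.summable_symbol {c : (Fin n → ℤ) → ℂ} (hc : InEllipsoid m N c)
    {b : Fin n → ℕ} (hb : 2 * order b + n < 2 * m) : Summable fun a => ‖symbol b a‖ * ‖c a‖ :=
  summable_of_sum_le (fun a => by positivity) (hc.sum_norm_symbol_le hb)

lemma hasSum_normSq_derivative {f : L2 n} (hf : MemSobolev m f) :
    HasSum (fun a => weight m .derivative a * ‖fourierCoeff f a‖ ^ 2)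
      (normSq m .derivative f) := by
  have h := hasSum_sum (s := multiIndices n m) fun b _ => hasSum_sq_fourierCoeff (weakDeriv b f)
  refine h.congr_fun fun a => ?_
  simp only [weight]
  rw [Finset.sum_mul]
  refine Finset.sum_congr rfl fun b hb => ?_
  rw [fourierCoeff_weakDeriv (hf b (mem_multiIndices.1 hb)), norm_mul, mul_pow, norm_symbol_sq]

lemma hasSum_normSq {f : L2 n} (hf : MemSobolev m f) (N : SobolevNorm) :
    HasSum (fun a => weight m N a * ‖fourierCoeff f a‖ ^ 2) (normSq m N f) := by
  have h := hasSum_normSq_derivative hf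
  cases N with
  | derivative => exact h
  | fourier =>
    -- The Fourier norm is defined as a `tsum`, so only summability is at stake; it is inherited
    -- from the derivative norm by comparing weights.
    refine Summable.hasSum ?_
    obtain ⟨K, hK, hle⟩ := exists_le_weight n m .derivative
    refine Summable.of_nonneg_of_le (fun a => mul_nonneg (weight_pos m _ a).le (by positivity))
      (fun a => ?_) (h.summable.mul_left K)
    rw [← mul_assoc]
    exact mul_le_mul_of_nonneg_right (hle a) (by positivity)

lemma inEllipsoid_of_mem_ball {f : L2 n} (hf : f ∈ ball n m N) :
    InEllipsoid m N (fourierCoeff f) := by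
  refine ⟨fourierCoeff_neg_of_real hf.1, fun ρ => ?_⟩
  exact (sum_le_hasSum _ (fun a _ => mul_nonneg (weight_pos m _ a).le (by positivity))
    (hasSum_normSq hf.2.1 N)).trans hf.2.2

/-- Riesz-Fischer yields both `f` and its weak derivatives, the latter from the sequences `symbol b
a * c a`, which are square summable. -/
lemma InEllipsoid.exists_ball {c : (Fin n → ℤ) → ℂ} (hc : InEllipsoid m N c) :
    ∃ f ∈ ball n m N, fourierCoeff f = c := by
  have h0 : Summable fun a => ‖c a‖ ^ 2 := by
    simpa [symbol_zero] using hc.summable_symbol_sq (b := 0) (by simp [order])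
  obtain ⟨f, hf⟩ := exists_fourierCoeff h0
  have hf' : fourierCoeff f = c := funext hf
  have hS : MemSobolev m f := fun b hb => by
    obtain ⟨g, hg⟩ := exists_fourierCoeff (hc.summable_symbol_sq hb)
    exact ⟨g, hasWeakDeriv_of_fourierCoeff fun a => by rw [hg, hf]⟩
  refine ⟨f, ⟨real_of_fourierCoeff_neg fun a => by rw [hf, hf, hc.herm], hS, ?_⟩, hf'⟩
  refine hasSum_le_of_sum_le (hasSum_normSq hS N) fun s => ?_
  rw [hf']
  exact hc.sum_finset_le s

lemma mem_ellipsoid_iff {c : EllTwo n} : c ∈ ellipsoid n m N ↔ InEllipsoid m N (c ·) := by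
  constructor
  · rintro ⟨f, hf, hcf⟩
    rw [show (c · : (Fin n → ℤ) → ℂ) = fourierCoeff f from funext hcf]
    exact inEllipsoid_of_mem_ball hf
  · intro hc
    obtain ⟨f, hf, hfc⟩ := hc.exists_ball
    exact ⟨f, hf, fun a => (congrFun hfc a).symm⟩

lemma InEllipsoid.truncate {c : (Fin n → ℤ) → ℂ} (hc : InEllipsoid m N c) (ρ : ℕ) :
    InEllipsoid m N fun a => if a ∈ freqBox n ρ then c a else 0 := by
  refine ⟨fun a => ?_, fun ρ' => ?_⟩
  · by_cases ha : a ∈ freqBox n ρ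
    · simp only [if_pos ha, if_pos (neg_mem_freqBox ha), hc.herm]
    · have : -a ∉ freqBox n ρ := fun h => ha (by simpa using neg_mem_freqBox h)
      simp only [if_neg ha, if_neg this, map_zero]
  · refine le_trans (Finset.sum_le_sum fun a _ => ?_) (hc.sum_le ρ')
    refine mul_le_mul_of_nonneg_left ?_ (weight_pos m N a).le
    split_ifs
    · exact le_rfl
    · simp

/-! ### Compactness -/

/-- Tychonoff: a set closed for coordinatewise convergence inside a product of discs of radius
`w_a^(-1/2)`. -/
lemma isCompact_setOf_inEllipsoid (n m : ℕ) (N : SobolevNorm) :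
    IsCompact {c : (Fin n → ℤ) → ℂ | InEllipsoid m N c} := by
  refine IsCompact.of_isClosed_subset (isCompact_univ_pi fun a : Fin n → ℤ =>
    isCompact_closedBall (0 : ℂ) (√(1 / weight m N a))) ?_ fun c hc a _ => ?_
  · have : {c : (Fin n → ℤ) → ℂ | InEllipsoid m N c}
        = (⋂ a, {c | c (-a) = starRingEnd ℂ (c a)})
          ∩ ⋂ ρ, {c | ∑ a ∈ freqBox n ρ, weight m N a * ‖c a‖ ^ 2 ≤ 1} := by
      ext c
      simp only [Set.mem_inter_iff, Set.mem_iInter, Set.mem_ofPred_eq]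
      exact ⟨fun h => ⟨h.1, h.2⟩, fun h => ⟨h.1, h.2⟩⟩
    rw [this]
    refine (isClosed_iInter fun a => isClosed_eq (continuous_apply _)
      (Complex.continuous_conj.comp (continuous_apply _))).inter
      (isClosed_iInter fun ρ => isClosed_le ?_ continuous_const)
    fun_prop
  · rw [mem_closedBall_zero_iff]
    exact Real.le_sqrt_of_sq_le (InEllipsoid.norm_sq_le hc a)

/-- On the ellipsoid coordinatewise convergence implies `ℓ₂` convergence, because `|c_a - c'_a|² ≤ 4
/ w_a` is a summable majorant. Thus coordinatewise compactness carries over to the norm topology. -/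
theorem isCompact_ellipsoid (N : SobolevNorm) (hm : n < 2 * m) :
    IsCompact (ellipsoid n m N) := by
  have hmem : ∀ c : {c : (Fin n → ℤ) → ℂ | InEllipsoid m N c}, Memℓp c.1 2 := fun c => by
    rw [memℓp_gen_iff (by norm_num)]
    have := c.2.summable_symbol_sq (b := 0) (by simp [order])
    simpa [symbol_zero] using this
  set T : {c : (Fin n → ℤ) → ℂ | InEllipsoid m N c} → EllTwo n := fun c => ⟨c.1, hmem c⟩
  have hT : Continuous T := by
    rw [continuous_iff_continuousAt]
    intro c₀
    rw [ContinuousAt, tendsto_iff_norm_sub_tendsto_zero]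
    have h1 : Continuous fun c : {c : (Fin n → ℤ) → ℂ | InEllipsoid m N c} =>
        ∑' a, ‖c.1 a - c₀.1 a‖ ^ 2 := by
      refine continuous_tsum (fun a =>
        ((((continuous_apply a).comp continuous_subtype_val).sub continuous_const).norm.pow 2))
        ((summable_inv_weight N hm).mul_left 4)
        fun a c => ?_
      rw [norm_pow, norm_norm]
      have h3 := c.2.norm_sq_le a
      have h4 := c₀.2.norm_sq_le a
      have h5 := norm_sub_le (c.1 a) (c₀.1 a)
      nlinarith [sq_nonneg (‖c.1 a‖ - ‖c₀.1 a‖), norm_nonneg (c.1 a - c₀.1 a),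
        norm_nonneg (c.1 a), norm_nonneg (c₀.1 a)]
    have h2 := (h1.sqrt).tendsto c₀
    simp only [sub_self, norm_zero, ne_eq, OfNat.ofNat_ne_zero, not_false_eq_true, zero_pow,
      tsum_zero, Real.sqrt_zero] at h2
    refine h2.congr fun c => ?_
    have h3 := lp.norm_rpow_eq_tsum (p := 2) (by norm_num) (T c - T c₀)
    simp only [ENNReal.toReal_ofNat, Real.rpow_ofNat] at h3
    change √(∑' a, ‖(T c - T c₀) a‖ ^ 2) = _
    rw [← h3, Real.sqrt_sq (norm_nonneg _)]
  have : CompactSpace {c : (Fin n → ℤ) → ℂ | InEllipsoid m N c} :=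
    isCompact_iff_compactSpace.1 (isCompact_setOf_inEllipsoid n m N)
  convert isCompact_range hT
  ext c
  rw [mem_ellipsoid_iff]
  exact ⟨fun h => ⟨⟨c, h⟩, rfl⟩, by rintro ⟨c', rfl⟩; exact c'.2⟩

lemma continuous_eval_ellTwo (p : FPoly n) :
    Continuous fun c : EllTwo n => MvPolynomial.eval (c ·) p :=
  (MvPolynomial.continuous_eval p).comp
    (lp.uniformContinuous_coe (E := fun _ : Fin n → ℤ => ℂ) (p := 2)).continuous

end SobolevPOP

end

/-! ### Expansion of polynomials in infinite linear forms. -/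

noncomputable section

namespace SobolevPOP

open MvPolynomial

variable {n : ℕ}

/-! ### Polynomials in linear forms -/

section FormPoly

variable {R σ : Type*} [CommSemiring R]

/-- The polynomial `∑_{α ∈ A} w_α ∏_j (∑_{max_i |k_i| ≤ ρ} t_{j,k} c_k)^{α_j}`. -/
def formPoly (A : Finset (σ →₀ ℕ)) (w : (σ →₀ ℕ) → R) (t : σ → (Fin n → ℤ) → R) (ρ : ℕ) :
    MvPolynomial (Fin n → ℤ) R :=
  ∑ α ∈ A, C (w α) * α.prod fun j e => (∑ k ∈ freqBox n ρ, C (t j k) * X k) ^ e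

/-- The stable value of the coefficients of `formPoly`. -/
def formCoeff (A : Finset (σ →₀ ℕ)) (w : (σ →₀ ℕ) → R) (t : σ → (Fin n → ℤ) → R)
    (β : MIndex n) : R := (formPoly A w t (harmDeg β)).coeff β

/-- Equality of the coefficients of all monomials in the variables from `B`. -/
def EqOn (B : Finset (Fin n → ℤ)) (u v : MvPolynomial (Fin n → ℤ) R) : Prop :=
  ∀ β : MIndex n, β.support ⊆ B → u.coeff β = v.coeff β

lemma EqOn.refl {B : Finset (Fin n → ℤ)} (u : MvPolynomial (Fin n → ℤ) R) : EqOn B u u :=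
  fun _ _ => rfl

lemma EqOn.mul {B : Finset (Fin n → ℤ)} {u v u' v' : MvPolynomial (Fin n → ℤ) R}
    (h : EqOn B u v) (h' : EqOn B u' v') : EqOn B (u * u') (v * v') := by
  classical
  intro β hβ
  rw [coeff_mul, coeff_mul]
  refine Finset.sum_congr rfl fun γ hγ => ?_
  have hγ' := Finset.HasAntidiagonal.mem_antidiagonal.1 hγ
  rw [h _ ((Finsupp.support_mono (hγ' ▸ self_le_add_right _ _)).trans hβ),
    h' _ ((Finsupp.support_mono (hγ' ▸ self_le_add_left _ _)).trans hβ)]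

lemma EqOn.pow {B : Finset (Fin n → ℤ)} {u v : MvPolynomial (Fin n → ℤ) R}
    (h : EqOn B u v) (e : ℕ) : EqOn B (u ^ e) (v ^ e) := by
  induction e with
  | zero => rw [pow_zero, pow_zero]; exact EqOn.refl _
  | succ e ih => rw [pow_succ, pow_succ]; exact ih.mul h

lemma EqOn.sum {ι : Type*} {B : Finset (Fin n → ℤ)} {u v : ι → MvPolynomial (Fin n → ℤ) R}
    {s : Finset ι} (h : ∀ i ∈ s, EqOn B (u i) (v i)) :
    EqOn B (∑ i ∈ s, u i) (∑ i ∈ s, v i) := fun β hβ => by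
  rw [coeff_sum, coeff_sum]
  exact Finset.sum_congr rfl fun i hi => h i hi β hβ

lemma EqOn.prod {ι : Type*} {B : Finset (Fin n → ℤ)} {u v : ι → MvPolynomial (Fin n → ℤ) R}
    {s : Finset ι} (h : ∀ i ∈ s, EqOn B (u i) (v i)) :
    EqOn B (∏ i ∈ s, u i) (∏ i ∈ s, v i) := by
  classical
  induction s using Finset.induction_on with
  | empty => exact EqOn.refl _
  | insert i s hi ih =>
    rw [Finset.prod_insert hi, Finset.prod_insert hi]
    exact (h i (Finset.mem_insert_self _ _)).mul
      (ih fun j hj => h j (Finset.mem_insert_of_mem hj))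

/-- Variables outside the support of `β` cannot contribute to `c^β`. `EqOn` expresses congruence
modulo the other variables, which is compatible with sums and products, so enlarging the box changes
nothing. -/
lemma coeff_formPoly (A : Finset (σ →₀ ℕ)) (w : (σ →₀ ℕ) → R) (t : σ → (Fin n → ℤ) → R)
    {ρ : ℕ} {β : MIndex n} (h : harmDeg β ≤ ρ) :
    (formPoly A w t ρ).coeff β = formCoeff A w t β := by
  classical
  have key : EqOn (freqBox n (harmDeg β)) (formPoly A w t ρ) (formPoly A w t (harmDeg β)) := by
    refine EqOn.sum fun α _ => (EqOn.refl _).mul (EqOn.prod fun j _ => EqOn.pow ?_ _)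
    intro γ hγ
    rw [coeff_sum, coeff_sum, ← Finset.sum_sdiff (freqBox_mono h)]
    refine (congrArg (· + _) (Finset.sum_eq_zero fun k hk => ?_)).trans (zero_add _)
    rw [coeff_C_mul, coeff_X]
    rw [if_neg, mul_zero]
    rintro rfl
    exact (Finset.mem_sdiff.1 hk).2 (hγ (by simp))
  exact key β (harmDeg_le_iff.1 le_rfl)

lemma coeff_formPoly_eq_zero (A : Finset (σ →₀ ℕ)) (w : (σ →₀ ℕ) → R)
    (t : σ → (Fin n → ℤ) → R) {ρ : ℕ} {β : MIndex n} (h : ¬ harmDeg β ≤ ρ) :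
    (formPoly A w t ρ).coeff β = 0 := by
  classical
  have hX : ∀ k ∈ freqBox n ρ, (X k : MvPolynomial (Fin n → ℤ) R) ∈
      MvPolynomial.supported R (freqBox n ρ : Set (Fin n → ℤ)) := fun k hk => by
    rw [MvPolynomial.supported_eq_adjoin_X]
    exact Algebra.subset_adjoin ⟨k, hk, rfl⟩
  have hC : ∀ r : R, (C r : MvPolynomial (Fin n → ℤ) R) ∈
      MvPolynomial.supported R (freqBox n ρ : Set (Fin n → ℤ)) := fun r =>
    Subalgebra.algebraMap_mem _ r
  have hmem : formPoly A w t ρ ∈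
      MvPolynomial.supported R (freqBox n ρ : Set (Fin n → ℤ)) :=
    Subalgebra.sum_mem _ fun α _ => Subalgebra.mul_mem _ (hC _) (Subalgebra.prod_mem _ fun j _ =>
      Subalgebra.pow_mem _ (Subalgebra.sum_mem _ fun k hk =>
        Subalgebra.mul_mem _ (hC _) (hX k hk)) _)
  rw [MvPolynomial.mem_supported] at hmem
  by_contra h0
  refine h (harmDeg_le_iff.2 fun a ha => ?_)
  exact_mod_cast hmem ((mem_vars_iff_mem_support a).2 ⟨β, mem_support_iff.2 h0, ha⟩)

lemma eval_formPoly (A : Finset (σ →₀ ℕ)) (w : (σ →₀ ℕ) → R) (t : σ → (Fin n → ℤ) → R)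
    (ρ : ℕ) (c : (Fin n → ℤ) → R) :
    eval c (formPoly A w t ρ)
      = ∑ α ∈ A, w α * α.prod fun j e => (∑ k ∈ freqBox n ρ, t j k * c k) ^ e := by
  simp [formPoly, Finsupp.prod]

lemma totalDegree_formPoly_le {A : Finset (σ →₀ ℕ)} (w : (σ →₀ ℕ) → R)
    (t : σ → (Fin n → ℤ) → R) (ρ : ℕ) {d : ℕ} (hd : ∀ α ∈ A, α.degree ≤ d) :
    (formPoly A w t ρ).totalDegree ≤ d := by
  refine totalDegree_finsetSum_le fun α hα => ?_
  refine (totalDegree_mul _ _).trans ?_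
  rw [totalDegree_C, zero_add]
  refine (totalDegree_finsetProd _ _).trans (le_trans ?_ (hd α hα))
  rw [Finsupp.degree]
  refine Finset.sum_le_sum fun j _ => (totalDegree_pow _ _).trans ?_
  refine mul_le_of_le_one_right (Nat.zero_le _) (totalDegree_finsetSum_le fun k _ => ?_)
  refine (totalDegree_mul _ _).trans ?_
  rw [totalDegree_C, zero_add]
  exact (totalDegree_monomial_le _ _).trans (by simp)

lemma formCoeff_eq_zero {A : Finset (σ →₀ ℕ)} (w : (σ →₀ ℕ) → R)
    (t : σ → (Fin n → ℤ) → R) {d : ℕ} (hd : ∀ α ∈ A, α.degree ≤ d) {β : MIndex n}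
    (hβ : d < algDeg β) : formCoeff A w t β = 0 :=
  coeff_eq_zero_of_totalDegree_lt ((totalDegree_formPoly_le w t _ hd).trans_lt hβ)

end FormPoly

/-- The coefficients of `u` are bounded by those of `v`. -/
def Majorized (u : FPoly n) (v : MvPolynomial (Fin n → ℤ) ℝ) : Prop :=
  ∀ β, ‖u.coeff β‖ ≤ v.coeff β

lemma Majorized.mul {u u' : FPoly n} {v v' : MvPolynomial (Fin n → ℤ) ℝ}
    (h : Majorized u v) (h' : Majorized u' v') : Majorized (u * u') (v * v') := fun β => by
  classical
  rw [coeff_mul, coeff_mul]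
  refine (norm_sum_le _ _).trans (Finset.sum_le_sum fun γ _ => ?_)
  rw [norm_mul]
  exact mul_le_mul (h _) (h' _) (norm_nonneg _) ((norm_nonneg _).trans (h _))

lemma Majorized.C {z : ℂ} {x : ℝ} (h : ‖z‖ ≤ x) :
    Majorized (n := n) (MvPolynomial.C z) (MvPolynomial.C x) := fun β => by
  classical
  rw [coeff_C, coeff_C]
  split_ifs
  · exact h
  · simp

lemma Majorized.X (a : Fin n → ℤ) : Majorized (MvPolynomial.X a) (MvPolynomial.X a) := fun β => by
  classical
  rw [coeff_X, coeff_X]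
  split_ifs <;> simp

lemma Majorized.pow {u : FPoly n} {v : MvPolynomial (Fin n → ℤ) ℝ} (h : Majorized u v) (e : ℕ) :
    Majorized (u ^ e) (v ^ e) := by
  induction e with
  | zero =>
    rw [pow_zero, pow_zero, ← map_one MvPolynomial.C, ← map_one MvPolynomial.C]
    exact Majorized.C (by simp)
  | succ e ih => rw [pow_succ, pow_succ]; exact ih.mul h

lemma Majorized.sum {ι : Type*} {s : Finset ι} {u : ι → FPoly n}
    {v : ι → MvPolynomial (Fin n → ℤ) ℝ} (h : ∀ i ∈ s, Majorized (u i) (v i)) :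
    Majorized (∑ i ∈ s, u i) (∑ i ∈ s, v i) := fun β => by
  rw [coeff_sum, coeff_sum]
  exact (norm_sum_le _ _).trans (Finset.sum_le_sum fun i hi => h i hi β)

lemma Majorized.prod {ι : Type*} {s : Finset ι} {u : ι → FPoly n}
    {v : ι → MvPolynomial (Fin n → ℤ) ℝ} (h : ∀ i ∈ s, Majorized (u i) (v i)) :
    Majorized (∏ i ∈ s, u i) (∏ i ∈ s, v i) := by
  classical
  induction s using Finset.induction_on with
  | empty => simpa using (Majorized.C (n := n) (z := 1) (x := 1) (by simp))
  | insert i s hi ih =>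
    rw [Finset.prod_insert hi, Finset.prod_insert hi]
    exact (h i (Finset.mem_insert_self _ _)).mul
      (ih fun j hj => h j (Finset.mem_insert_of_mem hj))

/-- The triangle inequality is carried through each sum and product, giving a majorant with
nonnegative coefficients that can be independent of the point of the torus. -/
lemma norm_formCoeff_le {σ : Type*} {A : Finset (σ →₀ ℕ)} {w : (σ →₀ ℕ) → ℂ}
    {t : σ → (Fin n → ℤ) → ℂ} {w' : (σ →₀ ℕ) → ℝ} {t' : σ → (Fin n → ℤ) → ℝ}
    (hw : ∀ α, ‖w α‖ ≤ w' α) (ht : ∀ j k, ‖t j k‖ ≤ t' j k) (β : MIndex n) :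
    ‖formCoeff A w t β‖ ≤ formCoeff A w' t' β := by
  have : Majorized (formPoly A w t (harmDeg β)) (formPoly A w' t' (harmDeg β)) :=
    Majorized.sum fun α _ => (Majorized.C (hw α)).mul (Majorized.prod fun j _ =>
      Majorized.pow (Majorized.sum fun k _ => (Majorized.C (ht j k)).mul (Majorized.X k)) _)
  exact this β

lemma formCoeff_nonneg {σ : Type*} {A : Finset (σ →₀ ℕ)} {w' : (σ →₀ ℕ) → ℝ}
    {t' : σ → (Fin n → ℤ) → ℝ} (hw : ∀ α, 0 ≤ w' α) (ht : ∀ j k, 0 ≤ t' j k) (β : MIndex n) :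
    0 ≤ formCoeff A w' t' β :=
  (norm_nonneg _).trans (norm_formCoeff_le (A := A) (w := fun _ => 0) (t := fun _ _ => 0)
    (by simpa using hw) (by simpa using ht) β)

lemma norm_monomialAt (c : (Fin n → ℤ) → ℂ) (β : MIndex n) :
    ‖monomialAt c β‖ = β.prod fun a k => ‖c a‖ ^ k := by
  simp [monomialAt, Finsupp.prod, norm_prod]

lemma exists_harmDeg_le (S : Finset (MIndex n)) : ∃ ρ, ∀ β ∈ S, harmDeg β ≤ ρ :=
  ⟨S.sup harmDeg, fun _ hβ => Finset.le_sup hβ⟩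

/-- Up to nonnegative terms, the partial sum belongs to the evaluation of the majorant polynomial at
`|c|`; there each linear form is at most `B j`. -/
lemma sum_formCoeff_mul_le {σ : Type*} {A : Finset (σ →₀ ℕ)} {w' : (σ →₀ ℕ) → ℝ}
    {t' : σ → (Fin n → ℤ) → ℝ} (hw : ∀ α, 0 ≤ w' α) (ht : ∀ j k, 0 ≤ t' j k)
    {c : (Fin n → ℤ) → ℂ} {B : σ → ℝ} (hB : ∀ j ρ, ∑ k ∈ freqBox n ρ, t' j k * ‖c k‖ ≤ B j)
    (S : Finset (MIndex n)) :
    ∑ β ∈ S, formCoeff A w' t' β * ‖monomialAt c β‖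
      ≤ ∑ α ∈ A, w' α * α.prod fun j e => B j ^ e := by
  classical
  obtain ⟨ρ, hρ⟩ := exists_harmDeg_le S
  have h1 : ∑ β ∈ S, formCoeff A w' t' β * ‖monomialAt c β‖
      ≤ eval (fun k => ‖c k‖) (formPoly A w' t' ρ) := by
    rw [eval_eq]
    have h2 : ∀ β ∈ S, formCoeff A w' t' β * ‖monomialAt c β‖
        = (formPoly A w' t' ρ).coeff β * ∏ i ∈ β.support, ‖c i‖ ^ β i := fun β hβ => by
      rw [coeff_formPoly A w' t' (hρ β hβ), norm_monomialAt]; rfl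
    rw [Finset.sum_congr rfl h2]
    calc _ ≤ ∑ β ∈ S ∪ (formPoly A w' t' ρ).support,
          (formPoly A w' t' ρ).coeff β * ∏ i ∈ β.support, ‖c i‖ ^ β i := by
            refine Finset.sum_le_sum_of_subset_of_nonneg Finset.subset_union_left fun β _ _ =>
              mul_nonneg ?_ (by positivity)
            by_cases h : harmDeg β ≤ ρ
            · rw [coeff_formPoly A w' t' h]; exact formCoeff_nonneg hw ht β
            · rw [coeff_formPoly_eq_zero A w' t' h]
      _ = _ := (Finset.sum_subset Finset.subset_union_right fun β _ hβ => by
            rw [notMem_support_iff.1 hβ, zero_mul]).symm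
  refine h1.trans ?_
  rw [eval_formPoly]
  refine Finset.sum_le_sum fun α _ => mul_le_mul_of_nonneg_left ?_ (hw α)
  refine Finset.prod_le_prod (fun j _ => pow_nonneg ?_ _) fun j _ => pow_le_pow_left₀ ?_ (hB j ρ) _
  all_goals exact Finset.sum_nonneg fun k _ => mul_nonneg (ht j k) (norm_nonneg _)

/-- The expansion of a polynomial in absolutely convergent series. -/
lemma hasSum_formCoeff {σ : Type*} {A : Finset (σ →₀ ℕ)} {w : (σ →₀ ℕ) → ℂ}
    {t : σ → (Fin n → ℤ) → ℂ} {w' : (σ →₀ ℕ) → ℝ} {t' : σ → (Fin n → ℤ) → ℝ}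
    (hw : ∀ α, ‖w α‖ ≤ w' α) (ht : ∀ j k, ‖t j k‖ ≤ t' j k) {c : (Fin n → ℤ) → ℂ} {B : σ → ℝ}
    (hB : ∀ j ρ, ∑ k ∈ freqBox n ρ, t' j k * ‖c k‖ ≤ B j)
    {z : σ → ℂ} (hz : ∀ j, HasSum (fun k => t j k * c k) (z j)) :
    HasSum (fun β => formCoeff A w t β * monomialAt c β)
      (∑ α ∈ A, w α * α.prod fun j e => z j ^ e) := by
  classical
  have hw0 : ∀ α, 0 ≤ w' α := fun α => (norm_nonneg _).trans (hw α)
  have ht0 : ∀ j k, 0 ≤ t' j k := fun j k => (norm_nonneg _).trans (ht j k)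
  have hs : Summable fun β => formCoeff A w' t' β * ‖monomialAt c β‖ :=
    summable_of_sum_le (fun β => mul_nonneg (formCoeff_nonneg hw0 ht0 β) (norm_nonneg _))
      (sum_formCoeff_mul_le hw0 ht0 hB)
  have hle : ∀ β, ‖formCoeff A w t β * monomialAt c β‖
      ≤ formCoeff A w' t' β * ‖monomialAt c β‖ := fun β => by
    rw [norm_mul]
    exact mul_le_mul_of_nonneg_right (norm_formCoeff_le hw ht β) (norm_nonneg _)
  have hsum : Summable fun β => formCoeff A w t β * monomialAt c β :=
    Summable.of_norm_bounded hs hle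
  -- Each truncated polynomial has a finite expansion; dominated convergence over monomials
  -- identifies the limit as `ρ → ∞`.
  have hlim := tendsto_tsum_of_dominated_convergence (𝓕 := atTop)
    (f := fun (ρ : ℕ) β => (formPoly A w t ρ).coeff β * monomialAt c β)
    (g := fun β => formCoeff A w t β * monomialAt c β) hs
    (fun β => tendsto_const_nhds.congr' (by
      filter_upwards [eventually_ge_atTop (harmDeg β)] with ρ hρ
      rw [coeff_formPoly A w t hρ]))
    (Eventually.of_forall fun ρ β => by
      by_cases h : harmDeg β ≤ ρ
      · rw [coeff_formPoly A w t h]; exact hle β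
      · rw [coeff_formPoly_eq_zero A w t h, zero_mul, norm_zero]
        exact mul_nonneg (formCoeff_nonneg hw0 ht0 β) (norm_nonneg _))
  have heval : ∀ ρ, ∑' β, (formPoly A w t ρ).coeff β * monomialAt c β
      = ∑ α ∈ A, w α * α.prod fun j e => (∑ k ∈ freqBox n ρ, t j k * c k) ^ e := fun ρ => by
    rw [← eval_formPoly, eval_eq, tsum_eq_sum (s := (formPoly A w t ρ).support)
      (fun β hβ => by rw [notMem_support_iff.1 hβ, zero_mul])]
    rfl
  simp_rw [heval] at hlim
  have hlim2 : Tendsto (fun ρ => ∑ α ∈ A, w α * α.prod fun j e =>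
      (∑ k ∈ freqBox n ρ, t j k * c k) ^ e) atTop (𝓝 (∑ α ∈ A, w α * α.prod fun j e => z j ^ e)) :=
    tendsto_finsetSum _ fun α _ => Tendsto.const_mul _ (tendsto_finsetProd _ fun j _ =>
      Tendsto.pow ((hz j).comp tendsto_freqBox) _)
  rw [← tendsto_nhds_unique hlim hlim2]
  exact hsum.hasSum

end SobolevPOP

end

/-! ### The functional `L` and the series expansion of the objective. -/

noncomputable section

namespace SobolevPOP

open MvPolynomial

variable {n : ℕ}

/-! ### The functional on bounded functions -/

/-- Bounded measurable functions. -/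
def BddMeas {E : Type*} [NormedAddCommGroup E] [MeasurableSpace E] (g : Torus n → E) : Prop :=
  Measurable g ∧ ∃ M : ℝ, ∀ x, ‖g x‖ ≤ M

lemma BddMeas.memLp {g : Torus n → ℝ} (h : BddMeas g) : MemLp g ∞ (torusMeasure n) := by
  obtain ⟨hm, M, hM⟩ := h
  exact memLp_top_of_bound hm.aestronglyMeasurable M (Eventually.of_forall hM)

lemma norm_toLp_le {g : Torus n → ℝ} (h : MemLp g ∞ (torusMeasure n)) {M : ℝ} (hM0 : 0 ≤ M)
    (hM : ∀ᵐ x ∂(torusMeasure n), ‖g x‖ ≤ M) : ‖h.toLp g‖ ≤ M := by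
  have := Lp.norm_le_of_ae_bound (f := h.toLp g) hM0 (by
    filter_upwards [hM, h.coeFn_toLp] with x hx hx'
    rwa [hx'])
  simpa using this

variable (L : LInf n →L[ℝ] ℝ)

lemma applyL_eq {g : Torus n → ℝ} (h : MemLp g ∞ (torusMeasure n)) :
    applyL L g = L (h.toLp g) := dif_pos h

lemma applyL_add {f g : Torus n → ℝ} (hf : BddMeas f) (hg : BddMeas g) :
    applyL L (fun x => f x + g x) = applyL L f + applyL L g := by
  rw [applyL_eq L hf.memLp, applyL_eq L hg.memLp, ← map_add, ← MemLp.toLp_add]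
  exact applyL_eq L (hf.memLp.add hg.memLp)

lemma applyL_const_mul {f : Torus n → ℝ} (hf : BddMeas f) (r : ℝ) :
    applyL L (fun x => r * f x) = r * applyL L f := by
  rw [applyL_eq L hf.memLp, ← smul_eq_mul, ← map_smul, ← MemLp.toLp_const_smul]
  exact applyL_eq L (hf.memLp.const_smul r)

lemma applyL_zero : applyL L (fun _ => 0) = 0 := by
  have h := applyL_const_mul L (f := fun _ => 0) ⟨measurable_const, 0, fun _ => by simp⟩ 0
  simpa using h

lemma abs_applyL_le {g : Torus n → ℝ} (h : BddMeas g) {M : ℝ} (hM : ∀ x, ‖g x‖ ≤ M) :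
    |applyL L g| ≤ ‖L‖ * M := by
  rw [applyL_eq L h.memLp]
  have hM0 : 0 ≤ M := (norm_nonneg _).trans (hM 0)
  exact (L.le_opNorm _).trans (mul_le_mul_of_nonneg_left
    (norm_toLp_le _ hM0 (Eventually.of_forall hM)) (norm_nonneg _))

/-- Series of bounded functions whose sup norms are summable. -/
lemma hasSum_applyL {ι : Type*} [Countable ι] {u : ι → Torus n → ℝ} {g : Torus n → ℝ}
    {bd : ι → ℝ} (hu : ∀ i, BddMeas (u i)) (hbd : ∀ i x, ‖u i x‖ ≤ bd i) (hs : Summable bd)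
    (hg : AEStronglyMeasurable g (torusMeasure n))
    (hsum : ∀ᵐ x ∂(torusMeasure n), HasSum (fun i => u i x) (g x)) :
    MemLp g ∞ (torusMeasure n) ∧ HasSum (fun i => applyL L (u i)) (applyL L g) := by
  have hbd0 : ∀ i, 0 ≤ bd i := fun i => (norm_nonneg _).trans (hbd i 0)
  have hgm : MemLp g ∞ (torusMeasure n) := by
    refine memLp_top_of_bound hg (∑' i, bd i) ?_
    filter_upwards [hsum] with x hx
    rw [← hx.tsum_eq]
    exact tsum_of_norm_bounded hs.hasSum fun i => hbd i x
  refine ⟨hgm, ?_⟩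
  rw [applyL_eq L hgm]
  -- Pointwise sums do not suffice for a functional on `L^∞`: the tails of `bd` bound the remainders
  -- in the sup norm, so the series converges there and `L` can be applied termwise.
  have h1 : HasSum (fun i => (hu i).memLp.toLp (u i)) (hgm.toLp g) := by
    have h0 := tendsto_tsum_compl_atTop_zero bd
    unfold HasSum
    rw [SummationFilter.unconditional_filter, tendsto_iff_norm_sub_tendsto_zero]
    refine squeeze_zero (fun _ => norm_nonneg _) (fun s => ?_) h0
    have h2 : MemLp (fun x => (∑ i ∈ s, u i x) - g x) ∞ (torusMeasure n) :=
      (memLp_finsetSum s fun i _ => (hu i).memLp).sub hgm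
    have h3 : ∑ i ∈ s, (hu i).memLp.toLp (u i) - hgm.toLp g = h2.toLp _ := by
      apply Lp.ext
      have h5 : ∀ᵐ x ∂(torusMeasure n), ∀ i, (hu i).memLp.toLp (u i) x = u i x :=
        ae_all_iff.2 fun i => (hu i).memLp.coeFn_toLp
      filter_upwards [Lp.coeFn_sub (∑ i ∈ s, (hu i).memLp.toLp (u i)) (hgm.toLp g),
        hgm.coeFn_toLp, h2.coeFn_toLp,
        Lp.coeFn_finsetSum s (fun i => (hu i).memLp.toLp (u i)), h5] with x e1 e2 e3 e4 e5
      rw [e1, e3, Pi.sub_apply, e2, e4, Finset.sum_apply]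
      simp_rw [e5]
    rw [h3]
    refine norm_toLp_le _ (tsum_nonneg fun i => hbd0 _) ?_
    filter_upwards [hsum] with x hx
    have h6 : HasSum (fun i : {i // i ∉ s} => u i x) (g x - ∑ i ∈ s, u i x) :=
      (Finset.hasSum_compl_iff (f := fun i => u i x) s).2 (by rwa [sub_add_cancel])
    rw [norm_sub_rev, ← h6.tsum_eq]
    exact tsum_of_norm_bounded (hs.subtype _).hasSum fun i => hbd i x
  have h7 := L.hasSum h1
  refine h7.congr_fun fun i => ?_
  exact applyL_eq L (hu i).memLp

lemma BddMeas.re {g : Torus n → ℂ} (h : BddMeas g) : BddMeas fun x => (g x).re :=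
  ⟨Complex.measurable_re.comp h.1, h.2.imp fun _ hM x => (Complex.abs_re_le_norm _).trans (hM x)⟩

lemma BddMeas.im {g : Torus n → ℂ} (h : BddMeas g) : BddMeas fun x => (g x).im :=
  ⟨Complex.measurable_im.comp h.1, h.2.imp fun _ hM x => (Complex.abs_im_le_norm _).trans (hM x)⟩

lemma BddMeas.mul_const {g : Torus n → ℂ} (h : BddMeas g) (z : ℂ) :
    BddMeas fun x => g x * z := by
  obtain ⟨hm, M, hM⟩ := h
  refine ⟨hm.mul_const z, M * ‖z‖, fun x => ?_⟩
  rw [norm_mul]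
  exact mul_le_mul_of_nonneg_right (hM x) (norm_nonneg _)

lemma BddMeas.add {E : Type*} [NormedAddCommGroup E] [MeasurableSpace E] [MeasurableAdd₂ E]
    {f g : Torus n → E} (hf : BddMeas f) (hg : BddMeas g) : BddMeas fun x => f x + g x := by
  obtain ⟨hm, M, hM⟩ := hf
  obtain ⟨hm', M', hM'⟩ := hg
  exact ⟨hm.add hm', M + M', fun x => (norm_add_le _ _).trans (add_le_add (hM x) (hM' x))⟩

lemma BddMeas.const_mul {g : Torus n → ℝ} (h : BddMeas g) (r : ℝ) : BddMeas fun x => r * g x := by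
  obtain ⟨hm, M, hM⟩ := h
  refine ⟨hm.const_mul r, ‖r‖ * M, fun x => ?_⟩
  rw [norm_mul]
  exact mul_le_mul_of_nonneg_left (hM x) (norm_nonneg _)

lemma applyLC_add {f g : Torus n → ℂ} (hf : BddMeas f) (hg : BddMeas g) :
    applyLC L (fun x => f x + g x) = applyLC L f + applyLC L g := by
  unfold applyLC
  simp only [Complex.add_re, Complex.add_im]
  rw [applyL_add L hf.re hg.re, applyL_add L hf.im hg.im]
  push_cast; ring

lemma applyLC_mul_const {f : Torus n → ℂ} (hf : BddMeas f) (z : ℂ) :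
    applyLC L (fun x => f x * z) = applyLC L f * z := by
  unfold applyLC
  have e1 : ∀ x, (f x * z).re = z.re * (f x).re + -z.im * (f x).im := fun x => by
    rw [Complex.mul_re]; ring
  have e2 : ∀ x, (f x * z).im = z.im * (f x).re + z.re * (f x).im := fun x => by
    rw [Complex.mul_im]; ring
  simp_rw [e1, e2]
  rw [applyL_add L (hf.re.const_mul _) (hf.im.const_mul _),
    applyL_add L (hf.re.const_mul _) (hf.im.const_mul _), applyL_const_mul L hf.re,
    applyL_const_mul L hf.im, applyL_const_mul L hf.re, applyL_const_mul L hf.im]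
  conv_rhs => rw [← Complex.re_add_im z]
  push_cast
  linear_combination (-((applyL L fun x => (f x).im : ℝ) : ℂ) * z.im) * Complex.I_mul_I

lemma applyLC_zero : applyLC L (fun _ => 0) = 0 := by
  simp [applyLC, applyL_zero]

lemma BddMeas.sum {ι : Type*} {s : Finset ι} {f : ι → Torus n → ℂ} (h : ∀ i ∈ s, BddMeas (f i)) :
    BddMeas fun x => ∑ i ∈ s, f i x := by
  classical
  induction s using Finset.induction_on with
  | empty => exact ⟨by simp, 0, fun x => by simp⟩
  | insert i s hi ih =>
    simp_rw [Finset.sum_insert hi]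
    exact (h i (Finset.mem_insert_self _ _)).add
      (ih fun j hj => h j (Finset.mem_insert_of_mem hj))

lemma applyLC_sum {ι : Type*} {s : Finset ι} {f : ι → Torus n → ℂ} (h : ∀ i ∈ s, BddMeas (f i)) :
    applyLC L (fun x => ∑ i ∈ s, f i x) = ∑ i ∈ s, applyLC L (f i) := by
  classical
  induction s using Finset.induction_on with
  | empty => simpa using applyLC_zero L
  | insert i s hi ih =>
    simp_rw [Finset.sum_insert hi]
    rw [applyLC_add L (h i (Finset.mem_insert_self _ _))
      (BddMeas.sum fun j hj => h j (Finset.mem_insert_of_mem hj)),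
      ih fun j hj => h j (Finset.mem_insert_of_mem hj)]

lemma norm_applyLC_le {g : Torus n → ℂ} (h : BddMeas g) {M : ℝ} (hM : ∀ x, ‖g x‖ ≤ M) :
    ‖applyLC L g‖ ≤ 2 * ‖L‖ * M := by
  unfold applyLC
  refine (norm_add_le _ _).trans ?_
  rw [norm_mul, Complex.norm_I, mul_one, Complex.norm_real, Complex.norm_real]
  have h1 := abs_applyL_le L h.re fun x => (Complex.abs_re_le_norm _).trans (hM x)
  have h2 := abs_applyL_le L h.im fun x => (Complex.abs_im_le_norm _).trans (hM x)
  rw [Real.norm_eq_abs, Real.norm_eq_abs]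
  linarith

lemma applyLC_conj {g : Torus n → ℂ} (h : BddMeas g) :
    applyLC L (fun x => starRingEnd ℂ (g x)) = starRingEnd ℂ (applyLC L g) := by
  unfold applyLC
  have : (fun x => (starRingEnd ℂ (g x)).im) = fun x => -1 * (g x).im := by
    ext x; simp
  rw [this, applyL_const_mul L h.im]
  simp

/-! ### The coefficients of the objective -/

variable {l : ℕ} (a : Fin l → Fin n → ℕ) (p : CoeffPoly n l)

lemma substPoly_eq (ρ : ℕ) (x : Torus n) :
    substPoly a p ρ x = formPoly p.support (fun α => ((p.coeff α x : ℝ) : ℂ))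
      (fun j k => symbol (argIndex a j) k * UnitAddTorus.mFourier k x) ρ := by
  rw [substPoly, eval₂_eq]
  rfl

lemma objCoeff_eq (β : MIndex n) : objCoeff L a p β = applyLC L fun x =>
    formCoeff p.support (fun α => ((p.coeff α x : ℝ) : ℂ))
      (fun j k => symbol (argIndex a j) k * UnitAddTorus.mFourier k x) β := by
  unfold objCoeff
  simp_rw [substPoly_eq]
  rfl

variable {p}

lemma BoundedCoeffs.exists_bound (hp : BoundedCoeffs p) :
    ∃ W : (Option (Fin l) →₀ ℕ) → ℝ, ∀ α x, ‖((p.coeff α x : ℝ) : ℂ)‖ ≤ W α := by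
  choose W hW using fun α => (hp α).2
  exact ⟨W, fun α x => by rw [Complex.norm_real]; exact hW α x⟩

lemma norm_symbol_mul_mFourier (b : Fin n → ℕ) (k : Fin n → ℤ) (x : Torus n) :
    ‖symbol b k * UnitAddTorus.mFourier k x‖ = ‖symbol b k‖ := by
  rw [norm_mul, mFourier_norm_apply, mul_one]

lemma measurable_coeff_mul {u v : Torus n → FPoly n} (hu : ∀ β, Measurable fun x => (u x).coeff β)
    (hv : ∀ β, Measurable fun x => (v x).coeff β) (β : MIndex n) :
    Measurable fun x => (u x * v x).coeff β := by
  classical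
  simp_rw [coeff_mul]
  exact Finset.measurable_fun_sum _ fun γ _ => (hu _).mul (hv _)

lemma measurable_coeff_sum {ι : Type*} {s : Finset ι} {u : ι → Torus n → FPoly n}
    (hu : ∀ i ∈ s, ∀ β, Measurable fun x => (u i x).coeff β) (β : MIndex n) :
    Measurable fun x => (∑ i ∈ s, u i x).coeff β := by
  simp_rw [coeff_sum]
  exact Finset.measurable_fun_sum _ fun i hi => hu i hi β

lemma measurable_coeff_C {u : Torus n → ℂ} (hu : Measurable u) (β : MIndex n) :
    Measurable fun x => (C (u x) : FPoly n).coeff β := by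
  classical
  simp_rw [coeff_C]
  split_ifs
  · exact hu
  · exact measurable_const

lemma measurable_coeff_pow {u : Torus n → FPoly n} (hu : ∀ β, Measurable fun x => (u x).coeff β)
    (e : ℕ) (β : MIndex n) : Measurable fun x => (u x ^ e).coeff β := by
  induction e generalizing β with
  | zero => simp_rw [pow_zero]; exact measurable_const
  | succ e ih => simp_rw [pow_succ]; exact measurable_coeff_mul ih hu β

lemma measurable_coeff_prod {ι : Type*} {s : Finset ι} {u : ι → Torus n → FPoly n}
    (hu : ∀ i ∈ s, ∀ β, Measurable fun x => (u i x).coeff β) (β : MIndex n) :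
    Measurable fun x => (∏ i ∈ s, u i x).coeff β := by
  classical
  induction s using Finset.induction_on generalizing β with
  | empty => simp_rw [Finset.prod_empty]; exact measurable_const
  | insert i s hi ih =>
    simp_rw [Finset.prod_insert hi]
    exact measurable_coeff_mul (hu i (Finset.mem_insert_self _ _))
      (ih fun j hj => hu j (Finset.mem_insert_of_mem hj)) β

lemma measurable_coeff_formPoly {σ : Type*} (A : Finset (σ →₀ ℕ)) {w : (σ →₀ ℕ) → Torus n → ℂ}
    {t : σ → (Fin n → ℤ) → Torus n → ℂ} (hw : ∀ α, Measurable (w α))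
    (ht : ∀ j k, Measurable (t j k)) (ρ : ℕ) (β : MIndex n) : Measurable fun x =>
      (formPoly A (fun α => w α x) (fun j k => t j k x) ρ).coeff β := by
  unfold formPoly Finsupp.prod
  refine measurable_coeff_sum (fun α _ => ?_) β
  refine measurable_coeff_mul (measurable_coeff_C (hw α)) ?_
  refine measurable_coeff_prod fun j _ => ?_
  refine measurable_coeff_pow (u := fun x => ∑ k ∈ freqBox n ρ, C (t j k x) * X k) ?_ _
  refine measurable_coeff_sum fun k _ => ?_
  exact measurable_coeff_mul (measurable_coeff_C (ht j k)) fun γ => measurable_const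

lemma bddMeas_formCoeff (hp : BoundedCoeffs p) (β : MIndex n) : BddMeas fun x =>
    formCoeff p.support (fun α => ((p.coeff α x : ℝ) : ℂ))
      (fun j k => symbol (argIndex a j) k * UnitAddTorus.mFourier k x) β := by
  obtain ⟨W, hW⟩ := hp.exists_bound
  refine ⟨?_, _, fun x => norm_formCoeff_le (fun α => hW α x)
    (fun j k => (norm_symbol_mul_mFourier (argIndex a j) k x).le) β⟩
  exact measurable_coeff_formPoly p.support
    (w := fun α x => ((p.coeff α x : ℝ) : ℂ))
    (t := fun j k x => symbol (argIndex a j) k * UnitAddTorus.mFourier k x)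
    (fun α => Complex.measurable_ofReal.comp (hp α).1)
    (fun j k => ((UnitAddTorus.mFourier k).continuous.measurable).const_mul _) (harmDeg β) β

lemma degree_le_of_mem_support {α : Option (Fin l) →₀ ℕ} (hα : α ∈ p.support) :
    α.degree ≤ p.totalDegree := by
  have := le_totalDegree hα
  exact this

lemma objCoeff_eq_zero {β : MIndex n} (hβ : p.totalDegree < algDeg β) : objCoeff L a p β = 0 := by
  rw [objCoeff_eq]
  simp_rw [formCoeff_eq_zero _ _ (fun α hα => degree_le_of_mem_support hα) hβ]
  exact applyLC_zero L

lemma starHom_formPoly {σ : Type*} {A : Finset (σ →₀ ℕ)} {w : (σ →₀ ℕ) → ℂ}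
    {t : σ → (Fin n → ℤ) → ℂ} (hw : ∀ α, starRingEnd ℂ (w α) = w α)
    (ht : ∀ j k, t j (-k) = starRingEnd ℂ (t j k)) (ρ : ℕ) :
    starHom n (formPoly A w t ρ) = formPoly A w t ρ := by
  simp only [formPoly, map_sum, map_mul, Finsupp.prod, map_prod, map_pow, starHom_C, hw, starHom_X]
  refine Finset.sum_congr rfl fun α _ => congrArg _ (Finset.prod_congr rfl fun j _ => ?_)
  congr 1
  refine Finset.sum_nbij' (fun k => -k) (fun k => -k) (fun k hk => neg_mem_freqBox hk)
    (fun k hk => neg_mem_freqBox hk) (fun k _ => neg_neg k) (fun k _ => neg_neg k) fun k _ => ?_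
  rw [ht]

lemma harmDeg_neg (β : MIndex n) : harmDeg (β.mapDomain fun a => -a) = harmDeg β := by
  classical
  unfold harmDeg
  rw [Finsupp.mapDomain_support_of_injective neg_injective, Finset.sup_image]
  refine Finset.sup_congr rfl fun a _ => ?_
  simp

lemma algDeg_neg (β : MIndex n) : algDeg (β.mapDomain fun a => -a) = algDeg β := by
  unfold algDeg
  rw [Finsupp.sum_mapDomain_index (by simp) (by simp)]

/-- Because `p` and `L` are real, the substituted polynomial is Hermitian at every `x`, and the
complexified `L` commutes with conjugation. -/
lemma objCoeff_neg (hp : BoundedCoeffs p) (β : MIndex n) :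
    objCoeff L a p (β.mapDomain fun a => -a) = starRingEnd ℂ (objCoeff L a p β) := by
  rw [objCoeff_eq, objCoeff_eq, ← applyLC_conj L (bddMeas_formCoeff a hp β)]
  refine congrArg (applyLC L) (funext fun x => ?_)
  have h := starHom_formPoly (A := p.support) (w := fun α => ((p.coeff α x : ℝ) : ℂ))
    (t := fun j k => symbol (argIndex a j) k * UnitAddTorus.mFourier k x) (by simp)
    (fun j k => by rw [symbol_neg_eq_conj, UnitAddTorus.mFourier_neg, map_mul]) (harmDeg β)
  unfold formCoeff
  rw [harmDeg_neg, ← coeff_starHom, h]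

/-! ### Expansion of the objective -/

variable {m : ℕ} {N : SobolevNorm} {a}

/-- The arguments of the polynomial have continuous derivatives on the Sobolev ball. -/
def AdmissibleOrders (a : Fin l → Fin n → ℕ) (m : ℕ) : Prop :=
  ∀ j : Option (Fin l), 2 * order (argIndex a j) + n < 2 * m

lemma admissibleOrders
    (hm : 2 * (Finset.univ.sup fun j => order (a j)) + n < 2 * m) : AdmissibleOrders a m := by
  rintro (_ | j)
  · have : order (argIndex a none) = 0 := by simp [argIndex, order]
    omega
  · have := Finset.le_sup (f := fun j => order (a j)) (Finset.mem_univ j)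
    simp only [argIndex, Option.elim]
    omega

/-- The bound for `∑_k |(D^b e_k) c_k|` on the ellipsoid. -/
def symbolBound (a : Fin l → Fin n → ℕ) (m : ℕ) (N : SobolevNorm) (j : Option (Fin l)) : ℝ :=
  √(∑' k : Fin n → ℤ, ‖symbol (argIndex a j) k‖ ^ 2 / weight m N k)

/-- Sobolev embedding: every argument of `p` has absolutely summable coefficients. They are
Hermitian, so the argument is real almost everywhere and taking `re` loses nothing. -/
lemma ae_hasSum_arg (ha : AdmissibleOrders a m) {f : L2 n} (hf : f ∈ ball n m N) :
    ∀ᵐ x ∂(torusMeasure n), ∀ j, HasSum (fun k => symbol (argIndex a j) k *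
      UnitAddTorus.mFourier k x * fourierCoeff f k) (((arg a f j x).re : ℝ) : ℂ) := by
  refine ae_all_iff.2 fun j => ?_
  have hc := inEllipsoid_of_mem_ball hf
  have hcoeff : ∀ k, fourierCoeff (arg a f j) k = symbol (argIndex a j) k * fourierCoeff f k := by
    intro k
    rcases j with _ | j
    · simp [arg, argIndex, symbol_zero]
    · have h1 := ha (some j)
      exact fourierCoeff_weakDeriv (hf.2.1 (a j) (by simp only [argIndex, Option.elim] at h1; omega)) k
  have h1 : Summable fun k => ‖fourierCoeff (arg a f j) k‖ := by
    simpa only [hcoeff, norm_mul] using hc.summable_symbol (ha j)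
  have h2 := real_of_fourierCoeff_neg (f := arg a f j) fun k => by
    rw [hcoeff, hcoeff, symbol_neg_eq_conj, hc.herm, map_mul]
  filter_upwards [ae_hasSum_fourier h1, h2] with x hx hx'
  have h3 : ((arg a f j x).re : ℂ) = arg a f j x := by
    apply Complex.ext <;> simp [hx']
  rw [h3]
  refine hx.congr_fun fun k => ?_
  rw [hcoeff]; ring

lemma integrand_eq (f : L2 n) (x : Torus n) :
    integrand a p f x = ∑ α ∈ p.support, p.coeff α x * α.prod fun j e => (arg a f j x).re ^ e := by
  rw [integrand, eval₂_eq]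
  rfl

lemma aestronglyMeasurable_integrand (hp : BoundedCoeffs p) (f : L2 n) :
    AEStronglyMeasurable (integrand a p f) (torusMeasure n) := by
  have : integrand a p f = fun x => ∑ α ∈ p.support, p.coeff α x *
      ∏ j ∈ α.support, (arg a f j x).re ^ α j := funext (integrand_eq f)
  rw [this]
  refine Finset.aestronglyMeasurable_fun_sum _ fun α _ => (hp α).1.aestronglyMeasurable.mul
    (Finset.aestronglyMeasurable_fun_prod _ fun j _ => ?_)
  exact (Complex.continuous_re.comp_aestronglyMeasurable
    (Lp.aestronglyMeasurable (arg a f j))).pow _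

/-- For almost every `x` the integrand is an absolutely convergent series in the monomials, with
majorants that do not depend on `x`; therefore `L` may be applied term by term. -/
theorem objective_expansion (ha : AdmissibleOrders a m) (hp : BoundedCoeffs p) {f : L2 n}
    (hf : f ∈ ball n m N) :
    MemLp (integrand a p f) ∞ (torusMeasure n) ∧
    HasSum (fun β => objCoeff L a p β * monomialAt (fourierCoeff f) β)
      ((objective L a p f : ℝ) : ℂ) := by
  obtain ⟨W, hW⟩ := hp.exists_bound
  have hc := inEllipsoid_of_mem_ball hf
  have hB : ∀ (j : Option (Fin l)) (ρ : ℕ), ∑ k ∈ freqBox n ρ, ‖symbol (argIndex a j) k‖ *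
      ‖fourierCoeff f k‖ ≤ symbolBound a m N j := fun j ρ => hc.sum_norm_symbol_le (ha j) _
  have hW0 : ∀ α, 0 ≤ W α := fun α => (norm_nonneg _).trans (hW α 0)
  set u : MIndex n → Torus n → ℂ := fun β x => formCoeff p.support
    (fun α => ((p.coeff α x : ℝ) : ℂ))
    (fun j k => symbol (argIndex a j) k * UnitAddTorus.mFourier k x) β *
      monomialAt (fourierCoeff f) β with hu
  set bd : MIndex n → ℝ := fun β => formCoeff p.support W
    (fun j k => ‖symbol (argIndex a j) k‖) β * ‖monomialAt (fourierCoeff f) β‖ with hbd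
  have hbdd : ∀ β, BddMeas (u β) := fun β => (bddMeas_formCoeff a hp β).mul_const _
  have hle : ∀ β x, ‖u β x‖ ≤ bd β := fun β x => by
    rw [hu, hbd, norm_mul]
    exact mul_le_mul_of_nonneg_right (norm_formCoeff_le (fun α => hW α x)
      (fun j k => (norm_symbol_mul_mFourier (argIndex a j) k x).le) β) (norm_nonneg _)
  have hbd0 : ∀ β, 0 ≤ bd β := fun β => (norm_nonneg _).trans (hle β 0)
  have hs : Summable bd := summable_of_sum_le hbd0
    (sum_formCoeff_mul_le hW0 (fun j k => norm_nonneg _) hB)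
  have hsum : ∀ᵐ x ∂(torusMeasure n), HasSum (fun β => u β x) ((integrand a p f x : ℝ) : ℂ) := by
    filter_upwards [ae_hasSum_arg ha hf] with x hx
    have := hasSum_formCoeff (A := p.support) (fun α => hW α x)
      (fun j k => (norm_symbol_mul_mFourier (argIndex a j) k x).le) hB hx
    convert this using 1
    rw [integrand_eq]
    simp [Finsupp.prod]
  have hre := hasSum_applyL L (fun β => (hbdd β).re)
    (fun β x => (Complex.abs_re_le_norm _).trans (hle β x)) hs
    (aestronglyMeasurable_integrand (a := a) hp f) (by
      filter_upwards [hsum] with x hx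
      simpa using Complex.hasSum_re hx)
  -- The individual terms are complex although the sum is real; the imaginary parts add up to zero.
  have him := hasSum_applyL L (fun β => (hbdd β).im)
    (fun β x => (Complex.abs_im_le_norm _).trans (hle β x)) hs
    (aestronglyMeasurable_const (b := (0 : ℝ))) (by
      filter_upwards [hsum] with x hx
      simpa using Complex.hasSum_im hx)
  refine ⟨hre.1, ?_⟩
  have h := (Complex.hasSum_ofReal.2 hre.2).add
    ((Complex.hasSum_ofReal.2 him.2).mul_right Complex.I)
  rw [applyL_zero, Complex.ofReal_zero, zero_mul, add_zero] at h
  refine h.congr_fun fun β => ?_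
  rw [objCoeff_eq, ← applyLC_mul_const L (bddMeas_formCoeff a hp β)]
  rfl

/-- The coefficients are absolutely summable, uniformly on the ellipsoid. -/
theorem exists_sum_norm_objCoeff_le (ha : AdmissibleOrders a m) (hp : BoundedCoeffs p)
    (N : SobolevNorm) :
    ∃ M : ℝ, 0 < M ∧ ∀ c, InEllipsoid m N c → ∀ S : Finset (MIndex n),
      ∑ β ∈ S, ‖objCoeff L a p β‖ * ‖monomialAt c β‖ ≤ M := by
  obtain ⟨W, hW⟩ := hp.exists_bound
  have hW0 : ∀ α, 0 ≤ W α := fun α => (norm_nonneg _).trans (hW α 0)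
  set M := ∑ α ∈ p.support, W α * α.prod fun j e => symbolBound a m N j ^ e
  have hM0 : 0 ≤ M := Finset.sum_nonneg fun α _ => mul_nonneg (hW0 α)
    (Finset.prod_nonneg fun j _ => pow_nonneg (Real.sqrt_nonneg _) _)
  -- The factor `2` accounts for real and imaginary parts under `L`; the summand `1` makes the bound
  -- strictly positive.
  refine ⟨2 * ‖L‖ * M + 1, by positivity, fun c hc S => ?_⟩
  have h1 : ∀ β, ‖objCoeff L a p β‖ ≤ 2 * ‖L‖ * formCoeff p.support W
      (fun j k => ‖symbol (argIndex a j) k‖) β := fun β => by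
    rw [objCoeff_eq]
    exact norm_applyLC_le L (bddMeas_formCoeff a hp β) fun x => norm_formCoeff_le
      (fun α => hW α x) (fun j k => (norm_symbol_mul_mFourier (argIndex a j) k x).le) β
  calc _ ≤ ∑ β ∈ S, 2 * ‖L‖ * (formCoeff p.support W
      (fun j k => ‖symbol (argIndex a j) k‖) β * ‖monomialAt c β‖) := by
        refine Finset.sum_le_sum fun β _ => ?_
        rw [← mul_assoc]
        exact mul_le_mul_of_nonneg_right (h1 β) (norm_nonneg _)
    _ ≤ 2 * ‖L‖ * M := by
        rw [← Finset.mul_sum]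
        refine mul_le_mul_of_nonneg_left (sum_formCoeff_mul_le hW0 (fun j k => norm_nonneg _)
          (fun j ρ => hc.sum_norm_symbol_le (ha j) _) S) (by positivity)
    _ ≤ _ := by linarith

end SobolevPOP

end

/-! ### Truncated objectives and the uniform tail estimate. -/

noncomputable section

namespace SobolevPOP

open MvPolynomial

variable {n l m : ℕ} {N : SobolevNorm} (L : LInf n →L[ℝ] ℝ) {a : Fin l → Fin n → ℕ}
  {p : CoeffPoly n l}

/-! ### Truncations of the objective -/

lemma finite_indexSet (n r ρ : ℕ) : (indexSet n r ρ).Finite := by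
  classical
  refine (Set.finite_Iic (∑ k ∈ freqBox n ρ, Finsupp.single k r : MIndex n)).subset ?_
  rintro β ⟨h1, h2⟩
  intro k
  rw [Finsupp.finsetSum_apply]
  by_cases hk : k ∈ β.support
  · rw [Finset.sum_eq_single_of_mem k (harmDeg_le_iff.1 h2 hk) (fun j _ hj => by simp [hj])]
    simp only [Finsupp.single_eq_same]
    exact (Finset.single_le_sum (f := fun k => β k) (fun _ _ => Nat.zero_le _) hk).trans h1
  · rw [Finsupp.notMem_support_iff.1 hk]; exact Nat.zero_le _

/-- The index set `A_{r,ρ}` as a finite set. -/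
def indexFinset (n r ρ : ℕ) : Finset (MIndex n) := (finite_indexSet n r ρ).toFinset

lemma mem_indexFinset {r ρ : ℕ} {β : MIndex n} :
    β ∈ indexFinset n r ρ ↔ algDeg β ≤ r ∧ harmDeg β ≤ ρ := by
  simp [indexFinset, indexSet]

lemma algDeg_zero : algDeg (0 : MIndex n) = 0 := by simp [algDeg]

lemma harmDeg_zero : harmDeg (0 : MIndex n) = 0 := by simp [harmDeg]

lemma zero_mem_indexSet (r ρ : ℕ) : (0 : MIndex n) ∈ indexSet n r ρ := by
  simp [indexSet, algDeg_zero, harmDeg_zero]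

/-- The part of the objective of harmonic degree at most `ρ`. -/
def objPoly (L : LInf n →L[ℝ] ℝ) (a : Fin l → Fin n → ℕ) (p : CoeffPoly n l) (ρ : ℕ) : FPoly n :=
  ∑ β ∈ indexFinset n p.totalDegree ρ, monomial β (objCoeff L a p β)

lemma rieszLin_objPoly (y : MIndex n → ℂ) (ρ : ℕ) : rieszLin y (objPoly L a p ρ)
    = ∑ β ∈ indexFinset n p.totalDegree ρ, objCoeff L a p β * y β := by
  simp_rw [objPoly, map_sum, rieszLin_monomial]

/-- Once `r ≥ d_p`, truncating the algebraic degree discards only zero coefficients. -/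
lemma rieszLin_objPoly' (y : MIndex n → ℂ) {r : ℕ} (hr : p.totalDegree ≤ r) (ρ : ℕ) :
    rieszLin y (objPoly L a p ρ) = ∑ β ∈ indexFinset n r ρ, objCoeff L a p β * y β := by
  rw [rieszLin_objPoly]
  refine Finset.sum_subset (fun β hβ => ?_) fun β hβ hβ' => ?_
  · rw [mem_indexFinset] at *; exact ⟨hβ.1.trans hr, hβ.2⟩
  · rw [mem_indexFinset] at *
    rw [objCoeff_eq_zero, zero_mul]
    by_contra h
    exact hβ' ⟨not_lt.1 h, hβ.2⟩

lemma tsum_indexSet (y : MIndex n → ℂ) {r : ℕ} (hr : p.totalDegree ≤ r) (ρ : ℕ) :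
    ∑' β : indexSet n r ρ, objCoeff L a p β * y β = rieszLin y (objPoly L a p ρ) := by
  rw [rieszLin_objPoly' L y hr, ← Finset.tsum_subtype]
  have : indexSet n r ρ = {β | β ∈ indexFinset n r ρ} := by
    ext β; simp [mem_indexFinset, indexSet]
  rw [this]
  rfl

lemma eval_eq_rieszLin (c : (Fin n → ℤ) → ℂ) (q : FPoly n) :
    eval c q = rieszLin (monomialAt c) q := by
  rw [eval_eq]; rfl

lemma starHom_monomial (β : MIndex n) (z : ℂ) :
    starHom n (monomial β z) = monomial (β.mapDomain fun a => -a) (starRingEnd ℂ z) := by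
  change rename _ (map _ (monomial β z)) = _
  rw [map_monomial, rename_monomial]

lemma mapDomain_neg_neg (β : MIndex n) :
    (β.mapDomain fun a => -a).mapDomain (fun a => -a) = β := by
  rw [← Finsupp.mapDomain_comp]
  have : ((fun a : Fin n → ℤ => -a) ∘ fun a => -a) = id := by ext; simp
  rw [this, Finsupp.mapDomain_id]

lemma starHom_objPoly (hp : BoundedCoeffs p) (ρ : ℕ) :
    starHom n (objPoly L a p ρ) = objPoly L a p ρ := by
  unfold objPoly
  simp_rw [map_sum, starHom_monomial, ← objCoeff_neg L a hp]
  refine Finset.sum_nbij' (fun β => β.mapDomain fun a => -a) (fun β => β.mapDomain fun a => -a)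
    (fun β hβ => ?_) (fun β hβ => ?_) (fun β _ => mapDomain_neg_neg β)
    (fun β _ => mapDomain_neg_neg β) fun β _ => rfl
  all_goals
    rw [mem_indexFinset] at *
    rwa [algDeg_neg, harmDeg_neg]

lemma monomialAt_truncate (c : (Fin n → ℤ) → ℂ) (ρ : ℕ) (β : MIndex n) :
    monomialAt (fun a => if a ∈ freqBox n ρ then c a else 0) β
      = if harmDeg β ≤ ρ then monomialAt c β else 0 := by
  split_ifs with h
  · refine Finsupp.prod_congr fun a ha => ?_
    beta_reduce
    rw [if_pos (harmDeg_le_iff.1 h ha)]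
  · rw [harmDeg_le_iff, Finset.not_subset] at h
    obtain ⟨a, ha, ha'⟩ := h
    refine Finset.prod_eq_zero ha ?_
    beta_reduce
    rw [if_neg ha', zero_pow (Finsupp.mem_support_iff.1 ha)]

/-- The truncated objective is the objective at a trigonometric polynomial in the ball. -/
lemma exists_eval_objPoly (ha : AdmissibleOrders a m) (hp : BoundedCoeffs p)
    {c : (Fin n → ℤ) → ℂ} (hc : InEllipsoid m N c) (ρ : ℕ) :
    ∃ f ∈ ball n m N, eval c (objPoly L a p ρ) = ((objective L a p f : ℝ) : ℂ) := by
  obtain ⟨f, hf, hfc⟩ := (hc.truncate ρ).exists_ball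
  refine ⟨f, hf, ?_⟩
  have h := (objective_expansion L ha hp hf).2
  rw [hfc] at h
  refine HasSum.unique ?_ h
  rw [eval_eq_rieszLin, rieszLin_objPoly]
  have h2 : ∑ β ∈ indexFinset n p.totalDegree ρ, objCoeff L a p β * monomialAt c β
      = ∑ β ∈ indexFinset n p.totalDegree ρ, objCoeff L a p β *
        monomialAt (fun a => if a ∈ freqBox n ρ then c a else 0) β := by
    refine Finset.sum_congr rfl fun β hβ => ?_
    rw [monomialAt_truncate, if_pos (mem_indexFinset.1 hβ).2]
  rw [h2]
  refine hasSum_sum_of_ne_finset_zero fun β hβ => ?_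
  rw [mem_indexFinset, not_and_or] at hβ
  rw [monomialAt_truncate]
  rcases hβ with hβ | hβ
  · rw [objCoeff_eq_zero L a (not_le.1 hβ), zero_mul]
  · rw [if_neg hβ, mul_zero]

lemma tendsto_indexFinset : Tendsto (fun ρ => indexFinset n ρ ρ) atTop atTop := by
  refine tendsto_atTop_finset_of_monotone (fun i j h β hβ => ?_) fun β => ?_
  · rw [mem_indexFinset] at *; exact ⟨hβ.1.trans h, hβ.2.trans h⟩
  · exact ⟨max (algDeg β) (harmDeg β), mem_indexFinset.2 ⟨le_max_left _ _, le_max_right _ _⟩⟩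

lemma tendsto_rieszLin_objPoly {y : MIndex n → ℂ} {z : ℂ}
    (h : HasSum (fun β => objCoeff L a p β * y β) z) :
    Tendsto (fun ρ => rieszLin y (objPoly L a p ρ)) atTop (𝓝 z) := by
  refine (h.comp tendsto_indexFinset).congr' ?_
  filter_upwards [eventually_ge_atTop p.totalDegree] with ρ hρ
  rw [rieszLin_objPoly' L y hρ]
  rfl

/-! ### Uniform smallness of the tails -/

/-- Interchanging `L` with the functional `ℓ_y` (finite sums) reduces estimates of the truncated
objective to estimates at each `x`, where `substPoly` is a polynomial in linear forms. -/
lemma rieszLin_objPoly_eq_applyLC (hp : BoundedCoeffs p) (y : MIndex n → ℂ) (ρ : ℕ) :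
    BddMeas (fun x => rieszLin y (substPoly a p ρ x)) ∧
    rieszLin y (objPoly L a p ρ) = applyLC L fun x => rieszLin y (substPoly a p ρ x) := by
  have h1 : ∀ x, rieszLin y (substPoly a p ρ x) = ∑ β ∈ indexFinset n p.totalDegree ρ,
      formCoeff p.support (fun α => ((p.coeff α x : ℝ) : ℂ))
        (fun j k => symbol (argIndex a j) k * UnitAddTorus.mFourier k x) β * y β := by
    intro x
    rw [← riesz_eq_rieszLin, riesz_eq_sum y _ (S := indexFinset n p.totalDegree ρ)]
    · refine Finset.sum_congr rfl fun β hβ => ?_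
      rw [substPoly_eq, coeff_formPoly _ _ _ (mem_indexFinset.1 hβ).2]
    · intro β hβ
      rw [mem_support_iff, substPoly_eq] at hβ
      rw [mem_indexFinset]
      have h2 : harmDeg β ≤ ρ := by
        by_contra h
        exact hβ (coeff_formPoly_eq_zero _ _ _ h)
      refine ⟨?_, h2⟩
      by_contra h
      rw [coeff_formPoly _ _ _ h2] at hβ
      exact hβ (formCoeff_eq_zero _ _ (fun α hα => degree_le_of_mem_support hα) (not_le.1 h))
  simp_rw [h1]
  have hb : ∀ β ∈ indexFinset n p.totalDegree ρ, BddMeas fun x =>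
      formCoeff p.support (fun α => ((p.coeff α x : ℝ) : ℂ))
        (fun j k => symbol (argIndex a j) k * UnitAddTorus.mFourier k x) β * y β :=
    fun β _ => (bddMeas_formCoeff a hp β).mul_const _
  refine ⟨BddMeas.sum hb, ?_⟩
  rw [rieszLin_objPoly, applyLC_sum L hb]
  refine Finset.sum_congr rfl fun β _ => ?_
  rw [applyLC_mul_const L (bddMeas_formCoeff a hp β), objCoeff_eq]

/-- The linear forms in `substPoly`. -/
def linForm (a : Fin l → Fin n → ℕ) (ρ : ℕ) (x : Torus n) (j : Option (Fin l)) : FPoly n :=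
  ∑ k ∈ freqBox n ρ, C (symbol (argIndex a j) k * UnitAddTorus.mFourier k x) * X k

lemma linForm_of_le {ρ₁ ρ : ℕ} (h : ρ₁ ≤ ρ) (x : Torus n) (j : Option (Fin l)) :
    linForm a ρ₁ x j = ∑ k ∈ freqBox n ρ, C (if k ∈ freqBox n ρ₁ then
      symbol (argIndex a j) k * UnitAddTorus.mFourier k x else 0) * X k := by
  rw [linForm, ← Finset.sum_subset (freqBox_mono h) fun k _ hk => by rw [if_neg hk]; simp]
  exact Finset.sum_congr rfl fun k hk => by rw [if_pos hk]

/-- The exponential factors have modulus one, so Cauchy-Schwarz gives a bound independent of `x`;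
adding `1` makes it strictly positive, as domination arguments require. -/
lemma dominated_linForm (ha : AdmissibleOrders a m) {ρ₁ ρ : ℕ} (h : ρ₁ ≤ ρ) (x : Torus n)
    (j : Option (Fin l)) :
    Dominated m N (linForm a ρ₁ x j) (symbolBound a m N j + 1) 1 ρ := by
  have h0 : 0 ≤ symbolBound a m N j := Real.sqrt_nonneg _
  have hnn : ∀ k : Fin n → ℤ, 0 ≤ ‖symbol (argIndex a j) k‖ ^ 2 / weight m N k := fun k =>
    div_nonneg (by positivity) (weight_pos m N k).le
  rw [linForm_of_le h]
  refine dominated_linearForm _ (by linarith) ?_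
  calc _ ≤ ∑ k ∈ freqBox n ρ, ‖symbol (argIndex a j) k‖ ^ 2 / weight m N k := by
        refine Finset.sum_le_sum fun k _ => ?_
        split_ifs
        · rw [norm_symbol_mul_mFourier]
        · simpa using hnn k
    _ ≤ symbolBound a m N j ^ 2 := by
        rw [symbolBound, Real.sq_sqrt (tsum_nonneg hnn)]
        exact (summable_symbol_div_weight N (ha j)).sum_le_tsum _ fun k _ => hnn k
    _ ≤ _ := pow_le_pow_left₀ h0 (by linarith) 2

lemma dominated_linForm_sub {ρ₁ ρ : ℕ} (h : ρ₁ ≤ ρ) (x : Torus n) (j : Option (Fin l)) {η : ℝ}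
    (hη : 0 < η) (ht : ∑ k ∈ freqBox n ρ \ freqBox n ρ₁,
      ‖symbol (argIndex a j) k‖ ^ 2 / weight m N k ≤ η ^ 2) :
    Dominated m N (linForm a ρ x j - linForm a ρ₁ x j) η 1 ρ := by
  have : linForm a ρ x j - linForm a ρ₁ x j = ∑ k ∈ freqBox n ρ, C (if k ∈ freqBox n ρ₁ then 0
      else symbol (argIndex a j) k * UnitAddTorus.mFourier k x) * X k := by
    rw [linForm_of_le h, linForm, ← Finset.sum_sub_distrib]
    refine Finset.sum_congr rfl fun k _ => ?_
    split_ifs <;> simp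
  rw [this]
  refine dominated_linearForm _ hη (le_trans (le_of_eq ?_) ht)
  rw [← Finset.sum_sdiff (freqBox_mono h)]
  refine (congrArg (_ + ·) (Finset.sum_eq_zero fun k hk => ?_)).trans ((add_zero _).trans
    (Finset.sum_congr rfl fun k hk => ?_))
  · rw [if_pos hk]; simp
  · rw [if_neg (Finset.mem_sdiff.1 hk).2, norm_symbol_mul_mFourier]

lemma substPoly_eq_sum (ρ : ℕ) (x : Torus n) : substPoly a p ρ x
    = ∑ α ∈ p.support, C ((p.coeff α x : ℝ) : ℂ) * α.prod fun j e => linForm a ρ x j ^ e := by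
  rw [substPoly_eq]; rfl

/-- At each `x`, the linear forms truncated at `ρ` and `ρ₁` differ by a form dominated by a small
`η`, uniformly in `x`. `StablyDominated` transfers this to the monomials of `p`, with certificates
of degree at most `d_p` inside level `ρ`, and `L` preserves the estimate. Thus `ρ₁` depends neither
on the state nor on its level. -/
theorem exists_tail_le (ha : AdmissibleOrders a m) (hp : BoundedCoeffs p) (N : SobolevNorm)
    {ε : ℝ} (hε : 0 < ε) :
    ∃ ρ₁, ∀ ρ r y, ρ₁ ≤ ρ → p.totalDegree ≤ r → IsState (quadModule n m N r ρ) y →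
      ‖rieszLin y (objPoly L a p ρ) - rieszLin y (objPoly L a p ρ₁)‖ ≤ ε := by
  obtain ⟨W, hW⟩ := hp.exists_bound
  have hW0 : ∀ α, 0 ≤ W α := fun α => (norm_nonneg _).trans (hW α 0)
  choose P D hP hD hPD using fun α => stablyDominated n m N (fun j => symbolBound a m N j + 1)
    (fun j => by have : 0 ≤ symbolBound a m N j := Real.sqrt_nonneg _; linarith) α
  set T := ∑ α ∈ p.support, W α * D α
  have hT : 0 ≤ T := Finset.sum_nonneg fun α _ => mul_nonneg (hW0 α) (hD α).le
  -- The pointwise error is at most `T η`, and the complexified `L` costs `2‖L‖`; the `1` avoids a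
  -- zero denominator.
  set η := ε / (2 * ‖L‖ * T + 1) with hηdef
  have hη : 0 < η := by positivity
  have hρ : ∃ ρ₁, ∀ j : Option (Fin l), ∀ ρ, ρ₁ ≤ ρ → ∑ k ∈ freqBox n ρ \ freqBox n ρ₁,
      ‖symbol (argIndex a j) k‖ ^ 2 / weight m N k ≤ η ^ 2 := by
    have h1 : ∀ j : Option (Fin l), ∀ᶠ ρ₁ in atTop,
        ∑' k : Fin n → ℤ, ‖symbol (argIndex a j) k‖ ^ 2 / weight m N k - η ^ 2
          < ∑ k ∈ freqBox n ρ₁, ‖symbol (argIndex a j) k‖ ^ 2 / weight m N k := fun j =>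
      (((summable_symbol_div_weight N (ha j)).hasSum.comp tendsto_freqBox).eventually
        (lt_mem_nhds (sub_lt_self _ (by positivity))))
    obtain ⟨ρ₁, hρ₁⟩ := (eventually_all.2 h1).exists
    refine ⟨ρ₁, fun j ρ h => ?_⟩
    have h2 := hρ₁ j
    have h3 := (summable_symbol_div_weight N (ha j)).sum_le_tsum (freqBox n ρ) fun k _ =>
      div_nonneg (by positivity) (weight_pos m N k).le
    rw [← Finset.sum_sdiff (freqBox_mono h)] at h3
    linarith
  obtain ⟨ρ₁, hρ₁⟩ := hρ
  refine ⟨ρ₁, fun ρ r y hle hr hy => ?_⟩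
  obtain ⟨b1, e1⟩ := rieszLin_objPoly_eq_applyLC L (a := a) hp y ρ
  obtain ⟨b2, e2⟩ := rieszLin_objPoly_eq_applyLC L (a := a) hp y ρ₁
  have e3 : rieszLin y (objPoly L a p ρ) - rieszLin y (objPoly L a p ρ₁) = applyLC L fun x =>
      rieszLin y (substPoly a p ρ x) + rieszLin y (substPoly a p ρ₁ x) * (-1) := by
    rw [applyLC_add L b1 (b2.mul_const _), applyLC_mul_const L b2, e1, e2]; ring
  rw [e3]
  have hbound : ∀ x, ‖rieszLin y (substPoly a p ρ x) + rieszLin y (substPoly a p ρ₁ x) * (-1)‖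
      ≤ T * η := fun x => by
    rw [mul_neg_one, ← sub_eq_add_neg, ← map_sub, substPoly_eq_sum, substPoly_eq_sum,
      ← Finset.sum_sub_distrib, map_sum, Finset.sum_mul]
    refine (norm_sum_le _ _).trans (Finset.sum_le_sum fun α hα => ?_)
    rw [← mul_sub, rieszLin_C_mul, norm_mul, mul_assoc]
    refine mul_le_mul (hW α x) ?_ (norm_nonneg _) (hW0 α)
    obtain ⟨-, -, h3⟩ := hPD α ρ (linForm a ρ x) (linForm a ρ₁ x) η hη
      (fun j => dominated_linForm ha le_rfl x j) (fun j => dominated_linForm ha hle x j)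
      (fun j => dominated_linForm_sub hle x j hη (hρ₁ j ρ hle))
    exact h3.norm_rieszLin_le (mul_pos (hD α) hη) ((degree_le_of_mem_support hα).trans hr) hy
  refine (norm_applyLC_le L (b1.add (b2.mul_const _)) hbound).trans ?_
  rw [hηdef, ← mul_assoc, mul_div_assoc', div_le_iff₀ (by positivity)]
  nlinarith

end SobolevPOP

end

/-! ### Bounds for pseudo-moments and construction of near-optimal densities. -/

noncomputable section

namespace SobolevPOP

open MvPolynomial

variable {n l m : ℕ} {N : SobolevNorm} {L : LInf n →L[ℝ] ℝ} {a : Fin l → Fin n → ℕ}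
  {p : CoeffPoly n l}

/-! ### The optimal value -/

lemma inEllipsoid_zero (m : ℕ) (N : SobolevNorm) :
    InEllipsoid m N (fun _ : Fin n → ℤ => (0 : ℂ)) :=
  ⟨fun a => by simp, fun ρ => by simp⟩

theorem exists_optValue_eq (ha : AdmissibleOrders a m) (hp : BoundedCoeffs p) (N : SobolevNorm)
    (L : LInf n →L[ℝ] ℝ) : ∃ v : ℝ, optValue m N L a p = v := by
  obtain ⟨M, hM, hle⟩ := exists_sum_norm_objCoeff_le L ha hp N
  obtain ⟨f₀, hf₀, -⟩ := (inEllipsoid_zero (n := n) m N).exists_ball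
  have hub : optValue m N L a p ≤ (objective L a p f₀ : EReal) := iInf₂_le f₀ hf₀
  have hlb : ((-M : ℝ) : EReal) ≤ optValue m N L a p := by
    refine le_iInf₂ fun f hf => EReal.coe_le_coe_iff.2 ?_
    have h1 := (objective_expansion L ha hp hf).2
    have h2 : ‖((objective L a p f : ℝ) : ℂ)‖ ≤ M := by
      refine le_of_tendsto h1.norm (Eventually.of_forall fun S => (norm_sum_le _ _).trans ?_)
      simp_rw [norm_mul]
      exact hle _ (inEllipsoid_of_mem_ball hf) S
    rw [Complex.norm_real, Real.norm_eq_abs] at h2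
    exact (abs_le.1 h2).1
  refine ⟨(optValue m N L a p).toReal, (EReal.coe_toReal ?_ ?_).symm⟩
  · exact (hub.trans_lt (EReal.coe_lt_top _)).ne
  · exact ((EReal.bot_lt_coe _).trans_le hlb).ne'

lemma le_objective {v : ℝ} (hv : optValue m N L a p = v) {f : L2 n} (hf : f ∈ ball n m N) :
    v ≤ objective L a p f := by
  have : optValue m N L a p ≤ (objective L a p f : EReal) := iInf₂_le f hf
  rw [hv] at this
  exact EReal.coe_le_coe_iff.1 this

lemma exists_objective_lt {v : ℝ} (hv : optValue m N L a p = v) {ε : ℝ} (hε : 0 < ε) :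
    ∃ f ∈ ball n m N, objective L a p f < v + ε := by
  have : optValue m N L a p < ((v + ε : ℝ) : EReal) := by
    rw [hv]; exact EReal.coe_lt_coe_iff.2 (by linarith)
  obtain ⟨f, hf⟩ := iInf_lt_iff.1 this
  obtain ⟨hf1, hf2⟩ := iInf_lt_iff.1 hf
  exact ⟨f, hf1, EReal.coe_lt_coe_iff.1 hf2⟩

/-- States nearly satisfy the lower bound `p^*`. -/
theorem eventually_le_rieszLin (ha : AdmissibleOrders a m) (hp : BoundedCoeffs p) {v : ℝ}
    (hv : optValue m N L a p = v) {ε : ℝ} (hε : 0 < ε) :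
    ∃ k, ∀ r ρ y, k ≤ r → k ≤ ρ → IsState (quadModule n m N r ρ) y →
      v - ε ≤ (rieszLin y (objPoly L a p ρ)).re := by
  obtain ⟨ρ₁, hρ₁⟩ := exists_tail_le L ha hp N (half_pos hε)
  -- With `ρ₁` fixed, the truncated objective minus `v - ε/2` is at least `ε/2` on the ellipsoid,
  -- its values being objective values in the ball. The Putinar level `(r₀, ρ₀)` is therefore fixed
  -- before `r`, `ρ` and `y`.
  obtain ⟨r₀, ρ₀, hmem⟩ := exists_mem_quadModule_of_pos (m := m) (N := N)
    (q := objPoly L a p ρ₁ - C (((v - ε / 2 : ℝ)) : ℂ)) (by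
      rw [map_sub, starHom_objPoly L hp, starHom_C, Complex.conj_ofReal]) (fun c hc => by
      obtain ⟨f, hf, he⟩ := exists_eval_objPoly L ha hp hc ρ₁
      rw [map_sub, he, eval_C, ← Complex.ofReal_sub, Complex.ofReal_re]
      linarith [le_objective hv hf])
  refine ⟨max (max r₀ p.totalDegree) (max ρ₀ ρ₁), fun r ρ y hr hρ hy => ?_⟩
  simp only [max_le_iff] at hr hρ
  have h1 := hρ₁ ρ r y hρ.2.2 hr.1.2 hy
  have h2 := hy.nonneg _ (quadModule_mono hr.1.1 hρ.2.1 hmem)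
  rw [map_sub, rieszLin_C, hy.one, mul_one, Complex.sub_re, Complex.ofReal_re] at h2
  have h3 := (Complex.abs_re_le_norm _).trans h1
  rw [Complex.sub_re] at h3
  linarith [(abs_le.1 h3).1]

/-- Under a state of the whole quadratic module the objective is absolutely summable. -/
theorem IsState.summable (ha : AdmissibleOrders a m) (hp : BoundedCoeffs p)
    {y : MIndex n → ℂ} (hy : IsState (quadModuleTop n m N) y) :
    Summable fun β => objCoeff L a p β * y β := by
  obtain ⟨M, hM, hle⟩ := exists_sum_norm_objCoeff_le L ha hp N
  refine Summable.of_norm (summable_of_sum_le (c := M + 1) (fun _ => norm_nonneg _) fun S => ?_)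
  set q := fun β => objCoeff L a p β
  -- Phases turning a finite part of the series into the sum of its absolute values under `ℓ_y`;
  -- vanishing terms get the harmless value `0`.
  set u : MIndex n → ℂ := fun β => starRingEnd ℂ (q β * y β) / ‖q β * y β‖ with hu
  have hu1 : ∀ β, ‖u β‖ ≤ 1 := fun β => by
    rw [hu]
    simp only [norm_div, RCLike.norm_conj, Complex.norm_real, norm_norm]
    exact div_self_le_one _
  have hu2 : ∀ β, u β * q β * y β = (‖q β * y β‖ : ℝ) := fun β => by
    by_cases h0 : q β * y β = 0
    · rw [mul_assoc, h0]; simp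
    · have : (‖q β * y β‖ : ℂ) ≠ 0 := Complex.ofReal_ne_zero.2 (norm_ne_zero_iff.2 h0)
      rw [hu, mul_assoc, div_mul_eq_mul_div, mul_comm, Complex.mul_conj,
        Complex.normSq_eq_norm_sq, Complex.ofReal_pow, sq, mul_div_assoc, div_self this, mul_one]
  set T : FPoly n := ∑ β ∈ S, monomial β (u β * q β) with hT
  have hyT : rieszLin y T = ((∑ β ∈ S, ‖q β * y β‖ : ℝ) : ℂ) := by
    rw [hT, map_sum]
    simp_rw [rieszLin_monomial, hu2]
    push_cast; rfl
  -- On the ellipsoid `|T| ≤ M`, so `2M + 1 - 2 Re T ≥ 1` there; Putinar's theorem transfers the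
  -- bound to `ℓ_y`.
  have hR : C ((2 * M + 1 : ℝ) : ℂ) - (T + starHom n T) ∈ quadModuleTop n m N := by
    refine mem_quadModuleTop.2 (exists_mem_quadModule_of_pos ?_ fun c hc => ?_)
    · rw [map_sub, map_add, starHom_starHom, starHom_C, Complex.conj_ofReal, add_comm T]
    · rw [map_sub, map_add, eval_starHom hc.herm, eval_C, Complex.add_conj, ← Complex.ofReal_sub,
        Complex.ofReal_re]
      have h1 : ‖eval c T‖ ≤ M := by
        rw [eval_eq_rieszLin, hT, map_sum]
        simp_rw [rieszLin_monomial]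
        refine (norm_sum_le _ _).trans (le_trans (Finset.sum_le_sum fun β _ => ?_) (hle c hc S))
        rw [norm_mul, norm_mul, mul_assoc]
        exact mul_le_of_le_one_left (by positivity) (hu1 β)
      have h2 := (abs_le.1 ((Complex.abs_re_le_norm _).trans h1)).2
      linarith
  obtain ⟨r, ρ, hTm⟩ := exists_mem_truncPoly T
  have h1 := (hy.mono (fun t ht => mem_quadModuleTop.2 ⟨r, ρ, ht⟩)).rieszLin_star hTm
  have h2 := hy.nonneg _ hR
  rw [map_sub, map_add, h1, hyT, rieszLin_C, hy.one, mul_one, Complex.conj_ofReal,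
    ← Complex.ofReal_add, ← Complex.ofReal_sub, Complex.ofReal_re] at h2
  linarith

/-! ### Densities from the inner hierarchy -/

variable {γ : Measure (EllTwo n)}

/-- The moments of the measure with density `g` on the ellipsoid. -/
def densityMoments (γ : Measure (EllTwo n)) (m : ℕ) (N : SobolevNorm) (g : FPoly n)
    (β : MIndex n) : ℂ :=
  ∫ c in ellipsoid n m N, monomialAt c β * eval (c ·) g ∂γ

lemma integrableOn_eval [IsLocallyFiniteMeasure γ] (hm : n < 2 * m) (q : FPoly n) :
    IntegrableOn (fun c : EllTwo n => eval (c ·) q) (ellipsoid n m N) γ :=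
  (continuous_eval_ellTwo q).continuousOn.integrableOn_compact (isCompact_ellipsoid N hm)

lemma rieszLin_densityMoments [IsLocallyFiniteMeasure γ] (hm : n < 2 * m) (g q : FPoly n) :
    rieszLin (densityMoments γ m N g) q
      = ∫ c in ellipsoid n m N, eval (c ·) q * eval (c ·) g ∂γ := by
  induction q using MvPolynomial.monomial_add_induction_on with
  | C z =>
    rw [rieszLin_C, densityMoments, ← integral_const_mul]
    simp [monomialAt]
  | monomial_add β z q _ _ h1 =>
    have h2 : rieszLin (densityMoments γ m N g) (monomial β z)
        = ∫ c in ellipsoid n m N, eval (c ·) (monomial β z) * eval (c ·) g ∂γ := by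
      rw [rieszLin_monomial, densityMoments, ← integral_const_mul]
      simp_rw [eval_monomial, mul_assoc]
      rfl
    rw [map_add, h1, h2, ← integral_add]
    · simp_rw [map_add, add_mul]
    · simp_rw [← map_mul]; exact integrableOn_eval hm _
    · simp_rw [← map_mul]; exact integrableOn_eval hm _

/-- A test polynomial and the density, both taken from the module, are nonnegative on the ellipsoid,
hence so is the integral of their product. -/
lemma isState_densityMoments [IsLocallyFiniteMeasure γ] (hm : n < 2 * m) {g : FPoly n}
    (hg : g ∈ quadModuleTop n m N) (h1 : densityMoments γ m N g 0 = 1) :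
    IsState (quadModuleTop n m N) (densityMoments γ m N g) := by
  have hE : MeasurableSet (ellipsoid n m N) := (isCompact_ellipsoid N hm).isClosed.measurableSet
  have key : ∀ q ∈ quadModuleTop n m N, ∃ x : ℝ, 0 ≤ x ∧
      rieszLin (densityMoments γ m N g) q = x := by
    intro q hq
    obtain ⟨r, ρ, hq⟩ := mem_quadModuleTop.1 hq
    obtain ⟨r', ρ', hg⟩ := mem_quadModuleTop.1 hg
    refine ⟨∫ c in ellipsoid n m N, (eval (c ·) q * eval (c ·) g).re ∂γ, ?_, ?_⟩
    · refine setIntegral_nonneg hE fun c hc => ?_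
      obtain ⟨x, hx, hx'⟩ := (mem_ellipsoid_iff.1 hc).eval_quadModule hq
      obtain ⟨z, hz, hz'⟩ := (mem_ellipsoid_iff.1 hc).eval_quadModule hg
      rw [hx', hz', ← Complex.ofReal_mul, Complex.ofReal_re]
      exact mul_nonneg hx hz
    · rw [rieszLin_densityMoments hm]
      refine Eq.trans ?_ integral_complex_ofReal
      refine setIntegral_congr_fun hE fun c hc => ?_
      obtain ⟨x, hx, hx'⟩ := (mem_ellipsoid_iff.1 hc).eval_quadModule hq
      obtain ⟨z, hz, hz'⟩ := (mem_ellipsoid_iff.1 hc).eval_quadModule hg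
      simp only [hx', hz']
      rw [← Complex.ofReal_mul, Complex.ofReal_re]
  refine ⟨h1, fun q hq => ?_, fun q hq => ?_⟩
  · obtain ⟨x, hx, hx'⟩ := key q hq
    rwa [hx', Complex.ofReal_re]
  · obtain ⟨x, hx, hx'⟩ := key q hq
    rw [hx', Complex.ofReal_im]

/-- Powers of `1 - X / K` concentrate where `X` is small. -/
lemma exists_pow_concentrated {Ω : Type*} [MeasurableSpace Ω] (μ : Measure Ω) [IsFiniteMeasure μ]
    {X : Ω → ℝ} (hX : Measurable X) {K ε : ℝ} (hε : 0 < ε) (hK : 2 * ε ≤ K)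
    (h0 : ∀ᵐ ω ∂μ, 0 ≤ X ω ∧ X ω ≤ K) (hμ : 0 < μ {ω | X ω < ε}) :
    ∃ k : ℕ, 0 < ∫ ω, (1 - X ω / K) ^ (2 * k) ∂μ ∧
      ∫ ω, X ω * (1 - X ω / K) ^ (2 * k) ∂μ ≤ 3 * ε * ∫ ω, (1 - X ω / K) ^ (2 * k) ∂μ := by
  have hKpos : 0 < K := by linarith
  set U := {ω | X ω < ε}
  have hU : MeasurableSet U := measurableSet_lt hX measurable_const
  -- `s` bounds `1 - X/K` from below on `U`, and `t < s` bounds it from above where `X ≥ 2ε`. So the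
  -- mass there is negligible, at the geometric rate `(t/s)^(2k)`; `2ε ≤ K` ensures `t ≥ 0`.
  set s := 1 - ε / K with hs
  set t := 1 - 2 * ε / K with ht
  have ht0 : 0 ≤ t := by rw [ht, sub_nonneg, div_le_one hKpos]; exact hK
  have hts : t < s := by
    rw [ht, hs]
    have : ε / K < 2 * ε / K := by rw [div_lt_div_iff_of_pos_right hKpos]; linarith
    linarith
  have hs0 : 0 < s := ht0.trans_lt hts
  have hF : ∀ k : ℕ, ∀ᵐ ω ∂μ, 0 ≤ (1 - X ω / K) ^ (2 * k) ∧ (1 - X ω / K) ^ (2 * k) ≤ 1 := by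
    intro k
    filter_upwards [h0] with ω hω
    have h1 : 0 ≤ 1 - X ω / K := by rw [sub_nonneg, div_le_one hKpos]; exact hω.2
    have h2 : 1 - X ω / K ≤ 1 := by
      have := div_nonneg hω.1 hKpos.le
      linarith
    exact ⟨pow_nonneg h1 _, pow_le_one₀ h1 h2⟩
  have hmeas : ∀ k : ℕ, Measurable fun ω => (1 - X ω / K) ^ (2 * k) := fun k => by fun_prop
  have hint : ∀ k : ℕ, Integrable (fun ω => (1 - X ω / K) ^ (2 * k)) μ := fun k =>
    Integrable.of_bound (hmeas k).aestronglyMeasurable 1 (by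
      filter_upwards [hF k] with ω hω
      rw [Real.norm_of_nonneg hω.1]; exact hω.2)
  have hintX : ∀ k : ℕ, Integrable (fun ω => X ω * (1 - X ω / K) ^ (2 * k)) μ := fun k =>
    Integrable.of_bound (hX.mul (hmeas k)).aestronglyMeasurable K (by
      filter_upwards [hF k, h0] with ω hω hω'
      rw [Real.norm_of_nonneg (mul_nonneg hω'.1 hω.1)]
      calc _ ≤ K * 1 := mul_le_mul hω'.2 hω.2 hω.1 hKpos.le
        _ = K := mul_one K)
  have hμU : 0 < μ.real U := ENNReal.toReal_pos hμ.ne' (measure_ne_top _ _)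
  have hlow : ∀ k : ℕ, s ^ (2 * k) * μ.real U ≤ ∫ ω, (1 - X ω / K) ^ (2 * k) ∂μ := fun k => by
    calc s ^ (2 * k) * μ.real U = ∫ ω in U, s ^ (2 * k) ∂μ := by
          rw [setIntegral_const, smul_eq_mul, mul_comm]
      _ ≤ ∫ ω in U, (1 - X ω / K) ^ (2 * k) ∂μ := by
          refine setIntegral_mono_on (integrable_const _) (hint k).integrableOn hU fun ω hω => ?_
          refine pow_le_pow_left₀ hs0.le ?_ _
          have : X ω / K < ε / K := (div_lt_div_iff_of_pos_right hKpos).2 hω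
          rw [hs]; linarith
      _ ≤ _ := setIntegral_le_integral (hint k) (by
          filter_upwards [hF k] with ω hω using hω.1)
  -- Split at `X = 2ε`. The main part costs `2ε`; the remaining `ε` in the claim absorbs the
  -- exponentially small term.
  have hup : ∀ k : ℕ, ∫ ω, X ω * (1 - X ω / K) ^ (2 * k) ∂μ
      ≤ 2 * ε * ∫ ω, (1 - X ω / K) ^ (2 * k) ∂μ + K * t ^ (2 * k) * μ.real Set.univ := fun k => by
    have h1 : ∫ ω, X ω * (1 - X ω / K) ^ (2 * k) ∂μ
        ≤ ∫ ω, (2 * ε * (1 - X ω / K) ^ (2 * k) + K * t ^ (2 * k)) ∂μ := by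
      refine integral_mono_ae (hintX k) (((hint k).const_mul _).add (integrable_const _)) ?_
      filter_upwards [h0, hF k] with ω hω hω'
      rcases le_total (X ω) (2 * ε) with h | h
      · have := mul_le_mul_of_nonneg_right h hω'.1
        have h3 : 0 ≤ K * t ^ (2 * k) := by positivity
        linarith
      · have h2 : (1 - X ω / K) ^ (2 * k) ≤ t ^ (2 * k) := by
          refine pow_le_pow_left₀ ?_ ?_ _
          · rw [sub_nonneg, div_le_one hKpos]; exact hω.2
          · have := (div_le_div_iff_of_pos_right hKpos).2 h
            rw [ht]; linarith
        have h3 := mul_le_mul hω.2 h2 hω'.1 hKpos.le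
        have h4 : 0 ≤ 2 * ε * (1 - X ω / K) ^ (2 * k) := mul_nonneg (by linarith) hω'.1
        linarith
    rw [integral_add ((hint k).const_mul _) (integrable_const _), integral_const_mul,
      integral_const, smul_eq_mul, mul_comm (μ.real Set.univ)] at h1
    exact h1
  have hlim : Tendsto (fun k : ℕ => ((t / s) ^ 2) ^ k) atTop (𝓝 0) := by
    refine tendsto_pow_atTop_nhds_zero_of_lt_one (by positivity) ?_
    exact pow_lt_one₀ (by positivity) ((div_lt_one hs0).2 hts) two_ne_zero
  have hsmall : 0 < ε * μ.real U / (K * (μ.real Set.univ + 1)) := by positivity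
  obtain ⟨k, hk⟩ := (hlim.eventually (gt_mem_nhds hsmall)).exists
  refine ⟨k, (mul_pos (pow_pos hs0 _) hμU).trans_le (hlow k), ?_⟩
  have h5 : K * t ^ (2 * k) * μ.real Set.univ ≤ ε * (s ^ (2 * k) * μ.real U) := by
    rw [← pow_mul, div_pow, div_lt_div_iff₀ (by positivity) (by positivity)] at hk
    have h6 : 0 ≤ K * t ^ (2 * k) := by positivity
    nlinarith
  have h7 := hlow k
  have h8 := hup k
  nlinarith

/-- Near-optimal densities. -/
theorem exists_density [IsLocallyFiniteMeasure γ] (ha : AdmissibleOrders a m)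
    (hp : BoundedCoeffs p) (hm : n < 2 * m)
    (hγ : ∀ U : Set (EllTwo n), IsOpen U → (U ∩ ellipsoid n m N).Nonempty →
      0 < γ (U ∩ ellipsoid n m N)) {v : ℝ} (hv : optValue m N L a p = v) {ε : ℝ} (hε : 0 < ε) :
    ∃ g : FPoly n, ∃ k : ℕ, g ∈ quadModule n m N k k ∧ densityMoments γ m N g 0 = 1 ∧
      ∀ ρ, k ≤ ρ → (rieszLin (densityMoments γ m N g) (objPoly L a p ρ)).re ≤ v + ε := by
  set E := ellipsoid n m N
  have hEc : IsCompact E := isCompact_ellipsoid N hm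
  have hEm : MeasurableSet E := hEc.isClosed.measurableSet
  -- Three `δ` for the concentration of the density, and one for each of the two tail comparisons,
  -- from `ρ` to `ρ₁` and from `ρ₁` to `ρ₂`.
  set δ := ε / 5 with hδdef
  have hδ : 0 < δ := by positivity
  obtain ⟨ρ₁, hρ₁⟩ := exists_tail_le L ha hp N hδ
  obtain ⟨f, hf, hfv⟩ := exists_objective_lt hv hδ
  have hlim := tendsto_rieszLin_objPoly L (objective_expansion L ha hp hf).2
  have hlim' := (Complex.continuous_re.tendsto _).comp hlim
  rw [Complex.ofReal_re] at hlim'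
  -- Large enough that the truncated objective is still below `v + δ` at the coefficients of `f`,
  -- and that the tail estimate applies.
  obtain ⟨ρ₂, hρ₂, hρ₂'⟩ := ((hlim'.eventually (gt_mem_nhds hfv)).and
    (eventually_ge_atTop ρ₁)).exists
  set q := objPoly L a p ρ₂ with hq
  set X : EllTwo n → ℝ := fun c => (eval (c ·) q).re - v with hXdef
  have hXc : Continuous X := (Complex.continuous_re.comp (continuous_eval_ellTwo q)).sub
    continuous_const
  -- Truncating `c` stays in the ellipsoid, so truncated objective values are objective values in
  -- the ball and cannot fall below `v`.
  have hXE : ∀ c ∈ E, 0 ≤ X c ∧ eval (c ·) q = ((X c + v : ℝ) : ℂ) := by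
    intro c hc
    obtain ⟨f', hf', he⟩ := exists_eval_objPoly L ha hp (mem_ellipsoid_iff.1 hc) ρ₂
    have h1 := le_objective hv hf'
    refine ⟨?_, ?_⟩
    · rw [hXdef]; simp only; rw [hq, he, Complex.ofReal_re]; linarith
    · rw [hXdef, sub_add_cancel, hq, he, Complex.ofReal_re]
  obtain ⟨K₀, hK₀⟩ := (hEc.image hXc).bddAbove
  set K := max K₀ (2 * δ)
  have hKpos : 0 < K := lt_of_lt_of_le (by positivity) (le_max_right _ _)
  have hXK : ∀ c ∈ E, X c ≤ K := fun c hc => (hK₀ ⟨c, hc, rfl⟩).trans (le_max_left _ _)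
  have hfin : IsFiniteMeasure (γ.restrict E) := ⟨by
    rw [Measure.restrict_apply_univ]; exact hEc.measure_lt_top⟩
  have hU : 0 < (γ.restrict E) {c | X c < δ} := by
    rw [Measure.restrict_apply (measurableSet_lt hXc.measurable measurable_const)]
    -- The near-minimizer `f` makes this relatively open subset of `E` nonempty; this is where
    -- positivity of `γ` enters.
    refine hγ _ (isOpen_lt hXc continuous_const) ?_
    have h1 : Memℓp (fourierCoeff f) 2 := by
      rw [memℓp_gen_iff (by norm_num)]
      simpa using (hasSum_sq_fourierCoeff f).summable
    refine ⟨⟨fourierCoeff f, h1⟩, ?_, ⟨f, hf, fun _ => rfl⟩⟩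
    change (eval (fourierCoeff f) q).re - v < δ
    rw [eval_eq_rieszLin]
    simp only [Function.comp_apply] at hρ₂
    linarith
  obtain ⟨k, hpos, hle⟩ := exists_pow_concentrated (γ.restrict E) hXc.measurable hδ
    (le_max_right _ _ : 2 * δ ≤ K)
    ((ae_restrict_iff' hEm).2 (Eventually.of_forall fun c hc => ⟨(hXE c hc).1, hXK c hc⟩)) hU
  set I := ∫ c in E, (1 - X c / K) ^ (2 * k) ∂γ with hI
  -- The polynomial equal to `1 - X/K` on `E`. The density is the Hermitian square of `h^k`,
  -- normalized by `I`; the even exponent `2k` places it in the quadratic module.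
  set h : FPoly n := 1 - C ((K⁻¹ : ℝ) : ℂ) * (q - C ((v : ℝ) : ℂ)) with hh
  have hstar : starHom n (h ^ k) = h ^ k := by
    rw [map_pow, hh, map_sub, map_one, map_mul, map_sub, hq, starHom_objPoly L hp, starHom_C,
      starHom_C, Complex.conj_ofReal, Complex.conj_ofReal]
  have heval : ∀ c ∈ E, eval (c ·) h = ((1 - X c / K : ℝ) : ℂ) := fun c hc => by
    rw [hh, map_sub, map_one, map_mul, map_sub, eval_C, eval_C, (hXE c hc).2]
    push_cast; rw [div_eq_inv_mul]; ring
  set g : FPoly n := C ((I⁻¹ : ℝ) : ℂ) * (starHom n (h ^ k) * h ^ k) with hg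
  have hgeval : ∀ c ∈ E, eval (c ·) g = ((I⁻¹ * (1 - X c / K) ^ (2 * k) : ℝ) : ℂ) := fun c hc => by
    rw [hg, hstar, map_mul, map_mul, map_pow, eval_C, heval c hc]
    push_cast; ring
  obtain ⟨d, ρ₃, hd⟩ := exists_mem_truncPoly (h ^ k)
  have hgQ : g ∈ quadModule n m N d ρ₃ := quadModule_C_mul (inv_nonneg.2 hpos.le) (quadModule_sq hd)
  have hone : densityMoments γ m N g 0 = 1 := by
    have : densityMoments γ m N g 0
        = ∫ c in E, ((I⁻¹ * (1 - X c / K) ^ (2 * k) : ℝ) : ℂ) ∂γ := by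
      refine setIntegral_congr_fun hEm fun c hc => ?_
      beta_reduce
      rw [hgeval c hc]; simp [monomialAt]
    rw [this, integral_complex_ofReal, integral_const_mul, ← hI, inv_mul_cancel₀ hpos.ne',
      Complex.ofReal_one]
  have hstate := isState_densityMoments hm (mem_quadModuleTop.2 ⟨_, _, hgQ⟩) hone
  have hval : (rieszLin (densityMoments γ m N g) q).re ≤ v + 3 * δ := by
    have h1 : rieszLin (densityMoments γ m N g) q
        = ∫ c in E, ((I⁻¹ * (X c * (1 - X c / K) ^ (2 * k))
          + v * (I⁻¹ * (1 - X c / K) ^ (2 * k)) : ℝ) : ℂ) ∂γ := by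
      rw [rieszLin_densityMoments hm]
      refine setIntegral_congr_fun hEm fun c hc => ?_
      beta_reduce
      rw [hgeval c hc, (hXE c hc).2]; push_cast; ring
    have hi1 : IntegrableOn (fun c => X c * (1 - X c / K) ^ (2 * k)) E γ :=
      (by fun_prop : Continuous fun c =>
        X c * (1 - X c / K) ^ (2 * k)).continuousOn.integrableOn_compact hEc
    have hi2 : IntegrableOn (fun c => (1 - X c / K) ^ (2 * k)) E γ :=
      (by fun_prop : Continuous fun c => (1 - X c / K) ^ (2 * k)).continuousOn.integrableOn_compact hEc
    have h2 : ∫ c in E, ((I⁻¹ * (X c * (1 - X c / K) ^ (2 * k))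
          + v * (I⁻¹ * (1 - X c / K) ^ (2 * k)) : ℝ) : ℂ) ∂γ
        = ((I⁻¹ * ∫ c in E, X c * (1 - X c / K) ^ (2 * k) ∂γ) + v : ℝ) := by
      rw [integral_complex_ofReal, integral_add (hi1.const_mul _)
        ((hi2.const_mul _).const_mul _), integral_const_mul, integral_const_mul,
        integral_const_mul, ← hI, inv_mul_cancel₀ hpos.ne', mul_one]
    rw [h1, h2, Complex.ofReal_re]
    have h3 : I⁻¹ * ∫ c in E, X c * (1 - X c / K) ^ (2 * k) ∂γ ≤ I⁻¹ * (3 * δ * I) :=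
      mul_le_mul_of_nonneg_left hle (inv_nonneg.2 hpos.le)
    rw [mul_comm (3 * δ), inv_mul_cancel_left₀ hpos.ne'] at h3
    linarith
  refine ⟨g, max d (max ρ₂ ρ₃), quadModule_mono (le_max_left _ _)
    ((le_max_right _ _).trans (le_max_right _ _)) hgQ, hone, fun ρ hρ => ?_⟩
  simp only [max_le_iff] at hρ
  -- Genuine moments are states at every level, so the tail estimate applies for all `ρ` with the
  -- same density.
  have hst : ∀ ρ, IsState (quadModule n m N p.totalDegree ρ) (densityMoments γ m N g) := fun ρ =>
    hstate.mono fun t ht => mem_quadModuleTop.2 ⟨_, _, ht⟩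
  have h1 := hρ₁ ρ _ _ (hρ₂'.trans hρ.2.1) le_rfl (hst ρ)
  have h2 := hρ₁ ρ₂ _ _ hρ₂' le_rfl (hst ρ₂)
  have h1' := (abs_le.1 ((Complex.abs_re_le_norm _).trans h1)).2
  have h2' := (abs_le.1 ((Complex.abs_re_le_norm _).trans h2)).1
  rw [Complex.sub_re] at h1' h2'
  rw [hq] at hval
  linarith

end SobolevPOP

end

/-! ### Values of the hierarchies and the convergence theorem. -/

noncomputable section

namespace SobolevPOP

open MvPolynomial

variable {n l m : ℕ} {N : SobolevNorm} {L : LInf n →L[ℝ] ℝ} {a : Fin l → Fin n → ℕ}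
  {p : CoeffPoly n l} {γ : Measure (EllTwo n)}

/-! ### The values of the hierarchies -/

lemma le_coneValue_outerCone {q : MIndex n → ℂ} {A : Set (MIndex n)} {Q : Set (FPoly n)} {x : EReal}
    (h : ∀ y, IsState Q y → x ≤ (((∑' β : A, q β * y β).re : ℝ) : EReal)) :
    x ≤ coneValue q A (outerCone Q A) := by
  refine le_iInf₂ fun z hz => ?_
  obtain ⟨⟨y, hy, rfl⟩, h0, h1⟩ := hz
  exact h y ⟨h1, fun t ht => (hy t ht).1, fun t ht => (hy t ht).2⟩

/-- Normalized inner points are moments of admissible densities, hence states, so they lie in the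
outer cone. -/
lemma coneValue_outerCone_le [IsLocallyFiniteMeasure γ] (hm : n < 2 * m) {q : MIndex n → ℂ}
    {A : Set (MIndex n)} {Q : Set (FPoly n)} (hQ : Q ⊆ quadModuleTop n m N) :
    coneValue q A (outerCone Q A) ≤ coneValue q A (innerCone γ (ellipsoid n m N) Q A) := by
  refine le_iInf₂ fun z hz => ?_
  obtain ⟨⟨g, hg, hz⟩, h0, h1⟩ := hz
  rw [hz] at h1
  have hst := (isState_densityMoments hm (hQ hg) h1).mono hQ
  refine iInf₂_le z ⟨⟨densityMoments γ m N g, fun t ht => ⟨hst.nonneg t ht, hst.im_eq t ht⟩, ?_⟩,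
    h0, ?_⟩
  · funext β; exact (hz β).symm
  · rw [hz]; exact h1

lemma coneValue_innerCone_le {q : MIndex n → ℂ} {A : Set (MIndex n)} {Q : Set (FPoly n)}
    (h0 : (0 : MIndex n) ∈ A) {g : FPoly n} (hg : g ∈ Q) (h1 : densityMoments γ m N g 0 = 1) :
    coneValue q A (innerCone γ (ellipsoid n m N) Q A)
      ≤ (((∑' β : A, q β * densityMoments γ m N g β).re : ℝ) : EReal) :=
  iInf₂_le (fun β : A => densityMoments γ m N g β) ⟨⟨g, hg, fun _ => rfl⟩, h0, h1⟩

lemma quadModule_subset_top (r ρ : ℕ) : quadModule n m N r ρ ⊆ quadModuleTop n m N :=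
  fun _ h => mem_quadModuleTop.2 ⟨r, ρ, h⟩

/-- Summability is essential: without it the `tsum` in `coneValue` could be the default value `0`,
unrelated to the truncations. -/
lemma tendsto_rieszLin_objPoly_tsum (ha : AdmissibleOrders a m) (hp : BoundedCoeffs p)
    {y : MIndex n → ℂ} (hy : IsState (quadModuleTop n m N) y) :
    Tendsto (fun ρ => (rieszLin y (objPoly L a p ρ)).re) atTop
      (𝓝 (∑' β : (Set.univ : Set (MIndex n)), objCoeff L a p β * y β).re) := by
  rw [tsum_univ fun β : MIndex n => objCoeff L a p β * y β]
  exact (Complex.continuous_re.tendsto _).comp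
    (tendsto_rieszLin_objPoly L (hy.summable ha hp).hasSum)

/-- Both hierarchies lie between `p^* - ε` and `p^* + ε` for large truncation degrees. -/
theorem exists_hierarchy_bounds [IsLocallyFiniteMeasure γ] (ha : AdmissibleOrders a m)
    (hp : BoundedCoeffs p) (hm : n < 2 * m)
    (hγ : ∀ U : Set (EllTwo n), IsOpen U → (U ∩ ellipsoid n m N).Nonempty →
      0 < γ (U ∩ ellipsoid n m N)) {v : ℝ} (hv : optValue m N L a p = v) {ε : ℝ} (hε : 0 < ε) :
    ∃ k, ∀ r ρ, k ≤ r → k ≤ ρ →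
      ((v - ε : ℝ) : EReal) ≤ pOut n m N (objCoeff L a p) r ρ ∧
      pInn n m N γ (objCoeff L a p) r ρ ≤ ((v + ε : ℝ) : EReal) := by
  obtain ⟨k₁, hk₁⟩ := eventually_le_rieszLin ha hp hv hε
  obtain ⟨g, k₂, hg, hg1, hk₂⟩ := exists_density ha hp hm hγ hv hε
  refine ⟨max p.totalDegree (max k₁ k₂), fun r ρ hr hρ => ?_⟩
  simp only [max_le_iff] at hr hρ
  constructor
  · refine le_coneValue_outerCone fun y hy => EReal.coe_le_coe_iff.2 ?_
    rw [tsum_indexSet L y hr.1]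
    exact hk₁ r ρ y hr.2.1 hρ.2.1 hy
  · refine (coneValue_innerCone_le (zero_mem_indexSet r ρ)
      (quadModule_mono hr.2.2 hρ.2.2 hg) hg1).trans (EReal.coe_le_coe_iff.2 ?_)
    rw [tsum_indexSet L _ hr.1]
    exact hk₂ ρ hρ.2.2

/-- A state of `Q_{∞,∞}` is a state of each `Q_{ρ,ρ}`, so the finite-level bounds pass to the limit
of the truncated sums. -/
theorem hierarchyTop_bounds [IsLocallyFiniteMeasure γ] (ha : AdmissibleOrders a m)
    (hp : BoundedCoeffs p) (hm : n < 2 * m)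
    (hγ : ∀ U : Set (EllTwo n), IsOpen U → (U ∩ ellipsoid n m N).Nonempty →
      0 < γ (U ∩ ellipsoid n m N)) {v : ℝ} (hv : optValue m N L a p = v) {ε : ℝ} (hε : 0 < ε) :
    ((v - ε : ℝ) : EReal) ≤ pOutTop n m N (objCoeff L a p) ∧
      pInnTop n m N γ (objCoeff L a p) ≤ ((v + ε : ℝ) : EReal) := by
  obtain ⟨k₁, hk₁⟩ := eventually_le_rieszLin ha hp hv hε
  obtain ⟨g, k₂, hg, hg1, hk₂⟩ := exists_density ha hp hm hγ hv hε
  constructor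
  · refine le_coneValue_outerCone fun y hy => EReal.coe_le_coe_iff.2 ?_
    refine ge_of_tendsto (tendsto_rieszLin_objPoly_tsum ha hp hy) ?_
    filter_upwards [eventually_ge_atTop k₁] with ρ hρ
    exact hk₁ ρ ρ y hρ hρ (hy.mono (quadModule_subset_top _ _))
  · have hgt := quadModule_subset_top _ _ hg
    refine (coneValue_innerCone_le (Set.mem_univ _) hgt hg1).trans (EReal.coe_le_coe_iff.2 ?_)
    refine le_of_tendsto
      (tendsto_rieszLin_objPoly_tsum ha hp (isState_densityMoments hm hgt hg1)) ?_
    filter_upwards [eventually_ge_atTop k₂] with ρ hρ using hk₂ ρ hρ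

lemma ereal_eq_coe_of_forall_bounds {x : EReal} {v : ℝ}
    (h : ∀ ε : ℝ, 0 < ε → ((v - ε : ℝ) : EReal) ≤ x ∧ x ≤ ((v + ε : ℝ) : EReal)) : x = v := by
  refine le_antisymm (EReal.le_of_forall_lt_iff_le.1 fun z hz => ?_)
    (EReal.ge_of_forall_gt_iff_ge.1 fun z hz => ?_)
  · have hz := EReal.coe_lt_coe_iff.1 hz
    simpa using (h (z - v) (by linarith)).2
  · have hz := EReal.coe_lt_coe_iff.1 hz
    simpa using (h (v - z) (by linarith)).1

lemma ereal_tendsto_coe_of_forall_bounds {u : ℕ × ℕ → EReal} {v : ℝ}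
    (h : ∀ ε : ℝ, 0 < ε → ∃ k, ∀ r ρ, k ≤ r → k ≤ ρ →
      ((v - ε : ℝ) : EReal) ≤ u (r, ρ) ∧ u (r, ρ) ≤ ((v + ε : ℝ) : EReal)) :
    Tendsto u (atTop ×ˢ atTop) (𝓝 (v : EReal)) := by
  have key : ∀ ε : ℝ, 0 < ε → ∀ᶠ x in atTop ×ˢ atTop,
      ((v - ε : ℝ) : EReal) ≤ u x ∧ u x ≤ ((v + ε : ℝ) : EReal) := fun ε hε => by
    obtain ⟨k, hk⟩ := h ε hε
    filter_upwards [(eventually_ge_atTop k).prod_mk (eventually_ge_atTop k)] with x hx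
    exact hk x.1 x.2 hx.1 hx.2
  refine tendsto_order.2 ⟨fun b hb => ?_, fun b hb => ?_⟩
  · obtain ⟨z, hz1, hz2⟩ := EReal.lt_iff_exists_real_btwn.1 hb
    filter_upwards [key (v - z) (by linarith [EReal.coe_lt_coe_iff.1 hz2])] with x hx
    rw [sub_sub_cancel] at hx
    exact hz1.trans_le hx.1
  · obtain ⟨z, hz1, hz2⟩ := EReal.lt_iff_exists_real_btwn.1 hb
    filter_upwards [key (z - v) (by linarith [EReal.coe_lt_coe_iff.1 hz1])] with x hx
    rw [add_sub_cancel] at hx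
    exact hx.2.trans_lt hz2

end SobolevPOP

end

theorem mainTheorem2 (n m l : ℕ) (hn : 0 < n) (a : Fin l → Fin n → ℕ)
    (hm : 2 * (Finset.univ.sup fun j => SobolevPOP.order (a j)) + n < 2 * m)
    (N : SobolevPOP.SobolevNorm)
    (p : SobolevPOP.CoeffPoly n l) (hp : SobolevPOP.BoundedCoeffs p)
    (L : SobolevPOP.LInf n →L[ℝ] ℝ)
    (γ : Measure (SobolevPOP.EllTwo n)) [IsLocallyFiniteMeasure γ]
    (hγ : ∀ U : Set (SobolevPOP.EllTwo n), IsOpen U →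
      (U ∩ SobolevPOP.ellipsoid n m N).Nonempty → 0 < γ (U ∩ SobolevPOP.ellipsoid n m N)) :
    -- the objective is well defined on the ball
    (∀ f ∈ SobolevPOP.ball n m N,
      MemLp (SobolevPOP.integrand a p f) ∞ (SobolevPOP.torusMeasure n)) ∧
    -- it is a polynomial of finite algebraic degree in the Fourier coefficients
    (∀ β, p.totalDegree < SobolevPOP.algDeg β → SobolevPOP.objCoeff L a p β = 0) ∧
    (∀ f ∈ SobolevPOP.ball n m N,
      HasSum (fun β => SobolevPOP.objCoeff L a p β *
          SobolevPOP.monomialAt (SobolevPOP.fourierCoeff f) β)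
        (SobolevPOP.objective L a p f : ℂ)) ∧
    -- the optimal value is finite
    (∃ v : ℝ, SobolevPOP.optValue m N L a p = v) ∧
    -- the limit values of the two hierarchies
    SobolevPOP.pOutTop n m N (SobolevPOP.objCoeff L a p) = SobolevPOP.optValue m N L a p ∧
    SobolevPOP.pInnTop n m N γ (SobolevPOP.objCoeff L a p) = SobolevPOP.optValue m N L a p ∧
    -- convergence of the two hierarchies as both truncation degrees go to infinity
    Tendsto (fun rρ : ℕ × ℕ => SobolevPOP.pOut n m N (SobolevPOP.objCoeff L a p) rρ.1 rρ.2)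
      (atTop ×ˢ atTop) (𝓝 (SobolevPOP.optValue m N L a p)) ∧
    Tendsto (fun rρ : ℕ × ℕ => SobolevPOP.pInn n m N γ (SobolevPOP.objCoeff L a p) rρ.1 rρ.2)
      (atTop ×ˢ atTop) (𝓝 (SobolevPOP.optValue m N L a p)) := by
  have ha := SobolevPOP.admissibleOrders hm
  have hm' : n < 2 * m := by omega
  obtain ⟨v, hv⟩ := SobolevPOP.exists_optValue_eq ha hp N L
  -- Outer values are at most inner ones, so a lower bound for the former and an upper bound for the
  -- latter squeeze both hierarchies.
  have htop : SobolevPOP.pOutTop n m N (SobolevPOP.objCoeff L a p)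
      ≤ SobolevPOP.pInnTop n m N γ (SobolevPOP.objCoeff L a p) :=
    SobolevPOP.coneValue_outerCone_le hm' subset_rfl
  have hle : ∀ r ρ, SobolevPOP.pOut n m N (SobolevPOP.objCoeff L a p) r ρ
      ≤ SobolevPOP.pInn n m N γ (SobolevPOP.objCoeff L a p) r ρ := fun r ρ =>
    SobolevPOP.coneValue_outerCone_le hm' (SobolevPOP.quadModule_subset_top r ρ)
  refine ⟨fun f hf => (SobolevPOP.objective_expansion L ha hp hf).1,
    fun β hβ => SobolevPOP.objCoeff_eq_zero L a hβ,
    fun f hf => (SobolevPOP.objective_expansion L ha hp hf).2, ⟨v, hv⟩, ?_⟩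
  rw [hv]
  refine ⟨SobolevPOP.ereal_eq_coe_of_forall_bounds fun ε hε => ?_,
    SobolevPOP.ereal_eq_coe_of_forall_bounds fun ε hε => ?_,
    SobolevPOP.ereal_tendsto_coe_of_forall_bounds fun ε hε => ?_,
    SobolevPOP.ereal_tendsto_coe_of_forall_bounds fun ε hε => ?_⟩
  · have h := SobolevPOP.hierarchyTop_bounds ha hp hm' hγ hv hε
    exact ⟨h.1, htop.trans h.2⟩
  · have h := SobolevPOP.hierarchyTop_bounds ha hp hm' hγ hv hε
    exact ⟨h.1.trans htop, h.2⟩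
  · obtain ⟨k, hk⟩ := SobolevPOP.exists_hierarchy_bounds ha hp hm' hγ hv hε
    exact ⟨k, fun r ρ hr hρ => ⟨(hk r ρ hr hρ).1, (hle r ρ).trans (hk r ρ hr hρ).2⟩⟩
  · obtain ⟨k, hk⟩ := SobolevPOP.exists_hierarchy_bounds ha hp hm' hγ hv hε
    exact ⟨k, fun r ρ hr hρ => ⟨(hk r ρ hr hρ).1.trans (hle r ρ), (hk r ρ hr hρ).2⟩⟩
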